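/- **Setting.** Let $L\ge 1$ and let $\mathbb T_L=(\mathbb Z/4L\mathbb Z)^3$, regarded as $L\times L\times L$ unit cells of side $4$ with periodic boundary conditions. The bitruncated cubic honeycomb in $\mathbb T_L$ has $2L^3$ three-cells (truncated octahedra) centred at the points whose coordinates are all $\equiv 0$ or all $\equiv 2 \pmod 4$; $12L^3$ vertices, namely the points with one coordinate $\equiv 0$, one $\equiv 2 \pmod 4$ and one odd; and $n=14L^3$ plaquettes (two-cells): $6L^3$ squares and $8L^3$ hexagons. The squares are called $Y$-plaquettes. The hexagons are centred at the points with three odd coordinates, and are called $X$- or $Z$-plaquettes according to whether the product of these coordinates is $\equiv 1$ or $\equiv 3 \pmod 4$; so on each truncated octahedron four hexagons are $X$ and four are $Z$, and hexagons that share an edge are of different kinds. Put a qubit on every vertex, let $B_p$ be the product of the Pauli operators $X_i$, $Y_i$ or $Z_i$ (according to the kind of $p$) over the vertices $i$ of $p$, and for $J>0$ let $$H_L=-J\sum_p B_p ,\qquad Z_L(\beta,J)=\operatorname{tr} e^{-\beta H_L}.$$ The dual lattice has the three-cells as sites and the plaquettes as bonds: $p$ joins the two cells $p_\pm$ that share it.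 For $s\in\{\pm1\}^3$ let $$Z^{\rm Ising}_{L,s}(K)=\sum_{\sigma}\exp\Big(K\sum_p \epsilon_s(p)\,\sigma_{p_+}\sigma_{p_-}\Big)$$ be the partition function of the classical Ising model on the dual lattice, periodic in direction $i$ if $s_i=1$ and antiperiodic if $s_i=-1$ (that is, $\epsilon_s(p)$ is the product of the $s_i$ over the directions $i$ in which the bond $p$ crosses the boundary of the box $[0,4L)^3$). Write $Z^{\rm Ising}_L$ for $s=(1,1,1)$. For $x>0$ put $$\tilde K(x)=-\tfrac12\ln\tanh x,\qquad C_L(x)=2^{12L^3-1}\big(\tfrac12\sinh 2x\big)^{7L^3}.$$ **Theorem.** The model with coupling constant $\beta J$ is dual to the classical Ising model on the dual lattice with coupling constant $\tilde K(\beta J)=-\frac12\ln\tanh\beta J$, up to the constant $C_L(\beta J)$ and in the thermodynamic limit, and it has a phase transition at a finite positive temperature. Precisely: 1. For all $L\ge1$ and $\beta,J>0$, $$C_L(\beta J)\,Z^{\rm Ising}_L(\tilde K(\beta J))\le Z_L(\beta,J)\le 16\,C_L(\beta J)\,Z^{\rm Ising}_L(\tilde K(\beta J)).$$ 2. For all $\beta,J>0$,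 $$\lim_{L\to\infty}\frac{Z_L(\beta,J)}{C_L(\beta J)\sum_{s\in\{\pm1\}^3}Z^{\rm Ising}_{L,s}(\tilde K(\beta J))}=1 .$$ 3. There are functions $\varphi,\psi:\mathbb R\to\mathbb R$ such that for all $K,\beta,J>0$ we have $\psi(K)=\lim_{L}\frac1{2L^3}\ln Z^{\rm Ising}_L(K)$ and $\varphi(\beta J)=\lim_{L}\frac1{2L^3}\ln Z_L(\beta,J)$, and for all $x>0$ $$\varphi(x)=6\ln 2+\tfrac72\ln\big(\tfrac12\sinh 2x\big)+\psi(\tilde K(x)).$$ Moreover, for every $x>0$, $\varphi$ is real-analytic at $x$ if and only if $\psi$ is real-analytic at $\tilde K(x)$. 4. For $0\le m<L$ let $Z_L^{(m)}(\beta,J)$ be the partition function of the model in which the sign of $J$ is reversed on the $m$ square plaquettes crossed by the segment from the cell centred at $(0,0,0)$ to the cell centred at $(4m,0,0)$ (this frustrates these two cells), and let $F_L^{(m)}(\beta,J)=-\beta^{-1}\ln\big(Z_L^{(m)}/Z_L\big)$ be the corresponding free-energy cost. There is a critical value $x_c\in(0,\infty)$ such that for all $\beta,J>0$: if $\beta J<x_c$,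 then $F_L^{(m)}(\beta,J)$ is bounded above by a constant independent of $L\ge1$ and $0\le m<L$; if $\beta J>x_c$, then there is no such constant. -/

import Mathlib

open Filter Topology

namespace BitruncatedCubic

/-! ### The bitruncated cubic honeycomb with periodic boundary conditions

All positions are points of the discrete torus `(ℤ/4L)³`; a cubic unit cell of the honeycomb has side
`4`, so the torus consists of `L × L × L` unit cells.  The 3-cells are the truncated octahedra whose
24 vertices are the permutations of `(0, ±1, ±2)` around the centre of the cell; the centres form the
body-centred cubic lattice `4ℤ³ ∪ (4ℤ³ + (2,2,2))`. -/

/-- Points of the discrete torus `(ℤ/4L)³`. -/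
abbrev Point (L : ℕ) : Type := Fin 3 → ZMod (4 * L)

/-- The `i`-th coordinate of a point, modulo `4`. -/
def res {L : ℕ} (p : Point L) (i : Fin 3) : ZMod 4 :=
  ZMod.castHom (Dvd.intro L rfl) (ZMod 4) (p i)

/-- The vertices of the honeycomb (where the qubits sit): one coordinate is `0` mod `4`, one is `2`
mod `4`, and one is odd. -/
def Vertex (L : ℕ) : Type :=
  {v : Point L // ∃ π : Equiv.Perm (Fin 3),
    res v (π 0) = 0 ∧ res v (π 1) = 2 ∧ (res v (π 2) = 1 ∨ res v (π 2) = 3)}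

/-- The 3-cells (truncated octahedra), given by their centres. These are the sites of the dual
lattice. -/
def Cell (L : ℕ) : Type :=
  {c : Point L // (∀ i, res c i = 0) ∨ (∀ i, res c i = 2)}

/-- The square plaquettes, given by the axis orthogonal to the square and its centre: the centre is
the midpoint of two cells at distance `4` along that axis. -/
def Square (L : ℕ) : Type :=
  {q : Fin 3 × Point L // (res q.2 q.1 = 0 ∨ res q.2 q.1 = 2) ∧
    ∀ j, j ≠ q.1 → res q.2 j = res q.2 q.1 + 2}

/-- The hexagonal plaquettes, given by their centres, the points with three odd coordinates. -/
def Hexagon (L : ℕ) : Type :=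
  {p : Point L // ∀ i, res p i = 1 ∨ res p i = 3}

/-- The plaquettes (2-cells) of the honeycomb. -/
abbrev Plaquette (L : ℕ) : Type := Square L ⊕ Hexagon L

/-- The centre of a plaquette. -/
def center {L : ℕ} : Plaquette L → Point L
  | Sum.inl q => q.1.2
  | Sum.inr h => h.1

/-- The vector, normal to the plaquette, from the centre of the plaquette to the centre of one of the
two 3-cells that share it: `2 eᵢ` for a square with axis `i`, and `(±1, ±1, ±1)` for a hexagon. -/
def normal {L : ℕ} : Plaquette L → Fin 3 → ℤ
  | Sum.inl q => Pi.single q.1.1 2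
  | Sum.inr h => fun i => if res h.1 i = 1 then 1 else -1

/-- `OnPlaquette v p`: the vertex `v` is one of the vertices of the plaquette `p`. A square with axis
`i` and centre `c` has the four vertices `c ± eⱼ` with `j ≠ i`; a hexagon with centre `c` and normal
`n` has the six vertices `c + nₖ eₖ - nⱼ eⱼ` with `j ≠ k`. -/
def OnPlaquette {L : ℕ} (v : Vertex L) : Plaquette L → Prop
  | Sum.inl q => ∃ j, j ≠ q.1.1 ∧
      (v.1 = q.1.2 + Pi.single j 1 ∨ v.1 = q.1.2 - Pi.single j 1)
  | Sum.inr h => ∃ j k, j ≠ k ∧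
      v.1 = h.1 + Pi.single k ((normal (Sum.inr h) k : ℤ) : ZMod (4 * L))
                - Pi.single j ((normal (Sum.inr h) j : ℤ) : ZMod (4 * L))

noncomputable instance instFintypeVertex (L : ℕ) [NeZero L] : Fintype (Vertex L) :=
  have : Finite (Vertex L) := inferInstanceAs (Finite (Subtype _))
  Fintype.ofFinite _

noncomputable instance instFintypeCell (L : ℕ) [NeZero L] : Fintype (Cell L) :=
  have : Finite (Cell L) := inferInstanceAs (Finite (Subtype _))
  Fintype.ofFinite _

noncomputable instance instFintypeSquare (L : ℕ) [NeZero L] : Fintype (Square L) :=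
  have : Finite (Square L) := inferInstanceAs (Finite (Subtype _))
  Fintype.ofFinite _

noncomputable instance instFintypeHexagon (L : ℕ) [NeZero L] : Fintype (Hexagon L) :=
  have : Finite (Hexagon L) := inferInstanceAs (Finite (Subtype _))
  Fintype.ofFinite _

noncomputable instance instDecidableEqVertex (L : ℕ) : DecidableEq (Vertex L) :=
  Classical.decEq _

noncomputable instance instDecidableEqCell (L : ℕ) : DecidableEq (Cell L) :=
  Classical.decEq _

/-! ### The quantum model -/

/-- The Pauli matrix `σˣ`. -/
def pauliX : Matrix (Fin 2) (Fin 2) ℂ := !![0, 1; 1, 0]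

/-- The Pauli matrix `σʸ`. -/
def pauliY : Matrix (Fin 2) (Fin 2) ℂ := !![0, -Complex.I; Complex.I, 0]

/-- The Pauli matrix `σᶻ`. -/
def pauliZ : Matrix (Fin 2) (Fin 2) ℂ := !![1, 0; 0, -1]

/-- The kind of a plaquette: squares are `Y`-plaquettes; the eight hexagons of each truncated
octahedron are alternately `X`- and `Z`-plaquettes, so that two hexagons which share an edge are of
different kinds (and at each vertex two plaquettes that share no edge are of the same kind). -/
noncomputable def plaquettePauli {L : ℕ} : Plaquette L → Matrix (Fin 2) (Fin 2) ℂ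
  | Sum.inl _ => pauliY
  | Sum.inr h => if ∏ i, res h.1 i = 1 then pauliX else pauliZ

/-- The tensor product `⨂ᵥ M v` of one-qubit operators, as a matrix in the computational basis
`V → {0, 1}`. -/
def tensorOp {V : Type} [Fintype V] (M : V → Matrix (Fin 2) (Fin 2) ℂ) :
    Matrix (V → Fin 2) (V → Fin 2) ℂ :=
  Matrix.of fun s t => ∏ v, M v (s v) (t v)

open Classical in
/-- The plaquette operator `B_p`: the Pauli matrix of the kind of `p` on each vertex of `p`, and the
identity on all other vertices. -/
noncomputable def plaquetteOp {L : ℕ} [NeZero L] (p : Plaquette L) :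
    Matrix (Vertex L → Fin 2) (Vertex L → Fin 2) ℂ :=
  tensorOp fun v => if OnPlaquette v p then plaquettePauli p else 1

/-- The Hamiltonian `H = -∑_p g_p B_p` with a real coupling `g_p` for each plaquette. -/
noncomputable def hamiltonian (L : ℕ) [NeZero L] (g : Plaquette L → ℝ) :
    Matrix (Vertex L → Fin 2) (Vertex L → Fin 2) ℂ :=
  -∑ p, (g p : ℂ) • plaquetteOp p

/-- The partition function `tr exp(-β H)`; this trace is real, see `trace_exp_eq`. -/
noncomputable def partitionFunction (L : ℕ) [NeZero L] (β : ℝ) (g : Plaquette L → ℝ) : ℝ :=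
  (Matrix.trace (NormedSpace.exp (-(β : ℂ) • hamiltonian L g))).re

theorem tensorOp_isHermitian {V : Type} [Fintype V] {M : V → Matrix (Fin 2) (Fin 2) ℂ}
    (hM : ∀ v, (M v).IsHermitian) : (tensorOp M).IsHermitian := by
  ext s t
  simp only [tensorOp, Matrix.conjTranspose_apply, Matrix.of_apply, star_prod]
  exact Finset.prod_congr rfl fun v _ => (hM v).apply _ _

theorem plaquettePauli_isHermitian {L : ℕ} (p : Plaquette L) :
    (plaquettePauli p).IsHermitian := by
  have hX : pauliX.IsHermitian := by
    ext i j; fin_cases i <;> fin_cases j <;> simp [pauliX]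
  have hY : pauliY.IsHermitian := by
    ext i j; fin_cases i <;> fin_cases j <;> simp [pauliY]
  have hZ : pauliZ.IsHermitian := by
    ext i j; fin_cases i <;> fin_cases j <;> simp [pauliZ]
  rcases p with q | h
  · exact hY
  · simp only [plaquettePauli]
    split_ifs
    · exact hX
    · exact hZ

theorem hamiltonian_isHermitian (L : ℕ) [NeZero L] (g : Plaquette L → ℝ) :
    (hamiltonian L g).IsHermitian := by
  have hB : ∀ p : Plaquette L, (plaquetteOp p).IsHermitian := by
    intro p
    refine tensorOp_isHermitian fun v => ?_
    split_ifs
    · exact plaquettePauli_isHermitian p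
    · exact Matrix.isHermitian_one
  simp only [Matrix.IsHermitian, hamiltonian, Matrix.conjTranspose_neg, Matrix.conjTranspose_sum,
    Matrix.conjTranspose_smul, (hB _).eq]
  simp

/-- The trace of the Boltzmann weight is real, so that `partitionFunction` is that trace. -/
theorem trace_exp_eq (L : ℕ) [NeZero L] (β : ℝ) (g : Plaquette L → ℝ) :
    ((partitionFunction L β g : ℝ) : ℂ) =
      Matrix.trace (NormedSpace.exp (-(β : ℂ) • hamiltonian L g)) := by
  have h1 : (-(β : ℂ) • hamiltonian L g).IsHermitian := by
    simp [Matrix.IsHermitian, Matrix.conjTranspose_smul, (hamiltonian_isHermitian L g).eq]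
  have h2 := h1.exp
  apply Complex.conj_eq_iff_re.mp
  have h3 := Matrix.trace_conjTranspose (NormedSpace.exp (-(β : ℂ) • hamiltonian L g))
  rw [h2.eq] at h3
  exact h3.symm

/-! ### The classical Ising model on the dual lattice

The sites of the dual lattice are the 3-cells, and its bonds are the plaquettes: a plaquette with
centre `c` and normal `n` joins the two cells `c + n` and `c - n`. -/

theorem end_isCell {L : ℕ} (p : Plaquette L) (ε : ℤ) (hε : ε = 1 ∨ ε = -1) :
    let c : Point L := fun i => center p i + ((ε * normal p i : ℤ) : ZMod (4 * L))
    (∀ i, res c i = 0) ∨ (∀ i, res c i = 2) := by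
  intro c
  have hres : ∀ i, res c i = res (center p) i + ((ε * normal p i : ℤ) : ZMod 4) := by
    intro i
    simp only [c, res, map_add, map_intCast]
  simp only [hres]
  rcases p with ⟨⟨a, x⟩, h1, h2⟩ | ⟨x, h⟩
  · simp only [center, normal] at *
    have key : ∀ i, res x i + ((ε * (Pi.single a 2 : Fin 3 → ℤ) i : ℤ) : ZMod 4)
        = res x a + 2 := by
      intro i
      by_cases hi : i = a
      · subst hi
        rcases hε with rfl | rfl
        · simp
        · simp only [Pi.single_eq_same]
          congr 1
      · simp [Pi.single_eq_of_ne hi, h2 i hi]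
    simp only [key]
    rcases h1 with h1 | h1
    · right; intro _; rw [h1]; decide
    · left; intro _; rw [h1]; decide
  · simp only [center, normal]
    rcases hε with rfl | rfl
    · right
      intro i
      rcases h i with hi | hi <;> rw [hi] <;> decide
    · left
      intro i
      rcases h i with hi | hi <;> rw [hi] <;> decide

/-- The cell `c + n` of a plaquette with centre `c` and normal `n`. -/
def cellAbove {L : ℕ} (p : Plaquette L) : Cell L :=
  ⟨fun i => center p i + ((1 * normal p i : ℤ) : ZMod (4 * L)), end_isCell p 1 (Or.inl rfl)⟩

/-- The cell `c - n` of a plaquette with centre `c` and normal `n`. -/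
def cellBelow {L : ℕ} (p : Plaquette L) : Cell L :=
  ⟨fun i => center p i + ((-1 * normal p i : ℤ) : ZMod (4 * L)), end_isCell p (-1) (Or.inr rfl)⟩

/-- The dual bond of `p` crosses the boundary of the box `[0, 4L)³` in direction `i`. -/
def Wraps {L : ℕ} (p : Plaquette L) (i : Fin 3) : Prop :=
  (center p i).val < (normal p i).natAbs ∨ 4 * L ≤ (center p i).val + (normal p i).natAbs

open Classical in
/-- The sign of the dual bond of `p` for the boundary conditions `s`: in direction `i` these are
periodic if `s i = 1` and antiperiodic if `s i = -1`. -/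
noncomputable def bondSign {L : ℕ} (s : Fin 3 → ℤˣ) (p : Plaquette L) : ℤˣ :=
  ∏ i, if Wraps p i then s i else 1

/-- The partition function of the classical ferromagnetic Ising model on the dual lattice with
coupling constant `K` (which includes the inverse temperature) and the boundary conditions `s`:
`∑_σ exp(K ∑_{bonds} ± σ σ')`, without magnetic field. -/
noncomputable def isingTwisted (L : ℕ) [NeZero L] (s : Fin 3 → ℤˣ) (K : ℝ) : ℝ :=
  ∑ σ : Cell L → ℤˣ, Real.exp (K * ∑ p : Plaquette L,
    (((bondSign s p * σ (cellAbove p) * σ (cellBelow p) : ℤˣ) : ℤ) : ℝ))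

/-- The partition function of the Ising model on the dual lattice, periodic boundary conditions. -/
noncomputable def isingPartition (L : ℕ) [NeZero L] (K : ℝ) : ℝ :=
  isingTwisted L (fun _ => 1) K

/-- The dual coupling constant `-½ ln tanh x`. -/
noncomputable def dualCoupling (x : ℝ) : ℝ := -(1 / 2) * Real.log (Real.tanh x)

/-- The constant of the duality relation: `2 ^ (12 L³ - 1) (½ sinh 2x) ^ (7 L³)`, where `12 L³` is the
number of vertices and `7 L³` is half the number of plaquettes. -/
noncomputable def dualityConstant (L : ℕ) (x : ℝ) : ℝ :=
  2 ^ (12 * L ^ 3 - 1) * (Real.sinh (2 * x) / 2) ^ (7 * L ^ 3)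

/-! ### The free energy of a pair of frustrated cells -/

/-- The square plaquettes that separate consecutive cells among the `m + 1` cells with centres
`(0,0,0), (4,0,0), …, (4m,0,0)`. -/
def OnDefectLine {L : ℕ} (m : ℕ) : Plaquette L → Prop
  | Sum.inl q => q.1.1 = 0 ∧ ∃ k < m, q.1.2 = Pi.single 0 ((4 * k + 2 : ℕ) : ZMod (4 * L))
  | Sum.inr _ => False

open Classical in
/-- The couplings `J`, with the sign reversed on the plaquettes that are crossed by the segment from
the cell `(0,0,0)` to the cell `(4m,0,0)`. Only at these two cells is the product of the signs of the
couplings over the faces of the cell equal to `-1` (for `0 < m < L`), while the product of the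
plaquette operators is `1`: the two cells are frustrated. -/
noncomputable def defectCoupling {L : ℕ} (m : ℕ) (J : ℝ) (p : Plaquette L) : ℝ :=
  if OnDefectLine m p then -J else J

/-- The free energy that it costs, at inverse temperature `β`, to frustrate two cells at distance `m`
unit cells: `-β⁻¹ ln (Z_defect / Z)`. -/
noncomputable def defectFreeEnergy (L : ℕ) [NeZero L] (m : ℕ) (β J : ℝ) : ℝ :=
  -(1 / β) * Real.log
    (partitionFunction L β (defectCoupling m J) / partitionFunction L β (fun _ => J))

end BitruncatedCubic

open BitruncatedCubic

namespace BitruncatedCubic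

/-! ### Functions of positive type on a finite group and Griffiths' inequalities -/

section PosType

variable {G : Type*} [CommGroup G]

/-- Nonnegative linear combinations of `±1`-valued characters. -/
inductive PosType : (G → ℝ) → Prop
  | char (c : ℝ) (hc : 0 ≤ c) (χ : G →* ℤˣ) : PosType fun g => c * ((χ g : ℤ) : ℝ)
  | add (f f' : G → ℝ) : PosType f → PosType f' → PosType fun g => f g + f' g

theorem PosType.const {c : ℝ} (hc : 0 ≤ c) : PosType fun _ : G => c := by
  simpa using PosType.char c hc (1 : G →* ℤˣ)

theorem PosType.mul {f f' : G → ℝ} (h : PosType f) (h' : PosType f') :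
    PosType fun g => f g * f' g := by
  induction h with
  | char c hc χ =>
    induction h' with
    | char c' hc' χ' =>
      have := PosType.char (c * c') (mul_nonneg hc hc') (χ * χ')
      convert this using 2 with g
      simp; ring
    | add f f' _ _ ih ih' =>
      convert PosType.add _ _ ih ih' using 2 with g
      ring
  | add f f' _ _ ih ih' =>
    convert PosType.add _ _ ih ih' using 2 with g
    ring

theorem PosType.prod {ι : Type*} (s : Finset ι) {f : ι → G → ℝ} (h : ∀ i ∈ s, PosType (f i)) :
    PosType fun g => ∏ i ∈ s, f i g := by
  classical
  induction s using Finset.induction_on with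
  | empty => simpa using PosType.const (G := G) zero_le_one
  | insert a s ha ih =>
    simp only [Finset.prod_insert ha]
    exact (h a (by simp)).mul (ih fun i hi => h i (by simp [hi]))

theorem exp_mul_sign (K : ℝ) (u : ℤˣ) :
    Real.exp (K * ((u : ℤ) : ℝ)) = Real.cosh K + Real.sinh K * ((u : ℤ) : ℝ) := by
  rcases Int.units_eq_one_or u with rfl | rfl
  · simp [Real.cosh_add_sinh]
  · simp [← Real.cosh_sub_sinh, sub_eq_add_neg]

theorem PosType.exp_char {K : ℝ} (hK : 0 ≤ K) (χ : G →* ℤˣ) :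
    PosType fun g => Real.exp (K * ((χ g : ℤ) : ℝ)) := by
  simp only [exp_mul_sign]
  exact .add _ _ (.const (Real.cosh_pos K).le) (.char _ (Real.sinh_nonneg_iff.2 hK) χ)

theorem PosType.exp_sum_char {ι : Type*} (s : Finset ι) {K : ι → ℝ} (hK : ∀ i, 0 ≤ K i)
    (χ : ι → G →* ℤˣ) : PosType fun g => Real.exp (∑ i ∈ s, K i * ((χ i g : ℤ) : ℝ)) := by
  simp only [Real.exp_sum]
  exact .prod s fun i _ => .exp_char (hK i) (χ i)

variable [Fintype G]

theorem sum_char_eq (χ : G →* ℤˣ) :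
    ∑ g, ((χ g : ℤ) : ℝ) = if χ = 1 then (Fintype.card G : ℝ) else 0 := by
  split_ifs with h
  · simp [h]
  · obtain ⟨x, hx⟩ : ∃ x, χ x ≠ 1 := by
      by_contra! hc
      exact h (MonoidHom.ext hc)
    have hx' : χ x = -1 := (Int.units_eq_one_or _).resolve_left hx
    have h1 : ∑ g, ((χ g : ℤ) : ℝ) = ∑ g, ((χ (x * g) : ℤ) : ℝ) :=
      (Equiv.sum_comp (Equiv.mulLeft x) fun g => ((χ g : ℤ) : ℝ)).symm
    simp only [map_mul, hx', neg_mul, one_mul, Units.val_neg, Int.cast_neg,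
      Finset.sum_neg_distrib] at h1
    linarith

theorem PosType.sum_nonneg {f : G → ℝ} (h : PosType f) : 0 ≤ ∑ g, f g := by
  induction h with
  | char c hc χ =>
    rw [← Finset.mul_sum, sum_char_eq]
    split_ifs <;> positivity
  | add f f' _ _ ih ih' => rw [Finset.sum_add_distrib]; exact add_nonneg ih ih'

omit [Fintype G] in
theorem PosType.sub_translate {f : G → ℝ} (hf : PosType f) (h : G) :
    PosType fun g => f g - f (g * h) := by
  induction hf with
  | char c hc χ =>
    have : (0 : ℝ) ≤ c * (1 - ((χ h : ℤ) : ℝ)) := by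
      rcases Int.units_eq_one_or (χ h) with e | e
      · simp [e]
      · simp [e]; linarith
    convert PosType.char _ this χ using 2 with g
    simp; ring
  | add f f' _ _ ih ih' =>
    convert PosType.add _ _ ih ih' using 2 with g
    ring

/-- The second inequality of Griffiths, in the form of Ginibre. -/
theorem griffiths {ι : Type*} [Fintype ι] {K : ι → ℝ} (hK : ∀ i, 0 ≤ K i) (χ : ι → G →* ℤˣ)
    {f w : G → ℝ} (hf : PosType f) (hw : PosType w) :
    (∑ g, f g * Real.exp (∑ i, K i * ((χ i g : ℤ) : ℝ))) *
        (∑ g, w g * Real.exp (∑ i, K i * ((χ i g : ℤ) : ℝ))) ≤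
      (∑ g, f g * w g * Real.exp (∑ i, K i * ((χ i g : ℤ) : ℝ))) *
        ∑ g, Real.exp (∑ i, K i * ((χ i g : ℤ) : ℝ)) := by
  set ρ : G → ℝ := fun g => Real.exp (∑ i, K i * ((χ i g : ℤ) : ℝ)) with hρ
  have key : ∀ h : G, 0 ≤ ∑ g, (f g - f (g * h)) * (w g - w (g * h)) * (ρ g * ρ (g * h)) := by
    intro h
    refine PosType.sum_nonneg (((hf.sub_translate h).mul (hw.sub_translate h)).mul ?_)
    have : ∀ i, 0 ≤ K i * (1 + ((χ i h : ℤ) : ℝ)) := fun i => by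
      have := hK i
      rcases Int.units_eq_one_or (χ i h) with e | e <;> simp [e]; linarith
    convert PosType.exp_sum_char Finset.univ this χ using 2 with g
    rw [hρ, ← Real.exp_add, ← Finset.sum_add_distrib]
    congr 1
    refine Finset.sum_congr rfl fun i _ => ?_
    simp; ring
  have h1 : 0 ≤ ∑ h : G, ∑ g, (f g - f (g * h)) * (w g - w (g * h)) * (ρ g * ρ (g * h)) :=
    Finset.sum_nonneg fun h _ => key h
  rw [Finset.sum_comm] at h1
  have h2 : ∀ g, ∑ h : G, (f g - f (g * h)) * (w g - w (g * h)) * (ρ g * ρ (g * h)) =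
      ∑ h : G, (f g - f h) * (w g - w h) * (ρ g * ρ h) := fun g =>
    Equiv.sum_comp (Equiv.mulLeft g) fun h => (f g - f h) * (w g - w h) * (ρ g * ρ h)
  simp only [h2] at h1
  have h3 : ∑ g, ∑ h, (f g - f h) * (w g - w h) * (ρ g * ρ h) =
      2 * ((∑ g, f g * w g * ρ g) * (∑ g, ρ g) - (∑ g, f g * ρ g) * (∑ g, w g * ρ g)) := by
    have e : ∀ u v : G → ℝ, (∑ g, u g) * (∑ g, v g) = ∑ g, ∑ h, u g * v h := fun u v => by
      rw [Finset.sum_mul_sum]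
    have e1 := e (fun g => f g * w g * ρ g) ρ
    have e2 := e ρ (fun g => f g * w g * ρ g)
    have e3 := e (fun g => f g * ρ g) (fun g => w g * ρ g)
    have e4 := e (fun g => w g * ρ g) (fun g => f g * ρ g)
    have : ∑ g, ∑ h, (f g - f h) * (w g - w h) * (ρ g * ρ h) =
        ∑ g, ∑ h, f g * w g * ρ g * ρ h + ∑ g, ∑ h, ρ g * (f h * w h * ρ h)
        - ∑ g, ∑ h, f g * ρ g * (w h * ρ h) - ∑ g, ∑ h, w g * ρ g * (f h * ρ h) := by
      simp only [← Finset.sum_add_distrib, ← Finset.sum_sub_distrib]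
      refine Finset.sum_congr rfl fun g _ => Finset.sum_congr rfl fun h _ => ?_
      ring
    rw [this, ← e1, ← e2, ← e3, ← e4]
    ring
  linarith

/-- The expectation of a character is increasing in the couplings. -/
theorem expectation_mono {ι : Type*} [Fintype ι] (χ : ι → G →* ℤˣ) (χ₀ : G →* ℤˣ)
    {K K' : ℝ} (hK : 0 ≤ K) (hKK' : K ≤ K') :
    (∑ g, ((χ₀ g : ℤ) : ℝ) * Real.exp (∑ i, K * ((χ i g : ℤ) : ℝ))) /
        (∑ g, Real.exp (∑ i, K * ((χ i g : ℤ) : ℝ))) ≤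
      (∑ g, ((χ₀ g : ℤ) : ℝ) * Real.exp (∑ i, K' * ((χ i g : ℤ) : ℝ))) /
        ∑ g, Real.exp (∑ i, K' * ((χ i g : ℤ) : ℝ)) := by
  have hpos : ∀ c : ℝ, 0 < ∑ g : G, Real.exp (∑ i, c * ((χ i g : ℤ) : ℝ)) := fun c =>
    Finset.sum_pos (fun _ _ => Real.exp_pos _) ⟨1, Finset.mem_univ _⟩
  rw [div_le_div_iff₀ (hpos _) (hpos _)]
  have h := griffiths (K := fun _ : ι => K) (fun _ => hK) χ (PosType.char 1 zero_le_one χ₀)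
    (PosType.exp_sum_char Finset.univ (K := fun _ : ι => K' - K) (fun _ => sub_nonneg.2 hKK') χ)
  have e : ∀ g, Real.exp (∑ i, (K' - K) * ((χ i g : ℤ) : ℝ)) *
      Real.exp (∑ i, K * ((χ i g : ℤ) : ℝ)) = Real.exp (∑ i, K' * ((χ i g : ℤ) : ℝ)) := by
    intro g
    rw [← Real.exp_add, ← Finset.sum_add_distrib]
    congr 1
    exact Finset.sum_congr rfl fun i _ => by ring
  simpa only [one_mul, mul_assoc, e] using h

/-! ### Domination -/

omit [Fintype G]

/-- `g` dominates `f`: both `g - f` and `g + f` are of positive type. -/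
def Dominated (f g : G → ℝ) : Prop :=
  PosType (fun x => g x - f x) ∧ PosType fun x => g x + f x

theorem Dominated.mul {f f' g g' : G → ℝ} (h : Dominated f g) (h' : Dominated f' g') :
    Dominated (fun x => f x * f' x) fun x => g x * g' x := by
  have hc := PosType.const (G := G) (c := 1 / 2) (by norm_num)
  constructor
  · convert hc.mul (.add _ _ (h.1.mul h'.2) (h.2.mul h'.1)) using 2 with x
    ring
  · convert hc.mul (.add _ _ (h.1.mul h'.1) (h.2.mul h'.2)) using 2 with x
    ring

theorem Dominated.prod {ι : Type*} (s : Finset ι) {f g : ι → G → ℝ}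
    (h : ∀ i ∈ s, Dominated (f i) (g i)) :
    Dominated (fun x => ∏ i ∈ s, f i x) fun x => ∏ i ∈ s, g i x := by
  classical
  induction s using Finset.induction_on with
  | empty =>
    simpa using ⟨by simpa using PosType.const (G := G) le_rfl,
      by simpa using PosType.const (G := G) (c := 1 + 1) (by norm_num)⟩
  | insert a s ha ih =>
    simp only [Finset.prod_insert ha]
    exact (h a (by simp)).mul (ih fun i hi => h i (by simp [hi]))

theorem Dominated.abs_sum_le [Fintype G] {f g : G → ℝ} (h : Dominated f g) :
    |∑ x, f x| ≤ ∑ x, g x := by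
  have h1 := h.1.sum_nonneg
  have h2 := h.2.sum_nonneg
  rw [Finset.sum_sub_distrib] at h1
  rw [Finset.sum_add_distrib] at h2
  exact abs_le.2 ⟨by linarith, by linarith⟩

theorem dominated_exp {K : ℝ} (hK : 0 ≤ K) (u : ℤˣ) (χ : G →* ℤˣ) :
    Dominated (fun x => Real.exp (K * ((u * χ x : ℤˣ) : ℤ)))
      fun x => Real.exp (K * ((χ x : ℤˣ) : ℤ)) := by
  have hs := Real.sinh_nonneg_iff.2 hK
  have hc := (Real.cosh_pos K).le
  have p1 : PosType fun x => (2 * Real.sinh K) * ((χ x : ℤ) : ℝ) := .char _ (by linarith) _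
  have p2 : PosType fun _ : G => 2 * Real.cosh K := .const (by linarith)
  have p0 : PosType fun _ : G => (0 : ℝ) := .const le_rfl
  simp only [Dominated, exp_mul_sign]
  rcases Int.units_eq_one_or u with rfl | rfl
  · constructor
    · convert p0 using 2; simp
    · convert PosType.add _ _ p2 p1 using 2; simp; ring
  · constructor
    · convert p1 using 2; simp; ring
    · convert p2 using 2; simp; ring

/-- A frustrated triangle is dominated by a fraction of the unfrustrated one. -/
theorem dominated_triangle {K : ℝ} (hK : 0 ≤ K) (u : Fin 3 → ℤˣ) (hu : u 0 * u 1 * u 2 = -1)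
    (χ : Fin 3 → G →* ℤˣ) (hχ : χ 0 * χ 1 * χ 2 = 1) :
    Dominated (fun x => ∏ i, Real.exp (K * ((u i * χ i x : ℤˣ) : ℤ)))
      fun x => ((1 - Real.tanh K ^ 3) / (1 + Real.tanh K ^ 3)) *
        ∏ i, Real.exp (K * ((χ i x : ℤˣ) : ℤ)) := by
  set t := Real.tanh K with ht
  set C := Real.cosh K with hC
  have hCpos : 0 < C := Real.cosh_pos K
  have hsinh : Real.sinh K = t * C := by
    rw [ht, Real.tanh_eq_sinh_div_cosh, div_mul_cancel₀ _ hCpos.ne']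
  have ht0 : 0 ≤ t := by
    rw [ht, Real.tanh_eq_sinh_div_cosh]
    exact div_nonneg (Real.sinh_nonneg_iff.2 hK) hCpos.le
  have ht1 : t ≤ 1 := by
    rw [ht, Real.tanh_eq_sinh_div_cosh, div_le_one hCpos]
    exact (Real.sinh_lt_cosh K).le
  have ht3 : t ^ 3 ≤ 1 := pow_le_one₀ ht0 ht1
  have ht31 : t ^ 3 ≤ t := by nlinarith [mul_nonneg ht0 ht0]
  set r := (1 - t ^ 3) / (1 + t ^ 3) with hr
  have hden : 0 < 1 + t ^ 3 := by positivity
  have hr0 : 0 ≤ r := div_nonneg (by linarith) hden.le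
  have hr1 : r * (1 + t ^ 3) = 1 - t ^ 3 := div_mul_cancel₀ _ hden.ne'
  have hr2 : t - t ^ 2 ≤ r * (t + t ^ 2) := by
    have : (1 - t) * (1 + t ^ 3) ≤ (1 - t ^ 3) * (1 + t) := by nlinarith [mul_nonneg ht0 ht0]
    have h2 : 1 - t ≤ r * (1 + t) := by
      rw [hr, div_mul_eq_mul_div, le_div_iff₀ hden]; exact this
    nlinarith
  have hχ2 : ∀ x, χ 2 x = χ 0 x * χ 1 x := by
    intro x
    have := DFunLike.congr_fun hχ x
    simp only [MonoidHom.mul_apply, MonoidHom.one_apply] at this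
    rcases Int.units_eq_one_or (χ 0 x) with e0 | e0 <;>
    rcases Int.units_eq_one_or (χ 1 x) with e1 | e1 <;>
    rcases Int.units_eq_one_or (χ 2 x) with e2 | e2 <;> simp [e0, e1, e2] at this ⊢
  have hw : ∀ x, ∏ i, Real.exp (K * ((χ i x : ℤˣ) : ℤ)) = C ^ 3 * ((1 + t ^ 3) + (t + t ^ 2) *
      (((χ 0 x : ℤ) : ℝ) + ((χ 1 x : ℤ) : ℝ) + ((χ 2 x : ℤ) : ℝ))) := by
    intro x
    simp only [Fin.prod_univ_three, exp_mul_sign, hsinh, hχ2]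
    rcases Int.units_eq_one_or (χ 0 x) with e0 | e0 <;>
    rcases Int.units_eq_one_or (χ 1 x) with e1 | e1 <;> simp [e0, e1] <;> ring
  have hwF : ∀ x, ∏ i, Real.exp (K * ((u i * χ i x : ℤˣ) : ℤ)) = C ^ 3 * ((1 - t ^ 3) + (t - t ^ 2) *
      (((u 0 : ℤ) : ℝ) * ((χ 0 x : ℤ) : ℝ) + ((u 1 : ℤ) : ℝ) * ((χ 1 x : ℤ) : ℝ) +
        ((u 2 : ℤ) : ℝ) * ((χ 2 x : ℤ) : ℝ))) := by
    intro x
    simp only [Fin.prod_univ_three, exp_mul_sign, hsinh, hχ2]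
    rcases Int.units_eq_one_or (χ 0 x) with e0 | e0 <;>
    rcases Int.units_eq_one_or (χ 1 x) with e1 | e1 <;>
    rcases Int.units_eq_one_or (u 0) with f0 | f0 <;>
    rcases Int.units_eq_one_or (u 1) with f1 | f1 <;>
    rcases Int.units_eq_one_or (u 2) with f2 | f2 <;>
    simp [f0, f1, f2] at hu <;>
    simp [e0, e1, f0, f1, f2] <;> ring
  have hC3 : 0 ≤ C ^ 3 := by positivity
  have hcoef : ∀ i, 0 ≤ r * (t + t ^ 2) - (t - t ^ 2) * ((u i : ℤ) : ℝ) ∧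
      0 ≤ r * (t + t ^ 2) + (t - t ^ 2) * ((u i : ℤ) : ℝ) := by
    intro i
    have : 0 ≤ t - t ^ 2 := by nlinarith
    have : 0 ≤ r * (t + t ^ 2) := by positivity
    rcases Int.units_eq_one_or (u i) with f | f <;> simp [f] <;> constructor <;> linarith
  have pos : ∀ c d₀ d₁ d₂ : ℝ, 0 ≤ c → 0 ≤ d₀ → 0 ≤ d₁ → 0 ≤ d₂ → PosType fun x =>
      C ^ 3 * (c + (d₀ * ((χ 0 x : ℤ) : ℝ) + (d₁ * ((χ 1 x : ℤ) : ℝ) +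
        d₂ * ((χ 2 x : ℤ) : ℝ)))) := fun c d₀ d₁ d₂ hc h0 h1 h2 =>
    (PosType.const hC3).mul (.add _ _ (.const hc) (.add _ _ (.char _ h0 _)
      (.add _ _ (.char _ h1 _) (.char _ h2 _))))
  simp only [Dominated, hw, hwF]
  constructor
  · convert pos 0 _ _ _ le_rfl (hcoef 0).1 (hcoef 1).1 (hcoef 2).1 using 2 with x
    linear_combination C ^ 3 * hr1
  · convert pos (2 * (1 - t ^ 3)) _ _ _ (by linarith) (hcoef 0).2 (hcoef 1).2 (hcoef 2).2
      using 2 with x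
    linear_combination C ^ 3 * hr1

end PosType

/-! ### Connected sets and lattice animals -/

section Animals

variable {P : Type*} (adj : P → P → Prop)

/-- Every element of `γ` is joined to `p` by a chain of neighbours in `γ`. -/
def ConnectedFrom (p : P) (γ : Finset P) : Prop :=
  p ∈ γ ∧ ∀ q ∈ γ, Relation.ReflTransGen (fun a b => adj a b ∧ b ∈ γ) p q

open Classical in
/-- The connected component of `p` in `S`. -/
noncomputable def component (S : Finset P) (p : P) : Finset P :=
  S.filter fun q => Relation.ReflTransGen (fun a b => adj a b ∧ b ∈ S) p q

variable {adj}

theorem component_subset (S : Finset P) (p : P) : component adj S p ⊆ S := by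
  classical exact Finset.filter_subset _ _

theorem mem_component_self {S : Finset P} {p : P} (hp : p ∈ S) : p ∈ component adj S p := by
  classical exact Finset.mem_filter.2 ⟨hp, .refl⟩

theorem mem_component_of_adj {S : Finset P} {p a b : P} (ha : a ∈ component adj S p)
    (hb : b ∈ S) (hab : adj a b) : b ∈ component adj S p := by
  classical
  exact Finset.mem_filter.2 ⟨hb, (Finset.mem_filter.1 ha).2.tail ⟨hab, hb⟩⟩

theorem connectedFrom_component {S : Finset P} {p : P} (hp : p ∈ S) :
    ConnectedFrom adj p (component adj S p) := by
  classical
  refine ⟨mem_component_self hp, fun q hq => ?_⟩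
  have h := (Finset.mem_filter.1 hq).2
  clear hq
  induction h with
  | refl => exact .refl
  | tail h1 h2 ih =>
    refine ih.tail ⟨h2.1, Finset.mem_filter.2 ⟨h2.2, h1.tail h2⟩⟩

theorem ConnectedFrom.subset_of_closed {p : P} {γ U : Finset P} (h : ConnectedFrom adj p γ)
    (hp : p ∈ U) (hU : ∀ a ∈ U, ∀ b ∈ γ, adj a b → b ∈ U) : γ ⊆ U := by
  intro q hq
  have h1 := h.2 q hq
  clear hq
  induction h1 with
  | refl => exact hp
  | tail _ h2 ih => exact hU _ ih _ h2.2 h2.1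

/-- A connected set is at least as large as the range of a height function. -/
theorem ConnectedFrom.height_le {p q : P} {γ : Finset P} (h : ConnectedFrom adj p γ) (hq : q ∈ γ)
    (f : P → ℕ) (hf : ∀ a b, adj a b → f b ≤ f a + 1) : f q + 1 ≤ f p + γ.card := by
  classical
  rcases lt_or_ge (f q) (f p) with hlt | hle
  · have : 0 < γ.card := Finset.card_pos.2 ⟨q, hq⟩
    omega
  have hsub : Finset.Icc (f p) (f q) ⊆ γ.image f := by
    intro k hk
    rw [Finset.mem_Icc] at hk
    by_contra hcon
    have hne : ∀ r ∈ γ, f r ≠ k := fun r hr e => hcon (Finset.mem_image.2 ⟨r, hr, e⟩)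
    have hsub : γ ⊆ γ.filter fun r => f r < k := by
      refine h.subset_of_closed
        (Finset.mem_filter.2 ⟨h.1, lt_of_le_of_ne hk.1 (hne p h.1)⟩) ?_
      intro a ha b hb hab
      rw [Finset.mem_filter] at ha ⊢
      exact ⟨hb, lt_of_le_of_ne (by have := hf a b hab; omega) (hne b hb)⟩
    have := (Finset.mem_filter.1 (hsub hq)).2
    omega
  have h1 := (Finset.card_le_card hsub).trans Finset.card_image_le
  rw [Nat.card_Icc] at h1
  omega

variable [Fintype P] (adj)

open Classical in
/-- A connected set together with its neighbours. -/
noncomputable def neighbourhood (γ : Finset P) : Finset P :=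
  γ ∪ γ.biUnion fun a => Finset.univ.filter fun b => adj a b

variable {adj}

theorem card_neighbourhood_le {D : ℕ}
    (hD : ∀ a : P, ∃ s : Finset P, s.card ≤ D ∧ ∀ b, adj a b → b ∈ s) (γ : Finset P) :
    (neighbourhood adj γ).card ≤ (D + 1) * γ.card := by
  classical
  refine (Finset.card_union_le _ _).trans ?_
  have : (γ.biUnion fun a => Finset.univ.filter fun b => adj a b).card ≤ γ.card * D := by
    refine Finset.card_biUnion_le_card_mul _ _ _ fun a _ => ?_
    obtain ⟨s, hs, hs'⟩ := hD a
    exact (Finset.card_le_card fun b hb => hs' b (Finset.mem_filter.1 hb).2).trans hs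
  linarith

open Classical in
/-- The generating function of the connected sets that contain a given point. -/
theorem sum_connected_le {D : ℕ}
    (hD : ∀ a : P, ∃ s : Finset P, s.card ≤ D ∧ ∀ b, adj a b → b ∈ s) (p : P) :
    ∑ γ ∈ Finset.univ.filter (ConnectedFrom adj p), ((1 / 2 : ℝ) ^ (D + 1)) ^ γ.card ≤ 1 := by
  set F : Finset P → Finset (Finset P) := fun γ =>
    Finset.univ.filter fun ω => ω ∩ neighbourhood adj γ = γ with hF
  have hsub : ∀ γ, γ ⊆ neighbourhood adj γ := fun γ => Finset.subset_union_left
  have hcard : ∀ γ, 2 ^ (Fintype.card P - (neighbourhood adj γ).card) ≤ (F γ).card := by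
    intro γ
    rw [← Finset.card_compl, ← Finset.card_powerset]
    refine Finset.card_le_card_of_injOn (fun ω => γ ∪ ω) ?_ ?_
    · intro ω hω
      have hω' : ω ⊆ (neighbourhood adj γ)ᶜ := Finset.mem_powerset.1 (Finset.mem_coe.1 hω)
      have hd : ω ∩ neighbourhood adj γ = ∅ := by
        rw [← Finset.disjoint_iff_inter_eq_empty]
        exact Finset.disjoint_left.2 fun x hx => Finset.mem_compl.1 (hω' hx)
      simp only [hF, Finset.coe_filter, Finset.mem_univ, true_and, Set.mem_ofPred_eq]
      rw [Finset.union_inter_distrib_right, hd, Finset.union_empty,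
        Finset.inter_eq_left.2 (hsub γ)]
    · intro ω hω ω' hω' he
      have hd : ∀ ω ∈ ((neighbourhood adj γ)ᶜ.powerset : Finset (Finset P)), (γ ∪ ω) \ γ = ω := by
        intro ω hω
        rw [Finset.mem_powerset] at hω
        refine Finset.union_sdiff_cancel_left (Finset.disjoint_left.2 fun x hx hx' => ?_)
        exact Finset.mem_compl.1 (hω hx') (hsub γ hx)
      have he' : (γ ∪ ω) \ γ = (γ ∪ ω') \ γ := by rw [show γ ∪ ω = γ ∪ ω' from he]
      rwa [hd ω hω, hd ω' hω'] at he'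
  have hle : ∀ γ γ' ω, ConnectedFrom adj p γ → ConnectedFrom adj p γ' → ω ∈ F γ → ω ∈ F γ' →
      γ ⊆ γ' := by
    intro γ γ' ω hγ hγ' hω hω'
    simp only [hF, Finset.mem_filter, Finset.mem_univ, true_and] at hω hω'
    refine hγ.subset_of_closed hγ'.1 fun a ha b hb hab => ?_
    rw [← hω', Finset.mem_inter]
    rw [← hω, Finset.mem_inter] at hb
    refine ⟨hb.1, Finset.mem_union_right _ ?_⟩
    exact Finset.mem_biUnion.2 ⟨a, ha, Finset.mem_filter.2 ⟨Finset.mem_univ _, hab⟩⟩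
  have hdisj : ∀ γ ∈ Finset.univ.filter (ConnectedFrom adj p),
      ∀ γ' ∈ Finset.univ.filter (ConnectedFrom adj p), γ ≠ γ' → Disjoint (F γ) (F γ') := by
    intro γ hγ γ' hγ' hne
    simp only [Finset.mem_filter, Finset.mem_univ, true_and] at hγ hγ'
    refine Finset.disjoint_left.2 fun ω hω hω' => hne ?_
    exact (hle γ γ' ω hγ hγ' hω hω').antisymm (hle γ' γ ω hγ' hγ hω' hω)
  have htot : ∑ γ ∈ Finset.univ.filter (ConnectedFrom adj p), (F γ).card ≤
      2 ^ Fintype.card P := by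
    rw [← Finset.card_biUnion hdisj, ← Fintype.card_finset]
    exact Finset.card_le_univ _
  have hpow : (0 : ℝ) < 2 ^ Fintype.card P := by positivity
  have hterm : ∀ γ : Finset P, ((1 / 2 : ℝ) ^ (D + 1)) ^ γ.card * 2 ^ Fintype.card P ≤
      ((F γ).card : ℝ) := by
    intro γ
    have h1 : ((1 / 2 : ℝ) ^ (D + 1)) ^ γ.card ≤ (1 / 2) ^ (neighbourhood adj γ).card := by
      rw [← pow_mul]
      exact pow_le_pow_of_le_one (by norm_num) (by norm_num) (card_neighbourhood_le hD γ)
    have h2 : ((2 ^ (Fintype.card P - (neighbourhood adj γ).card) : ℕ) : ℝ) ≤ (F γ).card := by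
      exact_mod_cast hcard γ
    refine le_trans ?_ h2
    refine (mul_le_mul_of_nonneg_right h1 hpow.le).trans (le_of_eq ?_)
    push_cast
    rw [pow_sub₀ _ two_ne_zero (Finset.card_le_univ _)]
    simp; ring
  have hfin : (∑ γ ∈ Finset.univ.filter (ConnectedFrom adj p),
      ((1 / 2 : ℝ) ^ (D + 1)) ^ γ.card) * 2 ^ Fintype.card P ≤ 1 * 2 ^ Fintype.card P := by
    rw [Finset.sum_mul, one_mul]
    refine (Finset.sum_le_sum fun γ _ => hterm γ).trans ?_
    exact_mod_cast htot
  exact le_of_mul_le_mul_right hfin hpow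

open Classical in
theorem sum_connected_large_le {D : ℕ}
    (hD : ∀ a : P, ∃ s : Finset P, s.card ≤ D ∧ ∀ b, adj a b → b ∈ s) (p : P) {t : ℝ}
    (ht0 : 0 ≤ t) (ht : t * 2 ^ (D + 1) ≤ 1) (d : ℕ) :
    ∑ γ ∈ Finset.univ.filter (fun γ => ConnectedFrom adj p γ ∧ d ≤ γ.card), t ^ γ.card ≤
      (t * 2 ^ (D + 1)) ^ d := by
  set z : ℝ := (1 / 2) ^ (D + 1) with hz
  have hz0 : 0 < z := by positivity
  have hz1 : z * 2 ^ (D + 1) = 1 := by rw [hz, ← mul_pow]; norm_num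
  set u := t * 2 ^ (D + 1) with hu
  have hu0 : 0 ≤ u := by positivity
  have htu : t = u * z := by rw [hu, mul_assoc, mul_comm _ z, hz1, mul_one]
  calc ∑ γ ∈ Finset.univ.filter (fun γ => ConnectedFrom adj p γ ∧ d ≤ γ.card), t ^ γ.card
      ≤ ∑ γ ∈ Finset.univ.filter (fun γ => ConnectedFrom adj p γ ∧ d ≤ γ.card),
          u ^ d * z ^ γ.card := by
        refine Finset.sum_le_sum fun γ hγ => ?_
        rw [Finset.mem_filter] at hγ
        rw [htu, mul_pow]
        exact mul_le_mul_of_nonneg_right (pow_le_pow_of_le_one hu0 ht hγ.2.2) (by positivity)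
    _ ≤ ∑ γ ∈ Finset.univ.filter (ConnectedFrom adj p), u ^ d * z ^ γ.card := by
        refine Finset.sum_le_sum_of_subset_of_nonneg ?_ fun _ _ _ => by positivity
        intro γ hγ
        simp only [Finset.mem_filter] at hγ ⊢
        exact ⟨hγ.1, hγ.2.1⟩
    _ = u ^ d * ∑ γ ∈ Finset.univ.filter (ConnectedFrom adj p), z ^ γ.card := by
        rw [Finset.mul_sum]
    _ ≤ u ^ d * 1 := mul_le_mul_of_nonneg_left (sum_connected_le hD p) (by positivity)
    _ = u ^ d := mul_one _

end Animals

/-! ### Trace of the exponential of a sum of commuting Pauli strings -/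

theorem tensorOp_mul {V : Type} [Fintype V] [DecidableEq V]
    (M N : V → Matrix (Fin 2) (Fin 2) ℂ) :
    tensorOp M * tensorOp N = tensorOp fun v => M v * N v := by
  ext s t
  simp only [tensorOp, Matrix.mul_apply, Matrix.of_apply, ← Finset.prod_mul_distrib]
  rw [Finset.prod_univ_sum, Fintype.piFinset_univ]

theorem tensorOp_one {V : Type} [Fintype V] [DecidableEq V] :
    tensorOp (fun _ : V => (1 : Matrix (Fin 2) (Fin 2) ℂ)) = 1 := by
  ext s t
  simp only [tensorOp, Matrix.of_apply, Matrix.one_apply]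
  rw [Finset.prod_ite_zero]
  simp [funext_iff]

theorem trace_tensorOp {V : Type} [Fintype V] [DecidableEq V] (M : V → Matrix (Fin 2) (Fin 2) ℂ) :
    (tensorOp M).trace = ∏ v, (M v).trace := by
  simp only [Matrix.trace, Matrix.diag_apply, tensorOp, Matrix.of_apply]
  rw [Finset.prod_univ_sum, Fintype.piFinset_univ]

theorem tensorOp_smul {V : Type} [Fintype V] [DecidableEq V] (c : V → ℂ)
    (M : V → Matrix (Fin 2) (Fin 2) ℂ) :
    tensorOp (fun v => c v • M v) = (∏ v, c v) • tensorOp M := by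
  ext s t
  simp [tensorOp, Finset.prod_mul_distrib]

/-- The three Pauli matrices. -/
def pauli : Fin 3 → Matrix (Fin 2) (Fin 2) ℂ := ![pauliX, pauliY, pauliZ]

theorem pauli_mul_self (k : Fin 3) : pauli k * pauli k = 1 := by
  fin_cases k <;> ext i j <;> fin_cases i <;> fin_cases j <;>
    simp [pauli, pauliX, pauliY, pauliZ, Matrix.mul_apply]

theorem pauli_anticomm {k l : Fin 3} (h : k ≠ l) :
    pauli k * pauli l = (-1 : ℂ) • (pauli l * pauli k) := by
  fin_cases k <;> fin_cases l <;> first | exact absurd rfl h | skip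
  all_goals
    ext i j; fin_cases i <;> fin_cases j <;>
      simp [pauli, pauliX, pauliY, pauliZ, Matrix.mul_apply]

/-- `M` if `u = -1` and the identity if `u = 1`. -/
def signPow {A : Type*} [One A] (u : ℤˣ) (M : A) : A := if u = 1 then 1 else M

theorem signPow_mul {A : Type*} [Monoid A] {M : A} (hM : M * M = 1) (u u' : ℤˣ) :
    signPow (u * u') M = signPow u M * signPow u' M := by
  rcases Int.units_eq_one_or u with rfl | rfl <;>
  rcases Int.units_eq_one_or u' with rfl | rfl <;> simp [signPow, hM]

theorem trace_pauli_product (x y z : ℤˣ) :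
    (signPow x (pauli 0) * signPow y (pauli 1) * signPow z (pauli 2)).trace =
      if x = y ∧ x = z then 2 * (if x = 1 then 1 else Complex.I) else 0 := by
  rcases Int.units_eq_one_or x with rfl | rfl <;>
  rcases Int.units_eq_one_or y with rfl | rfl <;>
  rcases Int.units_eq_one_or z with rfl | rfl <;>
    simp [signPow, pauli, pauliX, pauliY, pauliZ, Matrix.trace]; ring

theorem pauli_product (x : ℤˣ) :
    signPow x (pauli 0) * signPow x (pauli 1) * signPow x (pauli 2) =
      (if x = 1 then (1 : ℂ) else Complex.I) • (1 : Matrix (Fin 2) (Fin 2) ℂ) := by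
  rcases Int.units_eq_one_or x with rfl | rfl
  · simp [signPow]
  · ext i j; fin_cases i <;> fin_cases j <;>
      simp [signPow, pauli, pauliX, pauliY, pauliZ]

theorem exp_smul_of_mul_self {n : Type*} [Fintype n] [DecidableEq n] {B : Matrix n n ℂ}
    (hB : B * B = 1) (x : ℂ) :
    NormedSpace.exp (x • B) = Complex.cosh x • (1 : Matrix n n ℂ) + Complex.sinh x • B := by
  open scoped Matrix.Norms.Operator in
  let Q : Matrix n n ℂ := (1 / 2 : ℂ) • (1 + B)
  let Q' : Matrix n n ℂ := (1 / 2 : ℂ) • (1 - B)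
  have h1 : Q * Q = Q := by
    simp only [Q, smul_mul_smul_comm, mul_add, add_mul, hB, mul_one, one_mul]
    module
  have h2 : Q' * Q' = Q' := by
    simp only [Q', smul_mul_smul_comm, mul_sub, sub_mul, hB, mul_one, one_mul]
    module
  have h3 : Q * Q' = 0 := by
    simp only [Q, Q', smul_mul_smul_comm, mul_sub, add_mul, hB, mul_one, one_mul]
    module
  have h4 : Q' * Q = 0 := by
    simp only [Q, Q', smul_mul_smul_comm, mul_add, sub_mul, hB, mul_one, one_mul]
    module
  have h5 : Q + Q' = 1 := by simp only [Q, Q']; module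
  let φ : ℂ × ℂ →+* Matrix n n ℂ :=
    { toFun := fun u => u.1 • Q + u.2 • Q'
      map_one' := by simp [h5]
      map_zero' := by simp
      map_add' := fun u v => by simp only [Prod.fst_add, Prod.snd_add]; module
      map_mul' := fun u v => by
        simp only [Prod.fst_mul, Prod.snd_mul, mul_add, add_mul, smul_mul_smul_comm, h1, h2, h3,
          h4]
        simp }
  have hφ : Continuous φ := by
    change Continuous fun u : ℂ × ℂ => u.1 • Q + u.2 • Q'
    fun_prop
  have hx : x • B = φ (x, -x) := by
    change x • B = x • Q + (-x) • Q'
    simp only [Q, Q']; module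
  rw [hx]
  refine (NormedSpace.map_exp φ hφ (x, -x)).symm.trans ?_
  change (NormedSpace.exp (x, -x)).1 • Q + (NormedSpace.exp (x, -x)).2 • Q' = _
  rw [Prod.fst_exp, Prod.snd_exp, ← Complex.exp_eq_exp_ℂ, Complex.cosh, Complex.sinh]
  simp only [Q, Q']
  module

section PauliStrings

set_option linter.unusedSectionVars false

variable {V : Type} {P : Type*} [Fintype V] [Fintype P] [DecidableEq V]
  (On : V → P → Prop) (kd : P → Fin 3)

open Classical in
/-- The Pauli string of type `kd p` on the set of the `v` with `On v p`. -/
noncomputable def pauliString (p : P) : Matrix (V → Fin 2) (V → Fin 2) ℂ :=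
  tensorOp fun v => if On v p then pauli (kd p) else 1

open Classical in
/-- The parity of the number of `p` of type `k` at `v` with `a p = -1`. -/
noncomputable def localSign (a : P → ℤˣ) (v : V) (k : Fin 3) : ℤˣ :=
  ∏ p, if On v p ∧ kd p = k then a p else 1

open Classical in
theorem localSign_mul (a b : P → ℤˣ) (v : V) (k : Fin 3) :
    localSign On kd (a * b) v k = localSign On kd a v k * localSign On kd b v k := by
  simp only [localSign, ← Finset.prod_mul_distrib]
  refine Finset.prod_congr rfl fun p _ => ?_
  split_ifs <;> simp

/-- The sets of Pauli strings (given by the `a p = -1`) whose product is a scalar. -/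
def scalarKernel : Subgroup (P → ℤˣ) where
  carrier := {a | ∀ v, localSign On kd a v 0 = localSign On kd a v 1 ∧
    localSign On kd a v 0 = localSign On kd a v 2}
  one_mem' v := by simp [localSign]
  mul_mem' {a b} ha hb v := by
    simp only [localSign_mul]
    rw [(ha v).1, (hb v).1, ← (ha v).2, ← (hb v).2, (ha v).1, (hb v).1]
    exact ⟨rfl, rfl⟩
  inv_mem' {a} ha v := by
    have : a⁻¹ = a := funext fun p => Int.units_inv_eq_self _
    rw [this]; exact ha v

theorem mem_scalarKernel {a : P → ℤˣ} : a ∈ scalarKernel On kd ↔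
    ∀ v, localSign On kd a v 0 = localSign On kd a v 1 ∧
      localSign On kd a v 0 = localSign On kd a v 2 := Iff.rfl

/-- The scalar to which the Pauli strings with `a p = -1` multiply. -/
noncomputable def stringPhase (a : P → ℤˣ) : ℂ :=
  ∏ v, if localSign On kd a v 0 = 1 then 1 else Complex.I

open Classical in
/-- Two Pauli strings of different types overlap on an even set. -/
def EvenOverlap : Prop :=
  ∀ p q, kd p ≠ kd q → Even (Finset.univ.filter fun v => On v p ∧ On v q).card

theorem pauliString_mul_self (p : P) : pauliString On kd p * pauliString On kd p = 1 := by
  rw [pauliString, tensorOp_mul, ← tensorOp_one]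
  congr 1
  funext v
  split_ifs <;> simp [pauli_mul_self]

open Classical in
theorem pauliString_comm
    (hcomm : EvenOverlap On kd)
    (p q : P) : pauliString On kd p * pauliString On kd q =
      pauliString On kd q * pauliString On kd p := by
  rw [pauliString, pauliString, tensorOp_mul, tensorOp_mul]
  by_cases h : kd p = kd q
  · congr 1
    funext v
    rw [h]
    split_ifs <;> simp
  · have : (fun v => (if On v p then pauli (kd p) else 1) * (if On v q then pauli (kd q) else 1)) =
        fun v => (if On v p ∧ On v q then (-1 : ℂ) else 1) •
          ((if On v q then pauli (kd q) else 1) * (if On v p then pauli (kd p) else 1)) := by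
      funext v
      by_cases h1 : On v p <;> by_cases h2 : On v q <;> simp [h1, h2]
      rw [pauli_anticomm h]; simp
    rw [this, tensorOp_smul, Finset.prod_ite, Finset.prod_const, Finset.prod_const_one, mul_one,
      (hcomm p q h).neg_one_pow, one_smul]

open Classical in
theorem signPow_pauliString (p : P) (u : ℤˣ) :
    signPow u (pauliString On kd p) =
      tensorOp fun v => signPow (if On v p then u else 1) (pauli (kd p)) := by
  rcases Int.units_eq_one_or u with rfl | rfl
  · simp [signPow, tensorOp_one]
  · simp only [signPow, pauliString]
    rw [if_neg (by decide)]
    congr 1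
    funext v
    split_ifs <;> simp_all

/-- `u ↦ B ^ u` for an involution `B`. -/
def signPowHom {A : Type*} [Monoid A] {M : A} (hM : M * M = 1) : ℤˣ →* A where
  toFun u := signPow u M
  map_one' := by simp [signPow]
  map_mul' := signPow_mul hM

theorem commute_signPowHom (hcomm : EvenOverlap On kd) (p q : P) (x y : ℤˣ) :
    Commute (signPowHom (pauliString_mul_self On kd p) x)
      (signPowHom (pauliString_mul_self On kd q) y) := by
  change Commute (signPow x _) (signPow y _)
  have := pauliString_comm On kd hcomm p q
  unfold signPow
  split_ifs
  · exact Commute.one_left _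
  · exact Commute.one_left _
  · exact Commute.one_right _
  · exact this

/-- The products of Pauli strings, as a homomorphism. -/
noncomputable def stringHom (hcomm : EvenOverlap On kd) :
    (P → ℤˣ) →* Matrix (V → Fin 2) (V → Fin 2) ℂ :=
  MonoidHom.noncommPiCoprod (fun p => signPowHom (pauliString_mul_self On kd p))
    (fun p q _ x y => commute_signPowHom On kd hcomm p q x y)

section

variable (hcomm : EvenOverlap On kd)

include hcomm

theorem stringHom_mulSingle [DecidableEq P] (p : P) (u : ℤˣ) :
    stringHom On kd hcomm (Pi.mulSingle p u) = signPow u (pauliString On kd p) := by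
  have := MonoidHom.noncommPiCoprod_mulSingle
    (ϕ := fun p => signPowHom (pauliString_mul_self On kd p))
    (hcomm := fun p q _ x y => commute_signPowHom On kd hcomm p q x y) p u
  exact this

open Classical in
theorem stringHom_restrict (a : P → ℤˣ) (k : Fin 3) (s : Finset P) (hs : ∀ p ∈ s, kd p = k) :
    stringHom On kd hcomm (fun p => if p ∈ s then a p else 1) =
      tensorOp fun v => signPow (∏ p ∈ s, if On v p then a p else 1) (pauli k) := by
  induction s using Finset.induction_on with
  | empty =>
    have : (fun p : P => if p ∈ (∅ : Finset P) then a p else 1) = 1 := by ext p; simp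
    rw [this, map_one]
    simp [signPow, tensorOp_one]
  | insert q s hq ih =>
    have : (fun p : P => if p ∈ insert q s then a p else 1) =
        Pi.mulSingle q (a q) * fun p => if p ∈ s then a p else 1 := by
      funext p
      by_cases hp : p = q
      · subst hp; simp [hq]
      · simp [hp]
    rw [this, map_mul, ih fun p hp => hs p (Finset.mem_insert_of_mem hp), stringHom_mulSingle,
      signPow_pauliString, tensorOp_mul]
    congr 1
    funext v
    rw [Finset.prod_insert hq, signPow_mul (pauli_mul_self k),
      hs q (Finset.mem_insert_self _ _)]

open Classical in
theorem stringHom_eq (a : P → ℤˣ) : stringHom On kd hcomm a =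
    tensorOp fun v => signPow (localSign On kd a v 0) (pauli 0) *
      signPow (localSign On kd a v 1) (pauli 1) * signPow (localSign On kd a v 2) (pauli 2) := by
  have hk : ∀ k, stringHom On kd hcomm (fun p => if kd p = k then a p else 1) =
      tensorOp fun v => signPow (localSign On kd a v k) (pauli k) := by
    intro k
    have := stringHom_restrict On kd hcomm a k (Finset.univ.filter fun p => kd p = k)
      fun p hp => (Finset.mem_filter.1 hp).2
    simp only [Finset.mem_filter, Finset.mem_univ, true_and] at this
    rw [this]
    congr 1
    funext v
    congr 1
    rw [localSign, Finset.prod_filter]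
    refine Finset.prod_congr rfl fun p _ => ?_
    by_cases h1 : kd p = k <;> by_cases h2 : On v p <;> simp [h1, h2]
  have : a = (fun p => if kd p = 0 then a p else 1) * (fun p => if kd p = 1 then a p else 1) *
      fun p => if kd p = 2 then a p else 1 := by
    funext p
    have h3 : ∀ k : Fin 3, k = 0 ∨ k = 1 ∨ k = 2 := by decide
    rcases h3 (kd p) with h | h | h <;> simp [h]
  conv_lhs => rw [this]
  rw [map_mul, map_mul, hk, hk, hk, tensorOp_mul, tensorOp_mul]

theorem stringHom_of_mem {a : P → ℤˣ} (ha : a ∈ scalarKernel On kd) :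
    stringHom On kd hcomm a = stringPhase On kd a • 1 := by
  rw [stringHom_eq]
  have : (fun v => signPow (localSign On kd a v 0) (pauli 0) *
      signPow (localSign On kd a v 1) (pauli 1) * signPow (localSign On kd a v 2) (pauli 2)) =
      fun v => (if localSign On kd a v 0 = 1 then (1 : ℂ) else Complex.I) •
        (1 : Matrix (Fin 2) (Fin 2) ℂ) := by
    funext v
    rw [← (ha v).1, ← (ha v).2, pauli_product]
  rw [this, tensorOp_smul, tensorOp_one, stringPhase]

open Classical in
theorem trace_stringHom (a : P → ℤˣ) : (stringHom On kd hcomm a).trace =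
    if a ∈ scalarKernel On kd then 2 ^ Fintype.card V * stringPhase On kd a else 0 := by
  split_ifs with ha
  · rw [stringHom_of_mem On kd hcomm ha, Matrix.trace_smul, Matrix.trace_one]
    simp [mul_comm]
  · rw [stringHom_eq, trace_tensorOp]
    rw [mem_scalarKernel] at ha
    push Not at ha
    obtain ⟨v, hv⟩ := ha
    refine Finset.prod_eq_zero (Finset.mem_univ v) ?_
    rw [trace_pauli_product, if_neg]
    exact fun h => hv h.1 h.2

theorem stringPhase_mul {a b : P → ℤˣ} (ha : a ∈ scalarKernel On kd)
    (hb : b ∈ scalarKernel On kd) :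
    stringPhase On kd (a * b) = stringPhase On kd a * stringPhase On kd b := by
  have h := map_mul (stringHom On kd hcomm) a b
  rw [stringHom_of_mem On kd hcomm ha, stringHom_of_mem On kd hcomm hb,
    stringHom_of_mem On kd hcomm (mul_mem ha hb), smul_mul_smul_comm, mul_one] at h
  have h' := congrFun (congrFun h (fun _ => 0)) (fun _ => 0)
  simpa using h'

open Classical in
theorem trace_exp_sum_pauliString (x : P → ℂ) :
    (NormedSpace.exp (∑ p, x p • pauliString On kd p)).trace =
      2 ^ Fintype.card V * ∑ a : P → ℤˣ, if a ∈ scalarKernel On kd then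
        stringPhase On kd a * ∏ p, (if a p = 1 then Complex.cosh (x p) else Complex.sinh (x p))
        else 0 := by
  set w : P → ℤˣ → ℂ := fun p u => if u = 1 then Complex.cosh (x p) else Complex.sinh (x p)
  let ψ := MonoidAlgebra.lift ℂ (Matrix (V → Fin 2) (V → Fin 2) ℂ) (P → ℤˣ)
    (stringHom On kd hcomm)
  have hψ : ∀ a, ψ (MonoidAlgebra.of ℂ (P → ℤˣ) a) = stringHom On kd hcomm a := fun a =>
    MonoidAlgebra.lift_of _ _
  have h1 : ∀ s : Finset P, NormedSpace.exp (∑ p ∈ s, x p • pauliString On kd p) =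
      ψ (∏ p ∈ s, ∑ u : ℤˣ, w p u • MonoidAlgebra.of ℂ (P → ℤˣ) (Pi.mulSingle p u)) := by
    intro s
    induction s using Finset.induction_on with
    | empty => simp
    | insert q s hq ih =>
      rw [Finset.sum_insert hq, Finset.prod_insert hq, map_mul, Matrix.exp_add_of_commute, ih,
        exp_smul_of_mul_self (pauliString_mul_self On kd q)]
      · congr 1
        have hu : (Finset.univ : Finset ℤˣ) = {1, -1} := rfl
        rw [hu, Finset.sum_pair (by decide), map_add, map_smul, map_smul, hψ, hψ,
          stringHom_mulSingle, stringHom_mulSingle]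
        simp [w, signPow]
      · refine Commute.sum_right _ _ _ fun p _ => ?_
        exact (Commute.smul_left (pauliString_comm On kd hcomm q p) _).smul_right _
  have h2 : ∏ p, ∑ u : ℤˣ, w p u • MonoidAlgebra.of ℂ (P → ℤˣ) (Pi.mulSingle p u) =
      ∑ a : P → ℤˣ, (∏ p, w p (a p)) • MonoidAlgebra.of ℂ (P → ℤˣ) a := by
    rw [Finset.prod_univ_sum, Fintype.piFinset_univ]
    refine Finset.sum_congr rfl fun a _ => ?_
    rw [Finset.prod_smul, ← map_prod, Finset.univ_prod_mulSingle]
  rw [h1, h2, map_sum, Matrix.trace_sum, Finset.mul_sum]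
  refine Finset.sum_congr rfl fun a _ => ?_
  rw [map_smul, hψ, Matrix.trace_smul, trace_stringHom]
  split_ifs
  · simp only [smul_eq_mul, w]; ring
  · simp

end

end PauliStrings

/-! ### Local geometry of the honeycomb -/

section Geometry

variable {L : ℕ}

/-- The unit vector in direction `i`. -/
def unit (L : ℕ) (i : Fin 3) : Point L := Pi.single i 1

theorem res_add (x y : Point L) (i : Fin 3) : res (x + y) i = res x i + res y i := map_add _ _ _

theorem res_sub (x y : Point L) (i : Fin 3) : res (x - y) i = res x i - res y i := map_sub _ _ _

theorem res_unit_self (i : Fin 3) : res (unit L i) i = 1 := by simp [res, unit]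

theorem res_unit_ne {i j : Fin 3} (h : j ≠ i) : res (unit L i) j = 0 := by
  simp [res, unit, Pi.single_eq_of_ne h]

theorem unit_self (i : Fin 3) : unit L i i = 1 := by simp [unit]

theorem unit_ne {i j : Fin 3} (h : j ≠ i) : unit L i j = 0 := by
  simp [unit, Pi.single_eq_of_ne h]

theorem eq_of_three {α β γ : Fin 3} (h1 : α ≠ β) (h2 : α ≠ γ) (h3 : β ≠ γ) (i : Fin 3) :
    i = α ∨ i = β ∨ i = γ := by
  revert α β γ i; decide

theorem ext_three {α β γ : Fin 3} (h1 : α ≠ β) (h2 : α ≠ γ) (h3 : β ≠ γ) {M : Type*}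
    {x y : Fin 3 → M} (ha : x α = y α) (hb : x β = y β) (hc : x γ = y γ) : x = y := by
  funext i
  rcases eq_of_three h1 h2 h3 i with rfl | rfl | rfl <;> assumption

theorem prod_three {α β γ : Fin 3} (h1 : α ≠ β) (h2 : α ≠ γ) (h3 : β ≠ γ) {M : Type*}
    [CommMonoid M] (f : Fin 3 → M) : ∏ i, f i = f α * f β * f γ := by
  have : (Finset.univ : Finset (Fin 3)) = {α, β, γ} := by
    ext i; simpa using eq_of_three h1 h2 h3 i
  rw [this, Finset.prod_insert (by simp [h1, h2]), Finset.prod_pair h3, mul_assoc]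

/-- `x` is a vertex with odd coordinate `γ`. -/
structure IsVtx (x : Point L) (α β γ : Fin 3) : Prop where
  ab : α ≠ β
  ac : α ≠ γ
  bc : β ≠ γ
  even : (res x α = 0 ∧ res x β = 2) ∨ (res x α = 2 ∧ res x β = 0)
  odd : res x γ = 1 ∨ res x γ = 3

theorem IsVtx.symm {x : Point L} {α β γ : Fin 3} (h : IsVtx x α β γ) : IsVtx x β α γ :=
  ⟨h.ab.symm, h.bc, h.ac, h.even.symm.imp And.symm And.symm, h.odd⟩

theorem IsVtx.exists_vertex {x : Point L} {α β γ : Fin 3} (h : IsVtx x α β γ) :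
    ∃ v : Vertex L, v.1 = x := by
  have key : ∀ α β γ : Fin 3, α ≠ β → α ≠ γ → β ≠ γ →
      ∃ π : Equiv.Perm (Fin 3), π 0 = α ∧ π 1 = β ∧ π 2 = γ := by decide
  rcases h.even with he | he
  · obtain ⟨π, h0, h1, h2⟩ := key α β γ h.ab h.ac h.bc
    exact ⟨⟨x, π, by rw [h0, h1, h2]; exact ⟨he.1, he.2, h.odd⟩⟩, rfl⟩
  · obtain ⟨π, h0, h1, h2⟩ := key β α γ h.ab.symm h.bc h.ac
    exact ⟨⟨x, π, by rw [h0, h1, h2]; exact ⟨he.2, he.1, h.odd⟩⟩, rfl⟩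

theorem Vertex.exists_isVtx (v : Vertex L) : ∃ α β γ, IsVtx v.1 α β γ := by
  obtain ⟨x, π, h0, h1, h2⟩ := v
  exact ⟨π 0, π 1, π 2, by simp, by simp, by simp, Or.inl ⟨h0, h1⟩, h2⟩

theorem odd_ne_even {r : ZMod 4} (h : r = 1 ∨ r = 3) (h' : r = 0 ∨ r = 2) : False := by
  revert r; decide

theorem Square.res_even (q : Square L) (i : Fin 3) : res q.1.2 i = 0 ∨ res q.1.2 i = 2 := by
  obtain ⟨⟨a, c⟩, h1, h2⟩ := q
  simp only at *
  by_cases hi : i = a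
  · subst hi; exact h1
  · rw [h2 i hi]
    rcases h1 with h | h <;> rw [h] <;> decide

theorem center_injective : Function.Injective (center (L := L)) := by
  rintro (q | h) (q' | h') heq
  · obtain ⟨⟨a, c⟩, h1, h2⟩ := q
    obtain ⟨⟨a', c'⟩, h1', h2'⟩ := q'
    simp only [center] at heq h1 h2 h1' h2'
    subst heq
    have : a = a' := by
      by_contra hne
      obtain ⟨k, hk, hk'⟩ : ∃ k : Fin 3, k ≠ a ∧ k ≠ a' := by
        clear h1 h2 h1' h2'; revert a a'; decide
      have e1 := h2 k hk
      have e2 := h2' k hk'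
      have e3 := h2 a' (Ne.symm hne)
      rw [e1, e3] at e2
      revert e2
      generalize res c a = r
      revert r; decide
    subst this
    rfl
  · exact (odd_ne_even (h'.2 0) (by rw [show h'.1 = q.1.2 from heq.symm]; exact q.res_even 0)).elim
  · exact (odd_ne_even (h.2 0) (by rw [show h.1 = q'.1.2 from heq]; exact q'.res_even 0)).elim
  · exact congrArg Sum.inr (Subtype.ext heq)

/-- The kind of a plaquette: `0`, `1`, `2` for `X`, `Y`, `Z`. -/
noncomputable def kind : Plaquette L → Fin 3
  | Sum.inl _ => 1
  | Sum.inr h => if ∏ i, res h.1 i = 1 then 0 else 2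

theorem plaquettePauli_eq (p : Plaquette L) : plaquettePauli p = pauli (kind p) := by
  rcases p with q | h
  · rfl
  · simp only [plaquettePauli, kind]
    split_ifs <;> rfl

theorem onPlaquette_square {v : Vertex L} {α β γ : Fin 3} (hv : IsVtx v.1 α β γ) (q : Square L) :
    OnPlaquette v (Sum.inl q) ↔ q.1.2 = v.1 + unit L γ ∨ q.1.2 = v.1 - unit L γ := by
  constructor
  · rintro ⟨j, hj, h⟩
    have hjγ : j = γ := by
      have h1 : res v.1 j = 1 ∨ res v.1 j = 3 := by
        rcases h with h | h
        · have : res v.1 j = res q.1.2 j + 1 := by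
            rw [h, res_add]; congr 1; exact res_unit_self j
          rw [this]
          rcases q.res_even j with e | e <;> rw [e] <;> decide
        · have : res v.1 j = res q.1.2 j - 1 := by
            rw [h, res_sub]; congr 1; exact res_unit_self j
          rw [this]
          rcases q.res_even j with e | e <;> rw [e] <;> decide
      rcases eq_of_three hv.ab hv.ac hv.bc j with rfl | rfl | rfl
      · exact (odd_ne_even h1 (hv.even.imp And.left And.left)).elim
      · exact (odd_ne_even h1 (hv.even.symm.imp And.right And.right)).elim
      · rfl
    subst hjγ
    rcases h with h | h
    · right; rw [h]; simp [unit]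
    · left; rw [h]; simp [unit]
  · intro h
    refine ⟨γ, ?_, ?_⟩
    · intro hγ
      have key : ∀ j, j ≠ γ → res q.1.2 j = res v.1 j := by
        intro j hj
        rcases h with h | h
        · rw [h, res_add, res_unit_ne hj, add_zero]
        · rw [h, res_sub, res_unit_ne hj, sub_zero]
      have e1 := q.2.2 α (by rw [← hγ]; exact hv.ac)
      have e2 := q.2.2 β (by rw [← hγ]; exact hv.bc)
      rw [key α hv.ac] at e1
      rw [key β hv.bc, ← e1] at e2
      rcases hv.even with ⟨a, b⟩ | ⟨a, b⟩ <;> rw [a, b] at e2 <;> revert e2 <;> decide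
    · rcases h with h | h
      · right; rw [h]; simp [unit]
      · left; rw [h]; simp [unit]

theorem normal_hexagon (h : Hexagon L) (i : Fin 3) :
    (normal (Sum.inr h) i = 1 ∧ res h.1 i = 1) ∨ (normal (Sum.inr h) i = -1 ∧ res h.1 i = 3) := by
  rcases h.2 i with e | e
  · left; simp [normal, e]
  · right; simp only [normal, e]; exact ⟨if_neg (by decide), trivial⟩

theorem single_eq_smul_unit (i : Fin 3) (n : ℤ) :
    (Pi.single i ((n : ℤ) : ZMod (4 * L)) : Point L) = n • unit L i := by
  funext j
  by_cases h : j = i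
  · subst h; simp [unit]
  · simp [unit, Pi.single_eq_of_ne h]

theorem onPlaquette_hexagon {v : Vertex L} {α β γ : Fin 3} (hv : IsVtx v.1 α β γ)
    (h : Hexagon L) : OnPlaquette v (Sum.inr h) ↔ ∃ ε δ : ℤˣ,
      h.1 = v.1 + (ε : ℤ) • unit L α + (δ : ℤ) • unit L β := by
  constructor
  · rintro ⟨j, k, hjk, h1⟩
    rw [single_eq_smul_unit, single_eq_smul_unit] at h1
    have hres : ∀ i, res v.1 i = res h.1 i + ((normal (Sum.inr h) k : ℤ) : ZMod 4) * res (unit L k) i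
        - ((normal (Sum.inr h) j : ℤ) : ZMod 4) * res (unit L j) i := by
      intro i
      rw [h1, res_sub, res_add]
      simp [res]
    have hevenj : ∀ i, i = j ∨ i = k → res v.1 i = 0 ∨ res v.1 i = 2 := by
      intro i hi
      rcases hi with rfl | rfl
      · rw [hres i, res_unit_self, res_unit_ne hjk]
        rcases normal_hexagon h i with ⟨a, b⟩ | ⟨a, b⟩ <;> rw [a, b] <;> simp <;> decide
      · rw [hres i, res_unit_self, res_unit_ne hjk.symm]
        rcases normal_hexagon h i with ⟨a, b⟩ | ⟨a, b⟩ <;> rw [a, b] <;> simp <;> decide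
    have hj : j ≠ γ := fun e => odd_ne_even hv.odd (by rw [← e]; exact hevenj j (Or.inl rfl))
    have hk : k ≠ γ := fun e => odd_ne_even hv.odd (by rw [← e]; exact hevenj k (Or.inr rfl))
    have hn : ∀ i, ∃ u : ℤˣ, normal (Sum.inr h) i = (u : ℤ) := by
      intro i
      rcases normal_hexagon h i with ⟨a, -⟩ | ⟨a, -⟩
      · exact ⟨1, by simp [a]⟩
      · exact ⟨-1, by simp [a]⟩
    obtain ⟨uj, huj⟩ := hn j
    obtain ⟨uk, huk⟩ := hn k
    rw [huj, huk] at h1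
    have hc : (j = α ∧ k = β) ∨ (j = β ∧ k = α) := by
      rcases eq_of_three hv.ab hv.ac hv.bc j with e | e | e <;>
      rcases eq_of_three hv.ab hv.ac hv.bc k with f | f | f <;>
      first
        | exact Or.inl ⟨e, f⟩ | exact Or.inr ⟨e, f⟩ | exact absurd (e.trans f.symm) hjk
        | exact absurd e hj | exact absurd f hk
    rcases hc with ⟨rfl, rfl⟩ | ⟨rfl, rfl⟩
    · refine ⟨uj, -uk, ?_⟩
      rw [h1]; simp only [Units.val_neg]; module
    · refine ⟨-uk, uj, ?_⟩
      rw [h1]; simp only [Units.val_neg]; module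
  · rintro ⟨ε, δ, h1⟩
    have hα : res h.1 α = res v.1 α + ((ε : ℤ) : ZMod 4) := by
      rw [h1, res_add, res_add]
      simp [res, unit, Pi.single_eq_of_ne hv.ab]
    have hβ : res h.1 β = res v.1 β + ((δ : ℤ) : ZMod 4) := by
      rw [h1, res_add, res_add]
      simp [res, unit, Pi.single_eq_of_ne hv.ab.symm]
    have hcase : ((normal (Sum.inr h) α = ε ∧ normal (Sum.inr h) β = -δ) ∨
        (normal (Sum.inr h) α = -ε ∧ normal (Sum.inr h) β = δ)) := by
      rcases normal_hexagon h α with ⟨a, b⟩ | ⟨a, b⟩ <;>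
      rcases normal_hexagon h β with ⟨a', b'⟩ | ⟨a', b'⟩ <;>
      rcases hv.even with ⟨c, d⟩ | ⟨c, d⟩ <;>
      rcases Int.units_eq_one_or ε with rfl | rfl <;>
      rcases Int.units_eq_one_or δ with rfl | rfl <;>
      rw [b, c] at hα <;> rw [b', d] at hβ <;> rw [a, a'] <;>
      first | decide | (exfalso; revert hα; decide) | (exfalso; revert hβ; decide)
    rcases hcase with ⟨a, b⟩ | ⟨a, b⟩
    · refine ⟨α, β, hv.ab, ?_⟩
      rw [single_eq_smul_unit, single_eq_smul_unit, a, b, h1]; module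
    · refine ⟨β, α, hv.ab.symm, ?_⟩
      rw [single_eq_smul_unit, single_eq_smul_unit, a, b, h1]; module

theorem kind_hexagon {v : Vertex L} {α β γ : Fin 3} (hv : IsVtx v.1 α β γ) (h : Hexagon L)
    {ε δ : ℤˣ} (he : h.1 = v.1 + (ε : ℤ) • unit L α + (δ : ℤ) • unit L β) :
    kind (Sum.inr h) = if ((ε * δ : ℤˣ) : ℤ) * (res v.1 γ) = 3 then 0 else 2 := by
  have hα : res h.1 α = res v.1 α + ((ε : ℤ) : ZMod 4) := by
    rw [he, res_add, res_add]
    simp [res, unit, Pi.single_eq_of_ne hv.ab]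
  have hβ : res h.1 β = res v.1 β + ((δ : ℤ) : ZMod 4) := by
    rw [he, res_add, res_add]
    simp [res, unit, Pi.single_eq_of_ne hv.ab.symm]
  have hγ : res h.1 γ = res v.1 γ := by
    rw [he, res_add, res_add]
    simp [res, unit, Pi.single_eq_of_ne hv.ac.symm, Pi.single_eq_of_ne hv.bc.symm]
  simp only [kind, prod_three hv.ab hv.ac hv.bc, hα, hβ, hγ]
  congr 1
  rcases hv.even with ⟨c, d⟩ | ⟨c, d⟩ <;>
  rcases hv.odd with e | e <;>
  rcases Int.units_eq_one_or ε with rfl | rfl <;>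
  rcases Int.units_eq_one_or δ with rfl | rfl <;>
  rw [c, d, e] <;> simp <;> decide

theorem kind_ne_one (h : Hexagon L) : kind (Sum.inr h) ≠ 1 := by
  simp only [kind]; split_ifs <;> decide

end Geometry

section Overlap

variable {L : ℕ}

theorem even_card_of_involution {S : Finset (Vertex L)} (f : Point L → Point L)
    (hf : ∀ x, f (f x) = x) (h : ∀ v ∈ S, ∃ v' ∈ S, v'.1 = f v.1 ∧ v' ≠ v) : Even S.card := by
  choose g hg1 hg2 hg3 using h
  have h0 : ∑ v ∈ S, (1 : ZMod 2) = 0 := by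
    refine Finset.sum_involution g (fun v hv => by decide) (fun v hv _ => hg3 v hv) hg1 ?_
    intro v hv
    apply Subtype.ext
    rw [hg2 _ (hg1 v hv), hg2 v hv, hf]
  rw [Finset.sum_const, nsmul_eq_mul, mul_one] at h0
  exact (ZMod.natCast_eq_zero_iff_even).1 h0

theorem coord_ne_of_res_ne {x y : Point L} {i : Fin 3} (h : res x i ≠ res y i) : x ≠ y :=
  fun e => h (by rw [e])

theorem zsmul_unit_self (i : Fin 3) (n : ℤ) : (n • unit L i) i = n := by simp [unit]

theorem zsmul_unit_ne {i j : Fin 3} (h : j ≠ i) (n : ℤ) : (n • unit L i) j = 0 := by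
  simp [unit, Pi.single_eq_of_ne h]

theorem res_zsmul_unit_self (i : Fin 3) (n : ℤ) : res (n • unit L i) i = n := by
  simp [res, unit]

theorem res_zsmul_unit_ne {i j : Fin 3} (h : j ≠ i) (n : ℤ) : res (n • unit L i) j = 0 := by
  simp [res, unit, Pi.single_eq_of_ne h]

theorem overlap_square_hexagon [NeZero L] (q : Square L) (h : Hexagon L) (v : Vertex L)
    (h1 : OnPlaquette v (Sum.inl q)) (h2 : OnPlaquette v (Sum.inr h)) :
    ∃ v' : Vertex L, OnPlaquette v' (Sum.inl q) ∧ OnPlaquette v' (Sum.inr h) ∧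
      v'.1 = q.1.2 + h.1 - Pi.single q.1.1 (h.1 q.1.1 - q.1.2 q.1.1) - v.1 ∧ v' ≠ v := by
  obtain ⟨α, β, γ, hv⟩ := v.exists_isVtx
  obtain ⟨δ, hδ⟩ : ∃ δ : ℤˣ, v.1 = q.1.2 + (δ : ℤ) • unit L γ := by
    rcases (onPlaquette_square hv q).1 h1 with e | e
    · exact ⟨-1, by rw [e]; simp⟩
    · exact ⟨1, by rw [e]; simp⟩
  have hax : q.1.1 = α ∨ q.1.1 = β := by
    rcases eq_of_three hv.ab hv.ac hv.bc q.1.1 with e | e | e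
    · exact Or.inl e
    · exact Or.inr e
    · exfalso
      have e1 := q.2.2 α (by rw [e]; exact hv.ac)
      have e2 := q.2.2 β (by rw [e]; exact hv.bc)
      have f1 : res v.1 α = res q.1.2 α := by
        rw [hδ, res_add, res_zsmul_unit_ne hv.ac, add_zero]
      have f2 : res v.1 β = res q.1.2 β := by
        rw [hδ, res_add, res_zsmul_unit_ne hv.bc, add_zero]
      have := hv.even
      rw [f1, f2, e1, e2] at this
      revert this
      generalize res q.1.2 q.1.1 + 2 = r
      revert r; decide
  wlog hα : q.1.1 = α generalizing α β
  · exact this β α hv.symm hax.symm (hax.resolve_left hα)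
  clear hax
  obtain ⟨ε, ε', hε⟩ := (onPlaquette_hexagon hv h).1 h2
  have hdiff : h.1 q.1.1 - q.1.2 q.1.1 = ((ε : ℤ) : ZMod (4 * L)) := by
    rw [hε, hα, hδ]
    simp [unit_self, unit_ne hv.ab, unit_ne hv.ac]
  rw [hdiff, single_eq_smul_unit, hα]
  have hx : q.1.2 + h.1 - (ε : ℤ) • unit L α - v.1 = q.1.2 + (ε' : ℤ) • unit L β := by
    rw [hε]; module
  rw [hx]
  have rα : res q.1.2 α = res v.1 α := by rw [hδ, res_add, res_zsmul_unit_ne hv.ac, add_zero]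
  have rβ : res q.1.2 β = res v.1 β := by rw [hδ, res_add, res_zsmul_unit_ne hv.bc, add_zero]
  have rγ : res q.1.2 γ = res q.1.2 β := by
    rw [q.2.2 γ (by rw [hα]; exact hv.ac.symm), q.2.2 β (by rw [hα]; exact hv.ab.symm)]
  have hv' : IsVtx (q.1.2 + (ε' : ℤ) • unit L β) α γ β := by
    refine ⟨hv.ac, hv.ab, hv.bc.symm, ?_, ?_⟩
    · rw [res_add, res_add, res_zsmul_unit_ne hv.ab, res_zsmul_unit_ne hv.bc.symm, add_zero,
        add_zero, rγ, rα, rβ]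
      exact hv.even
    · rw [res_add, res_zsmul_unit_self, rβ]
      rcases hv.even with ⟨_, e⟩ | ⟨_, e⟩ <;> rw [e] <;>
      rcases Int.units_eq_one_or ε' with rfl | rfl <;> decide
  obtain ⟨v', hv'e⟩ := hv'.exists_vertex
  rw [← hv'e] at hv' ⊢
  refine ⟨v', ?_, ?_, rfl, ?_⟩
  · rw [onPlaquette_square hv', hv'e]
    rcases Int.units_eq_one_or ε' with rfl | rfl
    · right; simp
    · left; simp
  · rw [onPlaquette_hexagon hv']
    refine ⟨ε, δ, ?_⟩
    rw [hε, hδ, hv'e]; module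
  · intro e
    have h3 : res v'.1 γ = res v.1 γ := by rw [e]
    rw [hv'e, res_add, res_zsmul_unit_ne hv.bc.symm, add_zero] at h3
    exact odd_ne_even (h3 ▸ hv.odd) (q.res_even γ)

theorem two_ne_zero_zmod [NeZero L] (u : ℤˣ) : (2 * (u : ℤ) : ZMod (4 * L)) ≠ 0 := by
  intro h
  have h1 := congrArg (ZMod.castHom (Dvd.intro L rfl : 4 ∣ 4 * L) (ZMod 4)) h
  rw [map_mul, map_zero, map_intCast] at h1
  have : ZMod.castHom (Dvd.intro L rfl : 4 ∣ 4 * L) (ZMod 4) 2 = 2 := map_ofNat _ 2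
  rw [this] at h1
  rcases Int.units_eq_one_or u with rfl | rfl <;> revert h1 <;> decide

open Classical in
theorem overlap_hexagon_hexagon [NeZero L] (h h' : Hexagon L)
    (hk : kind (Sum.inr h) ≠ kind (Sum.inr h')) :
    Even (Finset.univ.filter fun v : Vertex L =>
      OnPlaquette v (Sum.inr h) ∧ OnPlaquette v (Sum.inr h')).card := by
  by_cases hex : ∃ (α : Fin 3) (u : ℤˣ), h'.1 = h.1 + (2 * (u : ℤ)) • unit L α
  · obtain ⟨α, u, hu⟩ := hex
    obtain ⟨β, γ, hab, hac, hbc⟩ : ∃ β γ : Fin 3, α ≠ β ∧ α ≠ γ ∧ β ≠ γ := by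
      clear hu; revert α; decide
    let n : Fin 3 → ZMod (4 * L) := fun i => ((normal (Sum.inr h) i : ℤ) : ZMod (4 * L))
    let s := Equiv.swap β γ
    have hn : ∀ i, n i * n i = 1 := by
      intro i
      rcases normal_hexagon h i with ⟨a, -⟩ | ⟨a, -⟩ <;> simp [n, a]
    have hs : ∀ i, s (s i) = i := fun i => Equiv.swap_apply_self _ _ _
    refine even_card_of_involution
      (fun x i => h.1 i + n i * n (s i) * (x (s i) - h.1 (s i))) ?_ ?_
    · intro x
      funext i
      simp only [hs]
      linear_combination (n i * n i * (x i - h.1 i)) * hn (s i) + (x i - h.1 i) * hn i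
    · intro v hv
      rw [Finset.mem_filter] at hv
      obtain ⟨-, hv1, hv2⟩ := hv
      obtain ⟨A, B, C, hvt⟩ := v.exists_isVtx
      obtain ⟨ε₁, δ₁, e1⟩ := (onPlaquette_hexagon hvt h).1 hv1
      obtain ⟨ε₂, δ₂, e2⟩ := (onPlaquette_hexagon hvt h').1 hv2
      have hαC : α ≠ C := by
        rintro rfl
        have := congrFun hu α
        rw [e2, e1] at this
        simp only [Pi.add_apply, zsmul_unit_ne hvt.ac.symm, zsmul_unit_ne hvt.bc.symm,
          zsmul_unit_self, add_zero, left_eq_add] at this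
        exact two_ne_zero_zmod (L := L) u (by push_cast at this; exact this)
      have hA : α = A ∨ α = B := by
        rcases eq_of_three hvt.ab hvt.ac hvt.bc α with e | e | e
        · exact Or.inl e
        · exact Or.inr e
        · exact absurd e hαC
      wlog hA' : α = A generalizing A B ε₁ δ₁ ε₂ δ₂
      · exact this B A hvt.symm δ₁ ε₁ (by rw [e1]; module) δ₂ ε₂ (by rw [e2]; module) hA.symm
          (hA.resolve_left hA')
      subst hA'
      clear hA
      have hsB : s B = C ∧ s C = B ∧ s α = α := by
        have h3 : ∀ α β γ B C : Fin 3, α ≠ β → α ≠ γ → β ≠ γ → α ≠ B → α ≠ C → B ≠ C →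
            Equiv.swap β γ B = C ∧ Equiv.swap β γ C = B ∧ Equiv.swap β γ α = α := by decide
        exact h3 α β γ B C hab hac hbc hvt.ab hvt.ac hvt.bc
      obtain ⟨hsB, hsC, hsα⟩ := hsB
      obtain ⟨uB, huB, huB'⟩ : ∃ w : ℤˣ, normal (Sum.inr h) B = (w : ℤ) ∧
          res h.1 B = ((w : ℤ) : ZMod 4) := by
        rcases normal_hexagon h B with ⟨a, b⟩ | ⟨a, b⟩
        · exact ⟨1, by simp [a], by rw [b]; decide⟩
        · exact ⟨-1, by simp [a], by rw [b]; decide⟩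
      obtain ⟨uC, huC, huC'⟩ : ∃ w : ℤˣ, normal (Sum.inr h) C = (w : ℤ) ∧
          res h.1 C = ((w : ℤ) : ZMod 4) := by
        rcases normal_hexagon h C with ⟨a, b⟩ | ⟨a, b⟩
        · exact ⟨1, by simp [a], by rw [b]; decide⟩
        · exact ⟨-1, by simp [a], by rw [b]; decide⟩
      let w : ℤˣ := uB * uC * δ₁
      have hfx : (fun i => h.1 i + n i * n (s i) * (v.1 (s i) - h.1 (s i))) =
          h.1 - (ε₁ : ℤ) • unit L α - (w : ℤ) • unit L C := by
        refine ext_three hvt.ab hvt.ac hvt.bc ?_ ?_ ?_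
        · simp only [hsα, hn, one_mul, Pi.sub_apply, zsmul_unit_self, zsmul_unit_ne hvt.ac]
          rw [e1]
          simp only [Pi.add_apply, zsmul_unit_self, zsmul_unit_ne hvt.ab]
          ring
        · simp only [hsB, Pi.sub_apply, zsmul_unit_ne hvt.ab.symm, zsmul_unit_ne hvt.bc]
          rw [e1]
          simp only [Pi.add_apply, zsmul_unit_self, zsmul_unit_ne hvt.ac.symm,
            zsmul_unit_ne hvt.bc.symm, zsmul_unit_ne hvt.ab.symm]
          ring
        · simp only [hsC, Pi.sub_apply, zsmul_unit_self, zsmul_unit_ne hvt.ac.symm, n, huB, huC]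
          rw [e1]
          simp only [Pi.add_apply, zsmul_unit_self, zsmul_unit_ne hvt.ac.symm,
            zsmul_unit_ne hvt.bc.symm, zsmul_unit_ne hvt.ab.symm, w]
          push_cast
          ring
      have r1 : res h.1 α = res v.1 α + ((ε₁ : ℤ) : ZMod 4) := by
        rw [e1, res_add, res_add, res_zsmul_unit_self, res_zsmul_unit_ne hvt.ab, add_zero]
      have r2 : res h.1 B = res v.1 B + ((δ₁ : ℤ) : ZMod 4) := by
        rw [e1, res_add, res_add, res_zsmul_unit_self, res_zsmul_unit_ne hvt.ab.symm, add_zero]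
      have hvt' : IsVtx (h.1 - (ε₁ : ℤ) • unit L α - (w : ℤ) • unit L C) α C B := by
        refine ⟨hvt.ac, hvt.ab, hvt.bc.symm, ?_, ?_⟩
        · rw [res_sub, res_sub, res_sub, res_sub, res_zsmul_unit_self, res_zsmul_unit_self,
            res_zsmul_unit_ne hvt.ac, res_zsmul_unit_ne hvt.ac.symm, r1, huC']
          rw [huB'] at r2
          simp only [add_sub_cancel_right, sub_zero]
          have h4 : ∀ w : ℤˣ, ∀ r : ZMod 4, ((uB : ℤ) : ZMod 4) = r + ((δ₁ : ℤ) : ZMod 4) →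
              (r = 0 ∨ r = 2) →
              ((uC : ℤ) : ZMod 4) - (((uB * uC * δ₁ : ℤˣ) : ℤ) : ZMod 4) = r := by
            intro _
            rcases Int.units_eq_one_or uB with rfl | rfl <;>
            rcases Int.units_eq_one_or uC with rfl | rfl <;>
            rcases Int.units_eq_one_or δ₁ with rfl | rfl <;> decide
          rw [h4 w _ r2 (hvt.even.symm.imp And.right And.right)]
          exact hvt.even
        · rw [res_sub, res_sub, res_zsmul_unit_ne hvt.ab.symm, res_zsmul_unit_ne hvt.bc, sub_zero,
            sub_zero]
          exact h.2 B
      obtain ⟨v', hv'e⟩ := hvt'.exists_vertex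
      rw [← hv'e] at hvt'
      refine ⟨v', ?_, by rw [hv'e, ← hfx], ?_⟩
      · rw [Finset.mem_filter]
        refine ⟨Finset.mem_univ _, (onPlaquette_hexagon hvt' h).2 ⟨ε₁, w, ?_⟩,
          (onPlaquette_hexagon hvt' h').2 ⟨ε₂, w, ?_⟩⟩
        · rw [hv'e]; module
        · have hd : δ₁ = δ₂ := by
            by_contra hne
            have := congrFun hu B
            rw [e2, e1] at this
            simp only [Pi.add_apply, zsmul_unit_ne hvt.ab.symm, zsmul_unit_self, add_zero,
              add_right_inj] at this
            have hδ : δ₂ = -δ₁ := by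
              rcases Int.units_eq_one_or δ₁ with rfl | rfl <;>
              rcases Int.units_eq_one_or δ₂ with rfl | rfl <;> simp_all
            refine two_ne_zero_zmod (L := L) δ₁ ?_
            rw [hδ] at this
            push_cast at this
            linear_combination -this
          rw [hv'e]
          have : h'.1 = h.1 + ((ε₂ : ℤ) • unit L α - (ε₁ : ℤ) • unit L α) := by
            rw [e2, e1, hd]; module
          rw [this]; module
      · intro e
        have h3 : res v'.1 B = res v.1 B := by rw [e]
        have h4 := hvt'.odd
        rw [h3] at h4
        exact odd_ne_even h4 (hvt.even.symm.imp And.right And.right)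
  · rw [Finset.filter_eq_empty_iff.2]
    · simp
    · rintro v - ⟨hv1, hv2⟩
      obtain ⟨A, B, C, hvt⟩ := v.exists_isVtx
      obtain ⟨ε₁, δ₁, e1⟩ := (onPlaquette_hexagon hvt h).1 hv1
      obtain ⟨ε₂, δ₂, e2⟩ := (onPlaquette_hexagon hvt h').1 hv2
      rw [kind_hexagon hvt h e1, kind_hexagon hvt h' e2] at hk
      have hprod : ε₁ * δ₁ ≠ ε₂ * δ₂ := fun e => hk (by rw [e])
      apply hex
      by_cases hε : ε₁ = ε₂
      · refine ⟨B, δ₂, ?_⟩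
        have hδ : δ₁ = -δ₂ := by
          rcases Int.units_eq_one_or δ₁ with rfl | rfl <;>
          rcases Int.units_eq_one_or δ₂ with rfl | rfl <;> simp_all
        rw [e2, e1, hδ, hε, Units.val_neg]; module
      · refine ⟨A, ε₂, ?_⟩
        have hε' : ε₁ = -ε₂ := by
          rcases Int.units_eq_one_or ε₁ with rfl | rfl <;>
          rcases Int.units_eq_one_or ε₂ with rfl | rfl <;> simp_all
        have hδ : δ₁ = δ₂ := by
          by_contra hne
          apply hprod
          rcases Int.units_eq_one_or δ₁ with rfl | rfl <;>
          rcases Int.units_eq_one_or δ₂ with rfl | rfl <;> simp_all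
        rw [e2, e1, hδ, hε', Units.val_neg]; module

open Classical in
theorem evenOverlap_onPlaquette [NeZero L] :
    EvenOverlap (fun (v : Vertex L) (p : Plaquette L) => OnPlaquette v p) kind := by
  have hsq : ∀ (q : Square L) (h : Hexagon L), Even (Finset.univ.filter fun v : Vertex L =>
      OnPlaquette v (Sum.inl q) ∧ OnPlaquette v (Sum.inr h)).card := by
    intro q h
    refine even_card_of_involution
      (fun x => q.1.2 + h.1 - Pi.single q.1.1 (h.1 q.1.1 - q.1.2 q.1.1) - x)
      (fun x => by simp) ?_
    intro v hv
    rw [Finset.mem_filter] at hv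
    obtain ⟨v', h1, h2, h3, h4⟩ := overlap_square_hexagon q h v hv.2.1 hv.2.2
    exact ⟨v', Finset.mem_filter.2 ⟨Finset.mem_univ _, h1, h2⟩, h3, h4⟩
  rintro (q | h) (q' | h') hk
  · exact absurd rfl hk
  · convert hsq q h'
  · simp only [and_comm (a := OnPlaquette _ (Sum.inr h))]
    convert hsq q' h
  · convert overlap_hexagon_hexagon h h' hk

end Overlap

section Kernel

set_option linter.unusedSectionVars false

variable {L : ℕ} [NeZero L]

open Classical in
/-- A sign on the plaquettes as a function of the centre, with value `1` at other points. -/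
noncomputable def extend (a : Plaquette L → ℤˣ) (x : Point L) : ℤˣ :=
  ∏ p, if center p = x then a p else 1

theorem extend_center (a : Plaquette L → ℤˣ) (p : Plaquette L) : extend a (center p) = a p := by
  classical
  rw [extend, Finset.prod_eq_single p]
  · simp
  · intro q _ hq
    rw [if_neg fun h => hq (center_injective h)]
  · simp

theorem extend_mul (a b : Plaquette L → ℤˣ) (x : Point L) :
    extend (a * b) x = extend a x * extend b x := by
  simp only [extend, ← Finset.prod_mul_distrib]
  exact Finset.prod_congr rfl fun p _ => by split_ifs <;> simp

theorem prod_ite_eq_extend (a : Plaquette L → ℤˣ) (Q : Plaquette L → Prop) [DecidablePred Q] {x y : Point L}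
    (hxy : x ≠ y) (hQ : ∀ p, Q p ↔ center p = x ∨ center p = y) :
    (∏ p, if Q p then a p else 1) = extend a x * extend a y := by
  simp only [extend, ← Finset.prod_mul_distrib]
  refine Finset.prod_congr rfl fun p _ => ?_
  by_cases h1 : center p = x
  · have h2 : center p ≠ y := fun h => hxy (h1.symm.trans h)
    rw [if_pos ((hQ p).2 (Or.inl h1)), if_pos h1, if_neg h2, mul_one]
  · by_cases h2 : center p = y
    · rw [if_pos ((hQ p).2 (Or.inr h2)), if_neg h1, if_pos h2, one_mul]
    · rw [if_neg fun h => ((hQ p).1 h).elim h1 h2, if_neg h1, if_neg h2, one_mul]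

/-- The group of the sets of plaquettes whose plaquette operators multiply to a scalar. -/
noncomputable def plaquetteKernel (L : ℕ) [NeZero L] : Subgroup (Plaquette L → ℤˣ) :=
  scalarKernel (fun (v : Vertex L) p => OnPlaquette v p) kind

theorem IsVtx.pm_ne {x : Point L} {α β γ : Fin 3} (h : IsVtx x α β γ) :
    x + unit L γ ≠ x - unit L γ := by
  apply coord_ne_of_res_ne (i := γ)
  rw [res_add, res_sub, res_unit_self]
  rcases h.odd with e | e <;> rw [e] <;> decide

theorem IsVtx.pp_ne {x : Point L} {α β γ : Fin 3} (h : IsVtx x α β γ) :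
    x + unit L α + unit L β ≠ x - unit L α - unit L β := by
  apply coord_ne_of_res_ne (i := α)
  rw [res_add, res_sub, res_add, res_sub, res_unit_self, res_unit_ne h.ab]
  rcases h.even with e | e <;> rw [e.1] <;> decide

theorem IsVtx.pm_ne' {x : Point L} {α β γ : Fin 3} (h : IsVtx x α β γ) :
    x + unit L α - unit L β ≠ x - unit L α + unit L β := by
  apply coord_ne_of_res_ne (i := α)
  rw [res_sub, res_add, res_add, res_sub, res_unit_self, res_unit_ne h.ab]
  rcases h.even with e | e <;> rw [e.1] <;> decide

theorem localSign_one (a : Plaquette L → ℤˣ) {v : Vertex L} {α β γ : Fin 3}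
    (hv : IsVtx v.1 α β γ) :
    localSign (fun (v : Vertex L) p => OnPlaquette v p) kind a v 1 =
      extend a (v.1 + unit L γ) * extend a (v.1 - unit L γ) := by
  classical
  rw [localSign]
  suffices h : ∀ p, (OnPlaquette v p ∧ kind p = 1) ↔
      center p = v.1 + unit L γ ∨ center p = v.1 - unit L γ by
    convert prod_ite_eq_extend a (fun p => OnPlaquette v p ∧ kind p = 1) hv.pm_ne h
  rintro (q | h)
  · rw [onPlaquette_square hv]
    simp [kind, center]
  · refine ⟨fun hh => absurd hh.2 (kind_ne_one h), fun hh => ?_⟩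
    exfalso
    have : res h.1 α = res v.1 α := by
      rcases hh with e | e
      · rw [show h.1 = _ from e, res_add, res_unit_ne hv.ac, add_zero]
      · rw [show h.1 = _ from e, res_sub, res_unit_ne hv.ac, sub_zero]
    exact odd_ne_even (h.2 α) (by rw [this]; exact hv.even.imp And.left And.left)

theorem center_square_ne {v : Vertex L} {α β γ : Fin 3} (hv : IsVtx v.1 α β γ) (q : Square L)
    (ε δ : ℤˣ) : center (Sum.inl q) ≠ v.1 + (ε : ℤ) • unit L α + (δ : ℤ) • unit L β := by
  intro h
  have h1 : res q.1.2 γ = res v.1 γ := by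
    rw [show q.1.2 = _ from h, res_add, res_add, res_zsmul_unit_ne hv.ac.symm,
      res_zsmul_unit_ne hv.bc.symm, add_zero, add_zero]
  exact odd_ne_even hv.odd (h1 ▸ q.res_even γ)

theorem localSign_hexagon (a : Plaquette L → ℤˣ) {v : Vertex L} {α β γ : Fin 3}
    (hv : IsVtx v.1 α β γ) (k : Fin 3) (hk1 : k ≠ 1) :
    localSign (fun (v : Vertex L) p => OnPlaquette v p) kind a v k =
      if (k = 0 ↔ res v.1 γ = 3) then
        extend a (v.1 + unit L α + unit L β) * extend a (v.1 - unit L α - unit L β)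
      else extend a (v.1 + unit L α - unit L β) * extend a (v.1 - unit L α + unit L β) := by
  have key : ∀ u : ℤˣ, (k = 0 ↔ ((u : ℤ) : ZMod 4) * res v.1 γ = 3) →
      ∀ p : Plaquette L, (OnPlaquette v p ∧ kind p = k) ↔
        center p = v.1 + unit L α + (u : ℤ) • unit L β ∨
        center p = v.1 - unit L α - (u : ℤ) • unit L β := by
    intro u hu p
    have e1 : v.1 + unit L α + (u : ℤ) • unit L β =
        v.1 + ((1 : ℤˣ) : ℤ) • unit L α + (u : ℤ) • unit L β := by simp
    have e2 : v.1 - unit L α - (u : ℤ) • unit L β =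
        v.1 + ((-1 : ℤˣ) : ℤ) • unit L α + ((-u : ℤˣ) : ℤ) • unit L β := by
      rw [Units.val_neg, Units.val_neg, Units.val_one]; module
    rcases p with q | h
    · constructor
      · rintro ⟨-, h⟩
        exact absurd h.symm hk1
      · rw [e1, e2]
        rintro (h | h) <;> exact absurd h (center_square_ne hv q _ _)
    · rw [onPlaquette_hexagon hv h]
      have hkk : ∀ w : ℤˣ, (if ((w : ℤ) : ZMod 4) * res v.1 γ = 3 then (0 : Fin 3) else 2) = k ↔
          w = u := by
        intro w
        rcases hv.odd with e | e <;> rw [e] at hu ⊢ <;>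
        rcases Int.units_eq_one_or w with rfl | rfl <;>
        rcases Int.units_eq_one_or u with rfl | rfl <;>
        revert k <;> decide
      constructor
      · rintro ⟨⟨ε, δ, he⟩, h2⟩
        rw [kind_hexagon hv h he, hkk] at h2
        rw [e1, e2]
        rcases Int.units_eq_one_or ε with rfl | rfl
        · left; rw [one_mul] at h2; rw [← h2]; exact he
        · right
          have : δ = -u := by rw [← h2]; simp
          rw [← this]; exact he
      · rintro (hh | hh)
        · rw [e1] at hh
          refine ⟨⟨1, u, hh⟩, ?_⟩
          rw [kind_hexagon hv h hh, hkk, one_mul]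
        · rw [e2] at hh
          refine ⟨⟨-1, -u, hh⟩, ?_⟩
          rw [kind_hexagon hv h hh, hkk]; simp
  classical
  rw [localSign]
  split_ifs with hc
  · have := key 1 (by simpa using hc)
    simp only [Units.val_one, one_smul] at this
    convert prod_ite_eq_extend a (fun p => OnPlaquette v p ∧ kind p = k) hv.pp_ne this
  · have := key (-1) (by
      rcases hv.odd with e | e <;> rw [e] at hc ⊢ <;> clear key <;> revert k <;> decide)
    simp only [Units.val_neg, Units.val_one, neg_smul, one_smul, ← sub_eq_add_neg,
      sub_neg_eq_add] at this
    convert prod_ite_eq_extend a (fun p => OnPlaquette v p ∧ kind p = k) hv.pm_ne' this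

theorem mem_plaquetteKernel {a : Plaquette L → ℤˣ} : a ∈ plaquetteKernel L ↔
    ∀ (x : Point L) (α β γ : Fin 3), IsVtx x α β γ →
      extend a (x + unit L γ) * extend a (x - unit L γ) =
        extend a (x + unit L α + unit L β) * extend a (x - unit L α - unit L β) ∧
      extend a (x + unit L γ) * extend a (x - unit L γ) =
        extend a (x + unit L α - unit L β) * extend a (x - unit L α + unit L β) := by
  rw [plaquetteKernel, mem_scalarKernel]
  constructor
  · intro h x α β γ hx
    obtain ⟨v, rfl⟩ := hx.exists_vertex
    obtain ⟨h1, h2⟩ := h v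
    rw [localSign_hexagon a hx 0 (by decide), localSign_one a hx] at h1
    rw [localSign_hexagon a hx 0 (by decide), localSign_hexagon a hx 2 (by decide)] at h2
    by_cases hc : res v.1 γ = 3
    · simp only [hc, iff_true, if_true, show (2 : Fin 3) ≠ 0 by decide, if_false] at h1 h2
      exact ⟨h1.symm, h1.symm.trans h2⟩
    · simp only [hc, iff_false, not_true, if_false, show (2 : Fin 3) ≠ 0 by decide,
        if_true] at h1 h2
      exact ⟨h1.symm.trans h2, h1.symm⟩
  · intro h v
    obtain ⟨α, β, γ, hv⟩ := v.exists_isVtx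
    obtain ⟨h1, h2⟩ := h v.1 α β γ hv
    rw [localSign_hexagon a hv 0 (by decide), localSign_one a hv,
      localSign_hexagon a hv 2 (by decide)]
    by_cases hc : res v.1 γ = 3
    · simp only [hc, iff_true, if_true, show (2 : Fin 3) ≠ 0 by decide, if_false]
      exact ⟨h1.symm, h1.symm.trans h2⟩
    · simp only [hc, iff_false, not_true, if_false, show (2 : Fin 3) ≠ 0 by decide,
        if_true]
      exact ⟨h2.symm, h2.symm.trans h1⟩

end Kernel

section Curl

set_option linter.unusedSectionVars false

variable {L : ℕ} [NeZero L]

/-- `c` is the centre of a square with axis `i`. -/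
structure IsSq (c : Point L) (i j k : Fin 3) : Prop where
  ij : i ≠ j
  ik : i ≠ k
  jk : j ≠ k
  even : res c i = 0 ∨ res c i = 2
  resj : res c j = res c i + 2
  resk : res c k = res c i + 2

theorem IsSq.symm {c : Point L} {i j k : Fin 3} (h : IsSq c i j k) : IsSq c i k j :=
  ⟨h.ik, h.ij, h.jk.symm, h.even, h.resk, h.resj⟩

theorem IsSq.exists_square {c : Point L} {i j k : Fin 3} (h : IsSq c i j k) :
    ∃ q : Square L, q.1 = (i, c) := by
  refine ⟨⟨(i, c), h.even, fun l hl => ?_⟩, rfl⟩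
  rcases eq_of_three h.ij h.ik h.jk l with rfl | rfl | rfl
  · exact absurd rfl hl
  · exact h.resj
  · exact h.resk

theorem IsSq.isVtx {c : Point L} {i j k : Fin 3} (h : IsSq c i j k) (δ : ℤˣ) :
    IsVtx (c + (δ : ℤ) • unit L j) i k j := by
  refine ⟨h.ik, h.ij, h.jk.symm, ?_, ?_⟩
  · rw [res_add, res_add, res_zsmul_unit_ne h.ij, res_zsmul_unit_ne h.jk.symm, h.resk]
    rcases h.even with e | e <;> rw [e] <;> decide
  · rw [res_add, res_zsmul_unit_self, h.resj]
    rcases h.even with e | e <;> rw [e] <;>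
    rcases Int.units_eq_one_or δ with rfl | rfl <;> decide

theorem IsSq.move {c : Point L} {i j k : Fin 3} (h : IsSq c i j k) (δ : ℤˣ) :
    IsSq (c + (2 * (δ : ℤ)) • unit L j) k i j := by
  refine ⟨h.ik.symm, h.jk.symm, h.ij, ?_, ?_, ?_⟩
  · rw [res_add, res_zsmul_unit_ne h.jk.symm, h.resk]
    rcases h.even with e | e <;> rw [e] <;> decide
  · rw [res_add, res_zsmul_unit_ne h.ij, res_add, res_zsmul_unit_ne h.jk.symm, h.resk]
    rcases h.even with e | e <;> rw [e] <;> decide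
  · rw [res_add, res_zsmul_unit_self, res_add, res_zsmul_unit_ne h.jk.symm, h.resk, h.resj]
    rcases h.even with e | e <;> rw [e] <;>
    rcases Int.units_eq_one_or δ with rfl | rfl <;> decide

/-- The product of the signs of the three plaquettes at an edge of the square with centre `c` and
axis `i`. -/
def curl (E : Point L → ℤˣ) (c : Point L) (i j k : Fin 3) (δ δ' : ℤˣ) : ℤˣ :=
  E c * E (c + unit L i + (δ : ℤ) • unit L j + (δ' : ℤ) • unit L k) *
    E (c - unit L i + (δ : ℤ) • unit L j + (δ' : ℤ) • unit L k)

theorem curl_symm (E : Point L → ℤˣ) (c : Point L) (i j k : Fin 3) (δ δ' : ℤˣ) :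
    curl E c i j k δ δ' = curl E c i k j δ' δ := by
  simp only [curl, add_right_comm _ ((δ : ℤ) • unit L j)]

/-- The conditions at the vertices. -/
def VertexCond (E : Point L → ℤˣ) : Prop :=
  ∀ (x : Point L) (α β γ : Fin 3), IsVtx x α β γ →
      E (x + unit L γ) * E (x - unit L γ) =
        E (x + unit L α + unit L β) * E (x - unit L α - unit L β) ∧
      E (x + unit L γ) * E (x - unit L γ) =
        E (x + unit L α - unit L β) * E (x - unit L α + unit L β)

theorem VertexCond.square {E : Point L → ℤˣ} (hE : VertexCond E) {c : Point L} {i j k : Fin 3}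
    (h : IsSq c i j k) (δ δ' : ℤˣ) :
    E c * E (c + (2 * (δ : ℤ)) • unit L j) =
      E (c + unit L i + (δ : ℤ) • unit L j + (δ' : ℤ) • unit L k) *
      E (c - unit L i + (δ : ℤ) • unit L j + (-δ' : ℤ) • unit L k) := by
  obtain ⟨h1, h2⟩ := hE _ _ _ _ (h.isVtx δ)
  have e0 : E (c + (δ : ℤ) • unit L j + unit L j) * E (c + (δ : ℤ) • unit L j - unit L j) =
      E c * E (c + (2 * (δ : ℤ)) • unit L j) := by
    rcases Int.units_eq_one_or δ with rfl | rfl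
    · rw [mul_comm]; congr 2 <;> simp only [Units.val_one] <;> module
    · congr 2 <;> simp only [Units.val_neg, Units.val_one] <;> module
  rw [e0] at h1 h2
  rcases Int.units_eq_one_or δ' with rfl | rfl
  · rw [h1]; congr 2 <;> simp only [Units.val_one] <;> module
  · rw [h2]; congr 2 <;> simp only [Units.val_neg, Units.val_one] <;> module

theorem VertexCond.curl_eq_neg {E : Point L → ℤˣ} (hE : VertexCond E) {c : Point L}
    {i j k : Fin 3} (h : IsSq c i j k) (δ δ' : ℤˣ) :
    curl E c i j k δ δ' = curl E c i j k δ (-δ') := by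
  have h1 := hE.square h δ δ'
  have h2 := hE.square h δ (-δ')
  rw [h1] at h2
  simp only [Units.val_neg, neg_neg] at h2
  simp only [curl, Units.val_neg]
  revert h2
  generalize E c = x₀
  generalize E (c + unit L i + (δ : ℤ) • unit L j + (δ' : ℤ) • unit L k) = x₁
  generalize E (c - unit L i + (δ : ℤ) • unit L j + -(δ' : ℤ) • unit L k) = x₂
  generalize E (c + unit L i + (δ : ℤ) • unit L j + -(δ' : ℤ) • unit L k) = x₃
  generalize E (c - unit L i + (δ : ℤ) • unit L j + (δ' : ℤ) • unit L k) = x₄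
  revert x₀ x₁ x₂ x₃ x₄
  decide

theorem VertexCond.curl_eq {E : Point L → ℤˣ} (hE : VertexCond E) {c : Point L}
    {i j k : Fin 3} (h : IsSq c i j k) (δ δ' : ℤˣ) :
    curl E c i j k δ δ' = curl E c i j k 1 1 := by
  have h1 : ∀ δ, curl E c i j k δ δ' = curl E c i j k δ 1 := by
    intro δ
    rcases Int.units_eq_one_or δ' with rfl | rfl
    · rfl
    · exact (hE.curl_eq_neg h δ 1).symm
  rw [h1]
  rcases Int.units_eq_one_or δ with rfl | rfl
  · rfl
  · exact (curl_symm E c i j k _ _).trans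
      ((hE.curl_eq_neg h.symm 1 1).symm.trans (curl_symm E c i k j _ _))

theorem VertexCond.curl_move {E : Point L → ℤˣ} (hE : VertexCond E) {c : Point L}
    {i j k : Fin 3} (h : IsSq c i j k) (δ : ℤˣ) :
    curl E (c + (2 * (δ : ℤ)) • unit L j) k i j 1 1 = curl E c i j k 1 1 := by
  rw [← hE.curl_eq h δ 1, ← hE.curl_eq (h.move δ) (-1) (-δ)]
  have h1 := hE.square h δ 1
  have e1 : c + (2 * (δ : ℤ)) • unit L j + unit L k + ((-1 : ℤˣ) : ℤ) • unit L i +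
      ((-δ : ℤˣ) : ℤ) • unit L j =
      c - unit L i + (δ : ℤ) • unit L j + ((1 : ℤˣ) : ℤ) • unit L k := by
    simp only [Units.val_neg, Units.val_one]; module
  have e2 : c + (2 * (δ : ℤ)) • unit L j - unit L k + ((-1 : ℤˣ) : ℤ) • unit L i +
      ((-δ : ℤˣ) : ℤ) • unit L j =
      c - unit L i + (δ : ℤ) • unit L j + (-((1 : ℤˣ) : ℤ)) • unit L k := by
    simp only [Units.val_neg, Units.val_one]; module
  simp only [curl, e1, e2]
  revert h1
  generalize E c = x₀
  generalize E (c + (2 * (δ : ℤ)) • unit L j) = y₀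
  generalize E (c + unit L i + (δ : ℤ) • unit L j + ((1 : ℤˣ) : ℤ) • unit L k) = x₁
  generalize E (c - unit L i + (δ : ℤ) • unit L j + (-((1 : ℤˣ) : ℤ)) • unit L k) = x₂
  generalize E (c - unit L i + (δ : ℤ) • unit L j + ((1 : ℤˣ) : ℤ) • unit L k) = x₄
  revert x₀ x₁ x₂ x₄ y₀
  decide

theorem VertexCond.of_curl {E : Point L → ℤˣ} {κ : ℤˣ}
    (hκ : ∀ c i j k, IsSq c i j k → ∀ δ δ', curl E c i j k δ δ' = κ) : VertexCond E := by
  intro x α β γ hx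
  wlog hne : res x β = res (x + unit L γ) γ generalizing α β
  · have h1 : res x α = res (x + unit L γ) γ := by
      rw [res_add, res_unit_self] at hne ⊢
      rcases hx.even with ⟨a, b⟩ | ⟨a, b⟩ <;> rcases hx.odd with c | c <;>
        rw [c] at hne ⊢ <;> rw [b] at hne <;> rw [a] <;> revert hne <;> decide
    have h2 := this β α hx.symm h1
    refine ⟨?_, ?_⟩
    · rw [h2.1, add_right_comm x (unit L β), sub_right_comm x (unit L β)]
    · rw [h2.2, mul_comm (E (x + unit L β - unit L α))]
      congr 2 <;> abel
  have hsq : IsSq (x + unit L γ) α γ β := by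
    refine ⟨hx.ac, hx.ab, hx.bc.symm, ?_, ?_, ?_⟩
    · rw [res_add, res_unit_ne hx.ac, add_zero]
      exact hx.even.imp And.left And.left
    · rw [← hne, res_add, res_unit_ne hx.ac, add_zero]
      rcases hx.even with ⟨a, b⟩ | ⟨a, b⟩ <;> rw [a, b] <;> decide
    · rw [res_add, res_add, res_unit_ne hx.ac, res_unit_ne hx.bc, add_zero, add_zero]
      rcases hx.even with ⟨a, b⟩ | ⟨a, b⟩ <;> rw [a, b] <;> decide
  have hmv := hsq.move (-1)
  have a1 := hκ _ _ _ _ hsq (-1) 1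
  have a2 := hκ _ _ _ _ hsq (-1) (-1)
  have a3 := hκ _ _ _ _ hmv (-1) 1
  simp only [curl, Units.val_neg, Units.val_one] at a1 a2 a3
  have b1 : x + unit L γ + unit L α + (-1 : ℤ) • unit L γ + (1 : ℤ) • unit L β =
      x + unit L α + unit L β := by module
  have b2 : x + unit L γ - unit L α + (-1 : ℤ) • unit L γ + (1 : ℤ) • unit L β =
      x - unit L α + unit L β := by module
  have b3 : x + unit L γ + unit L α + (-1 : ℤ) • unit L γ + (-1 : ℤ) • unit L β =
      x + unit L α - unit L β := by module
  have b4 : x + unit L γ - unit L α + (-1 : ℤ) • unit L γ + (-1 : ℤ) • unit L β =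
      x - unit L α - unit L β := by module
  have b5 : x + unit L γ + (2 * (-1) : ℤ) • unit L γ = x - unit L γ := by module
  have b6 : x - unit L γ + unit L β + (-1 : ℤ) • unit L α + (1 : ℤ) • unit L γ =
      x - unit L α + unit L β := by module
  have b7 : x - unit L γ - unit L β + (-1 : ℤ) • unit L α + (1 : ℤ) • unit L γ =
      x - unit L α - unit L β := by module
  rw [b1, b2] at a1
  rw [b3, b4] at a2
  rw [b5, b6, b7] at a3
  revert a1 a2 a3
  generalize E (x + unit L γ) = y₁
  generalize E (x - unit L γ) = y₂
  generalize E (x + unit L α + unit L β) = y₃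
  generalize E (x - unit L α - unit L β) = y₄
  generalize E (x + unit L α - unit L β) = y₅
  generalize E (x - unit L α + unit L β) = y₆
  clear hκ
  intro a1 a2 a3
  subst a1
  revert a2 a3
  clear b1 b2 b3 b4 b5 b6 b7 hmv hsq hne hx
  revert y₁ y₂ y₃ y₄ y₅ y₆
  decide

theorem IsSq.translate {c : Point L} {i j k : Fin 3} (h : IsSq c i j k) (l : Fin 3) (n : ℤ) :
    IsSq (c + (4 * n) • unit L l) i j k := by
  have : ∀ m, res (c + (4 * n) • unit L l) m = res c m := by
    intro m
    rw [res_add]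
    by_cases hm : m = l
    · subst hm
      rw [res_zsmul_unit_self]
      push_cast
      rw [show (4 : ZMod 4) = 0 from rfl]; simp
    · rw [res_zsmul_unit_ne hm, add_zero]
  exact ⟨h.ij, h.ik, h.jk, by rw [this]; exact h.even, by rw [this, this]; exact h.resj,
    by rw [this, this]; exact h.resk⟩

theorem VertexCond.curl_translate {E : Point L → ℤˣ} (hE : VertexCond E) {c : Point L}
    {i j k : Fin 3} (h : IsSq c i j k) (l : Fin 3) (n : ℤ) :
    curl E (c + (4 * n) • unit L l) i j k 1 1 = curl E c i j k 1 1 := by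
  have side : ∀ {c : Point L} {i j k : Fin 3}, IsSq c i j k →
      curl E (c + (4 : ℤ) • unit L j) i j k 1 1 = curl E c i j k 1 1 := by
    intro c i j k h
    have h1 := hE.curl_move h 1
    have h2 := hE.curl_move (h.move 1).symm 1
    rw [curl_symm _ _ k j i, h1] at h2
    rw [← h2, curl_symm _ _ _ j k]
    congr 1
    simp only [Units.val_one]; module
  have step : ∀ {c : Point L}, IsSq c i j k →
      curl E (c + (4 : ℤ) • unit L l) i j k 1 1 = curl E c i j k 1 1 := by
    intro c h
    rcases eq_of_three h.ij h.ik h.jk l with rfl | rfl | rfl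
    · have h1 := hE.curl_move h 1
      have h2 := side (h.move 1)
      have h3 := hE.curl_move (IsSq.symm (by simpa only [mul_one] using (h.move 1).translate l 1)) (-1)
      simp only [Units.val_one, Units.val_neg, mul_one] at h1 h2 h3
      rw [h1] at h2
      rw [curl_symm _ _ k j l, h2] at h3
      rw [← h3, curl_symm _ _ l k j]
      congr 1
      module
    · exact side h
    · rw [curl_symm, curl_symm _ c]; exact side h.symm
  induction n using Int.induction_on with
  | zero => simp
  | succ n ih =>
    rw [← ih, ← step (h.translate l n)]
    congr 1; module
  | pred n ih =>
    rw [← ih, ← step (h.translate l (-n - 1))]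
    congr 1; module

theorem exists_translate {x y : Point L} (h : ∀ i, res x i = res y i) :
    ∃ n : Fin 3 → ℤ, y = x + (4 * n 0) • unit L 0 + (4 * n 1) • unit L 1 + (4 * n 2) • unit L 2 := by
  have h1 : ∀ i, ∃ n : ℤ, y i = x i + ((4 * n : ℤ) : ZMod (4 * L)) := by
    intro i
    obtain ⟨a, ha⟩ := ZMod.intCast_surjective (x i)
    obtain ⟨b, hb⟩ := ZMod.intCast_surjective (y i)
    have hi := h i
    rw [res, res, ← ha, ← hb, map_intCast, map_intCast,
      ZMod.intCast_eq_intCast_iff_dvd_sub] at hi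
    obtain ⟨n, hn⟩ := hi
    refine ⟨n, ?_⟩
    rw [← ha, ← hb, ← Int.cast_add]
    congr 1
    push_cast at hn
    linarith
  choose n hn using h1
  refine ⟨n, ?_⟩
  funext i
  rw [hn i]
  fin_cases i <;> simp [unit]

theorem VertexCond.curl_congr {E : Point L → ℤˣ} (hE : VertexCond E) {c c' : Point L}
    {i j k : Fin 3} (h : IsSq c i j k) (hc : ∀ i, res c i = res c' i) :
    curl E c' i j k 1 1 = curl E c i j k 1 1 := by
  obtain ⟨n, rfl⟩ := exists_translate hc
  rw [hE.curl_translate ((h.translate _ _).translate _ _),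
    hE.curl_translate (h.translate _ _), hE.curl_translate h]

theorem VertexCond.exists_curl {E : Point L → ℤˣ} (hE : VertexCond E) :
    ∃ κ : ℤˣ, ∀ c i j k, IsSq c i j k → ∀ δ δ', curl E c i j k δ δ' = κ := by
  have base : IsSq ((2 : ℤ) • unit L 0) 0 1 2 := by
    refine ⟨by decide, by decide, by decide, ?_, ?_, ?_⟩
    · right; rw [res_zsmul_unit_self]; rfl
    · rw [res_zsmul_unit_self, res_zsmul_unit_ne (by decide)]; rfl
    · rw [res_zsmul_unit_self, res_zsmul_unit_ne (by decide)]; rfl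
  refine ⟨curl E ((2 : ℤ) • unit L 0) 0 1 2 1 1, ?_⟩
  set κ := curl E ((2 : ℤ) • unit L 0) 0 1 2 1 1 with hκ
  suffices h : ∀ c i j k, IsSq c i j k → curl E c i j k 1 1 = κ from
    fun c i j k hc δ δ' => (hE.curl_eq hc δ δ').trans (h c i j k hc)
  have t1 : ∀ c j k, IsSq c 0 j k → res c 0 = 2 → curl E c 0 j k 1 1 = κ := by
    intro c j k hc hr
    wlog hj : j = 1 generalizing j k
    · rw [curl_symm]
      refine this k j hc.symm ?_
      have h1 := hc.ij; have h2 := hc.ik; have h3 := hc.jk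
      clear hc; revert j k; decide
    have hk : k = 2 := by
      have h2 := hc.ik; have h3 := hc.jk
      clear hc; subst hj; revert k; decide
    subst hj hk
    refine hE.curl_congr base fun i => ?_
    rcases eq_of_three hc.ij hc.ik hc.jk i with rfl | rfl | rfl
    · rw [hr, res_zsmul_unit_self]; rfl
    · rw [hc.resj, hr, res_zsmul_unit_ne (by decide)]; rfl
    · rw [hc.resk, hr, res_zsmul_unit_ne (by decide)]; rfl
  have resmove : ∀ {c : Point L} {i j k : Fin 3}, IsSq c i j k →
      res (c + (2 * ((1 : ℤˣ) : ℤ)) • unit L j) k = res c i + 2 := by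
    intro c i j k hc
    rw [res_add, res_zsmul_unit_ne hc.jk.symm, hc.resk, add_zero]
  have t2 : ∀ c i j k, IsSq c i j k → i ≠ 0 → res c i = 0 → curl E c i j k 1 1 = κ := by
    intro c i j k hc hi hr
    wlog hk : k = 0 generalizing j k
    · rw [curl_symm]
      refine this k j hc.symm ?_
      have h1 := hc.ij; have h2 := hc.ik; have h3 := hc.jk
      clear hc hr this; revert i j k; decide
    subst hk
    rw [← hE.curl_move hc 1]
    exact t1 _ _ _ (hc.move 1) (by rw [resmove hc, hr]; rfl)
  have t3 : ∀ c i j k, IsSq c i j k → i ≠ 0 → res c i = 2 → curl E c i j k 1 1 = κ := by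
    intro c i j k hc hi hr
    wlog hk : k ≠ 0 generalizing j k
    · rw [curl_symm]
      refine this k j hc.symm ?_
      have h3 := hc.jk
      push Not at hk
      rw [← hk]; exact h3
    rw [← hE.curl_move hc 1]
    exact t2 _ _ _ _ (hc.move 1) hk (by rw [resmove hc, hr]; rfl)
  intro c i j k hc
  rcases hc.even with hr | hr
  · by_cases hi : i = 0
    · subst hi
      rw [← hE.curl_move hc 1]
      exact t3 _ _ _ _ (hc.move 1) hc.ik.symm (by rw [resmove hc, hr]; rfl)
    · exact t2 c i j k hc hi hr
  · by_cases hi : i = 0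
    · subst hi; exact t1 c j k hc hr
    · exact t3 c i j k hc hi hr

theorem mem_plaquetteKernel_iff_curl {a : Plaquette L → ℤˣ} : a ∈ plaquetteKernel L ↔
    ∃ κ : ℤˣ, ∀ c i j k, IsSq c i j k → ∀ δ δ', curl (extend a) c i j k δ δ' = κ := by
  rw [mem_plaquetteKernel]
  exact ⟨fun h => VertexCond.exists_curl h, fun ⟨_, h⟩ => VertexCond.of_curl h⟩

end Curl

section Potential

theorem add_single_invariant {M : Type*} {G : (Fin 3 → ℤ) → M}
    (h : ∀ i n, G (n + Pi.single i 1) = G n) (i : Fin 3) (m : ℤ) (n : Fin 3 → ℤ) :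
    G (n + Pi.single i m) = G n := by
  induction m using Int.induction_on with
  | zero => simp
  | succ m ih => rw [Pi.single_add, ← add_assoc, h, ih]
  | pred m ih =>
    have := h i (n + Pi.single i (-(m : ℤ) - 1))
    rw [add_assoc, ← Pi.single_add, sub_add_cancel] at this
    rw [← this, ih]

theorem sum_single_three (n : Fin 3 → ℤ) :
    n = Pi.single 0 (n 0) + Pi.single 1 (n 1) + Pi.single 2 (n 2) := by
  funext i; fin_cases i <;> simp

theorem eq_of_add_single_invariant {M : Type*} {G : (Fin 3 → ℤ) → M}
    (h : ∀ i n, G (n + Pi.single i 1) = G n) (n : Fin 3 → ℤ) : G n = G 0 := by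
  rw [sum_single_three n, add_single_invariant h, add_single_invariant h]
  simpa using add_single_invariant h 0 (n 0) 0

/-- A flat connection on `ℤ³` is trivial. -/
theorem exists_potential (u : Fin 3 → (Fin 3 → ℤ) → ℤˣ)
    (hu : ∀ i j n, u i n * u j (n + Pi.single i 1) = u j n * u i (n + Pi.single j 1)) :
    ∃ F : (Fin 3 → ℤ) → ℤˣ, ∀ i n, F (n + Pi.single i 1) = F n * u i n := by
  let T : Fin 3 → Equiv.Perm ((Fin 3 → ℤ) × ℤˣ) := fun i =>
    { toFun := fun x => (x.1 + Pi.single i 1, x.2 * u i x.1)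
      invFun := fun x => (x.1 - Pi.single i 1, x.2 * u i (x.1 - Pi.single i 1))
      left_inv := fun x => by ext1 <;> simp [mul_assoc]
      right_inv := fun x => by ext1 <;> simp [mul_assoc] }
  have hT : ∀ i x, T i x = (x.1 + Pi.single i 1, x.2 * u i x.1) := fun i x => rfl
  have hcomm : ∀ i j, Commute (T i) (T j) := by
    intro i j
    ext1 x
    simp only [Equiv.Perm.mul_apply, hT]
    ext1
    · simp only [add_right_comm]
    · simp only [mul_assoc, hu i j]
  have hfst : ∀ i (m : ℤ) x, ((T i ^ m) x).1 = x.1 + Pi.single i m := by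
    intro i m
    induction m using Int.induction_on with
    | zero => simp
    | succ m ih =>
      intro x
      rw [zpow_add_one, Equiv.Perm.mul_apply, ih, hT, add_assoc, ← Pi.single_add, add_comm (1 : ℤ)]
    | pred m ih =>
      intro x
      have h1 := ih ((T i)⁻¹ x)
      have h2 : (T i ((T i)⁻¹ x)).1 = x.1 := by simp
      rw [hT] at h2
      simp only at h2
      rw [zpow_sub_one, Equiv.Perm.mul_apply, h1, ← h2, add_assoc, ← Pi.single_add]
      congr 2; ring
  let X : (Fin 3 → ℤ) → (Fin 3 → ℤ) × ℤˣ := fun n => (T 0 ^ n 0 * T 1 ^ n 1 * T 2 ^ n 2) (0, 1)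
  have hX1 : ∀ n, (X n).1 = n := by
    intro n
    simp only [X, Equiv.Perm.mul_apply, hfst, zero_add]
    conv_rhs => rw [sum_single_three n]
    abel
  have hX : ∀ i n, X (n + Pi.single i 1) = T i (X n) := by
    intro i n
    simp only [X, ← Equiv.Perm.mul_apply]
    congr 1
    have c1 := fun i j m => ((hcomm i j).zpow_right m).eq
    fin_cases i
    · simp [zpow_add, ← mul_assoc, c1]
    · simp only [Fin.mk_one, Pi.add_apply, Pi.single_eq_same,
        Pi.single_eq_of_ne (show (0 : Fin 3) ≠ 1 by decide),
        Pi.single_eq_of_ne (show (2 : Fin 3) ≠ 1 by decide), add_zero]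
      rw [← mul_assoc, ← mul_assoc, c1, mul_assoc _ (T 1), ← zpow_one_add, add_comm]
    · simp only [Fin.reduceFinMk, Pi.add_apply, Pi.single_eq_same,
        Pi.single_eq_of_ne (show (0 : Fin 3) ≠ 2 by decide),
        Pi.single_eq_of_ne (show (1 : Fin 3) ≠ 2 by decide), add_zero]
      rw [← mul_assoc, ← mul_assoc, c1, mul_assoc _ (T 2), c1, ← mul_assoc, mul_assoc _ (T 2),
        ← zpow_one_add, add_comm]
  refine ⟨fun n => (X n).2, fun i n => ?_⟩
  change (X (n + Pi.single i 1)).2 = (X n).2 * u i n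
  rw [hX, hT, hX1]

/-- The integer points above the cells. -/
def IsCellZ (x : Fin 3 → ℤ) : Prop :=
  (∀ i, (x i : ZMod 4) = 0) ∨ ∀ i, (x i : ZMod 4) = 2

/-- The body-centred cubic lattice, in the basis of the vectors `(-2, 2, 2)`, `(2, -2, 2)`,
`(2, 2, -2)`. -/
def bcc (n : Fin 3 → ℤ) : Fin 3 → ℤ := fun i => 2 * (∑ l, n l) - 4 * n i

theorem isCellZ_bcc (n : Fin 3 → ℤ) : IsCellZ (bcc n) := by
  have h4 : (4 : ZMod 4) = 0 := rfl
  have key : ∀ r : ZMod 4, 2 * r = 0 ∨ 2 * r = 2 := by decide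
  rcases key ((∑ l, n l : ℤ) : ZMod 4) with h | h
  · left; intro i
    simp only [bcc, Int.cast_sub, Int.cast_mul, Int.cast_ofNat, h, h4]; simp
  · right; intro i
    simp only [bcc, Int.cast_sub, Int.cast_mul, Int.cast_ofNat, h, h4]; simp

theorem IsCellZ.exists_bcc {x : Fin 3 → ℤ} (h : IsCellZ x) : ∃ n, x = bcc n := by
  have key : (∀ i, x i % 4 = 0) ∨ ∀ i, x i % 4 = 2 := by
    refine h.imp (fun h i => ?_) (fun h i => ?_)
    · have := (ZMod.intCast_eq_intCast_iff_dvd_sub (x i) 0 4).1 (by simpa using h i)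
      push_cast at this; omega
    · have := (ZMod.intCast_eq_intCast_iff_dvd_sub (x i) 2 4).1 (by simpa using h i)
      push_cast at this; omega
  refine ⟨fun i => (∑ l, x l - x i) / 4, ?_⟩
  have h0 : ∀ i, x i % 4 = x 0 % 4 := fun i => by
    rcases key with k | k <;> rw [k, k]
  have h1 := h0 1
  have h2 := h0 2
  have h3 : x 0 % 4 = 0 ∨ x 0 % 4 = 2 := key.imp (fun k => k 0) fun k => k 0
  funext i
  simp only [bcc, Fin.sum_univ_three]
  fin_cases i <;> simp <;> omega

theorem bcc_injective : Function.Injective bcc := by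
  intro n m h
  have hi : ∀ i, bcc n i = bcc m i := fun i => congrFun h i
  have h0 := hi 0
  have h1 := hi 1
  have h2 := hi 2
  simp only [bcc, Fin.sum_univ_three] at h0 h1 h2
  funext i
  fin_cases i <;> simp <;> omega

theorem bcc_add (n m : Fin 3 → ℤ) : bcc (n + m) = bcc n + bcc m := by
  funext i; simp [bcc, Finset.sum_add_distrib]; ring

/-- Half of the basis vectors of the body-centred cubic lattice. -/
def halfBasis (i : Fin 3) : Fin 3 → ℤ := fun l => 1 - (Pi.single i 2 : Fin 3 → ℤ) l

theorem bcc_single (i : Fin 3) : bcc (Pi.single i 1) = (2 : ℤ) • halfBasis i := by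
  funext l
  by_cases h : l = i
  · subst h; simp [bcc, halfBasis]
  · simp [bcc, halfBasis, Pi.single_eq_of_ne h]

variable {L : ℕ} [NeZero L]

/-- Reduction of integer points modulo `4L`. -/
def toPoint (L : ℕ) (x : Fin 3 → ℤ) : Point L := fun i => (x i : ZMod (4 * L))

omit [NeZero L] in
theorem toPoint_add (x y : Fin 3 → ℤ) : toPoint L (x + y) = toPoint L x + toPoint L y := by
  funext i; simp [toPoint]

omit [NeZero L] in
theorem toPoint_sub (x y : Fin 3 → ℤ) : toPoint L (x - y) = toPoint L x - toPoint L y := by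
  funext i; simp [toPoint]

omit [NeZero L] in
theorem toPoint_single (i : Fin 3) (n : ℤ) : toPoint L (Pi.single i n) = n • unit L i := by
  funext l
  by_cases h : l = i
  · subst h; simp [toPoint, unit]
  · simp [toPoint, unit, Pi.single_eq_of_ne h]

omit [NeZero L] in
theorem res_toPoint (x : Fin 3 → ℤ) (i : Fin 3) : res (toPoint L x) i = (x i : ZMod 4) := by
  simp [res, toPoint]

omit [NeZero L] in
theorem toPoint_surjective (y : Point L) : ∃ x, toPoint L x = y := by
  choose x hx using fun i => ZMod.intCast_surjective (y i)
  exact ⟨x, funext hx⟩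

omit [NeZero L] in
theorem toPoint_add_period (x : Fin 3 → ℤ) (k : Fin 3) (n : ℤ) :
    toPoint L (x + Pi.single k (4 * L * n)) = toPoint L x := by
  rw [toPoint_add, toPoint_single]
  have : ((4 * L * n : ℤ)) • unit L k = 0 := by
    funext l
    have h0 : ((4 * L : ℕ) : ZMod (4 * L)) = 0 := ZMod.natCast_self _
    push_cast at h0
    simp [h0]
  rw [this, add_zero]

/-- `Ψ` is a potential for `a`. -/
def IsPotential (Ψ : (Fin 3 → ℤ) → ℤˣ) (a : Plaquette L → ℤˣ) : Prop :=
  ∀ p x, toPoint L x = center p → a p = Ψ (x - normal p) * Ψ (x + normal p)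

omit [NeZero L] in
theorem isCellZ_add_normal {p : Plaquette L} {x : Fin 3 → ℤ} (h : toPoint L x = center p) :
    IsCellZ (x + normal p) := by
  refine (end_isCell p 1 (Or.inl rfl)).imp (fun h' i => ?_) (fun h' i => ?_) <;>
  · rw [← h' i, ← h]
    simp [res, toPoint]

omit [NeZero L] in
theorem isCellZ_sub_normal {p : Plaquette L} {x : Fin 3 → ℤ} (h : toPoint L x = center p) :
    IsCellZ (x - normal p) := by
  refine (end_isCell p (-1) (Or.inr rfl)).imp (fun h' i => ?_) (fun h' i => ?_) <;>
  · rw [← h' i, ← h]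
    simp [res, toPoint, sub_eq_add_neg]

omit [NeZero L] in
theorem isSq_bcc (n : Fin 3 → ℤ) {i j k : Fin 3} (hij : i ≠ j) (hik : i ≠ k) (hjk : j ≠ k) :
    IsSq (toPoint L (bcc n + Pi.single k 2)) k i j := by
  refine ⟨hik.symm, hjk.symm, hij, ?_, ?_, ?_⟩ <;> simp only [res_toPoint] <;>
  rcases isCellZ_bcc n with h | h <;>
  simp only [Pi.add_apply, Pi.single_eq_same, Pi.single_eq_of_ne hik, Pi.single_eq_of_ne hjk,
    Int.cast_add, h] <;> decide

theorem sign_cases (N : Fin 3 → ℤ) (hN : ∀ i, N i = 1 ∨ N i = -1) :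
    N = 1 ∨ N = -1 ∨ (∃ i, N = halfBasis i) ∨ ∃ i, N = -halfBasis i := by
  have key : ∀ M : Fin 3 → ℤ, N 0 = M 0 → N 1 = M 1 → N 2 = M 2 → N = M := by
    intro M h0 h1 h2; funext i; fin_cases i <;> assumption
  rcases hN 0 with h0 | h0 <;> rcases hN 1 with h1 | h1 <;> rcases hN 2 with h2 | h2
  · exact Or.inl (key _ h0 h1 h2)
  · exact Or.inr (Or.inr (Or.inl ⟨2, key _ (by rw [h0]; rfl) (by rw [h1]; rfl) (by rw [h2]; rfl)⟩))
  · exact Or.inr (Or.inr (Or.inl ⟨1, key _ (by rw [h0]; rfl) (by rw [h1]; rfl) (by rw [h2]; rfl)⟩))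
  · exact Or.inr (Or.inr (Or.inr ⟨0, key _ (by rw [h0]; rfl) (by rw [h1]; rfl) (by rw [h2]; rfl)⟩))
  · exact Or.inr (Or.inr (Or.inl ⟨0, key _ (by rw [h0]; rfl) (by rw [h1]; rfl) (by rw [h2]; rfl)⟩))
  · exact Or.inr (Or.inr (Or.inr ⟨1, key _ (by rw [h0]; rfl) (by rw [h1]; rfl) (by rw [h2]; rfl)⟩))
  · exact Or.inr (Or.inr (Or.inr ⟨2, key _ (by rw [h0]; rfl) (by rw [h1]; rfl) (by rw [h2]; rfl)⟩))
  · exact Or.inr (Or.inl (key _ h0 h1 h2))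

theorem units_mul_cancel (x y : ℤˣ) : x * (x * y) = y := by
  rw [← mul_assoc, Int.units_mul_self, one_mul]

/-- A sign on the plaquettes whose product at each edge is `1` has a quasiperiodic potential. -/
theorem exists_isPotential {a : Plaquette L → ℤˣ}
    (ha : ∀ c i j k, IsSq c i j k → ∀ δ δ', curl (extend a) c i j k δ δ' = 1) :
    ∃ (Ψ : (Fin 3 → ℤ) → ℤˣ) (s : Fin 3 → ℤˣ),
      (∀ x, IsCellZ x → ∀ k, Ψ (x + Pi.single k (4 * L : ℤ)) = s k * Ψ x) ∧ IsPotential Ψ a := by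
  set E : (Fin 3 → ℤ) → ℤˣ := fun x => extend a (toPoint L x) with hE
  let u : Fin 3 → (Fin 3 → ℤ) → ℤˣ := fun i n => E (bcc n + halfBasis i)
  have hcurl : ∀ n i j k, i ≠ j → i ≠ k → j ≠ k → ∀ δ δ' : ℤˣ,
      E (bcc n + Pi.single k 2) *
        E (bcc n + Pi.single k 2 + Pi.single k 1 + Pi.single i (δ : ℤ) + Pi.single j (δ' : ℤ)) *
        E (bcc n + Pi.single k 2 - Pi.single k 1 + Pi.single i (δ : ℤ) + Pi.single j (δ' : ℤ))
        = 1 := by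
    intro n i j k hij hik hjk δ δ'
    have := ha _ _ _ _ (isSq_bcc (L := L) n hij hik hjk) δ δ'
    rw [curl] at this
    simp only [hE]
    rw [toPoint_add _ (Pi.single j (δ' : ℤ)), toPoint_add _ (Pi.single i (δ : ℤ)),
      toPoint_add _ (Pi.single k (1 : ℤ)), toPoint_add _ (Pi.single j (δ' : ℤ)),
      toPoint_add _ (Pi.single i (δ : ℤ)), toPoint_sub _ (Pi.single k (1 : ℤ)),
      toPoint_single, toPoint_single, toPoint_single, one_smul]
    exact this
  have hsq : ∀ n i j k, i ≠ j → i ≠ k → j ≠ k →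
      E (bcc n + Pi.single k 2) = u i n * u j (n + Pi.single i 1) := by
    intro n i j k hij hik hjk
    have h := hcurl n i j k hij hik hjk (-1) 1
    have e1 : bcc n + Pi.single k 2 + Pi.single k 1 + Pi.single i (((-1 : ℤˣ) : ℤ)) +
        Pi.single j (((1 : ℤˣ) : ℤ)) = bcc (n + Pi.single i 1) + halfBasis j := by
      rw [bcc_add, bcc_single]
      refine ext_three hij hik hjk ?_ ?_ ?_ <;>
      (simp [halfBasis, Pi.single_eq_of_ne, hij, hik, hjk, hij.symm, hik.symm, hjk.symm]; try ring)
    have e2 : bcc n + Pi.single k 2 - Pi.single k 1 + Pi.single i (((-1 : ℤˣ) : ℤ)) +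
        Pi.single j (((1 : ℤˣ) : ℤ)) = bcc n + halfBasis i := by
      refine ext_three hij hik hjk ?_ ?_ ?_ <;>
      (simp [halfBasis, Pi.single_eq_of_ne, hij, hik, hjk, hij.symm, hik.symm, hjk.symm]; try ring)
    rw [e1, e2] at h
    revert h
    simp only [u]
    generalize E (bcc n + Pi.single k 2) = x
    generalize E (bcc (n + Pi.single i 1) + halfBasis j) = y
    generalize E (bcc n + halfBasis i) = z
    revert x y z; decide
  obtain ⟨F, hF⟩ := exists_potential u (by
    intro i j n
    by_cases hij : i = j
    · subst hij; rfl
    · obtain ⟨k, hik, hjk⟩ : ∃ k : Fin 3, i ≠ k ∧ j ≠ k := by revert i j; decide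
      rw [← hsq n i j k hij hik hjk, ← hsq n j i k (Ne.symm hij) hjk hik])
  have hu : ∀ i n, u i n = F n * F (n + Pi.single i 1) := fun i n => by
    rw [hF, units_mul_cancel]
  have hsqF : ∀ n i j k, i ≠ j → i ≠ k → j ≠ k →
      E (bcc n + Pi.single k 2) = F n * F (n + Pi.single i 1 + Pi.single j 1) := by
    intro n i j k hij hik hjk
    rw [hsq n i j k hij hik hjk, hu, hu, mul_assoc, units_mul_cancel]
  have honeF : ∀ n, E (bcc n + 1) = F n * F (n + 1) := by
    intro n
    have h := hcurl n 0 1 2 (by decide) (by decide) (by decide) 1 1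
    have e1 : bcc n + Pi.single 2 2 + Pi.single 2 1 + Pi.single 0 (((1 : ℤˣ) : ℤ)) +
        Pi.single 1 (((1 : ℤˣ) : ℤ)) =
        bcc (n + Pi.single 0 1 + Pi.single 1 1) + halfBasis 2 := by
      rw [bcc_add, bcc_add, bcc_single, bcc_single]
      funext l; fin_cases l <;> simp [halfBasis]; try ring
    have e2 : bcc n + Pi.single 2 2 - Pi.single 2 1 + Pi.single 0 (((1 : ℤˣ) : ℤ)) +
        Pi.single 1 (((1 : ℤˣ) : ℤ)) = bcc n + 1 := by
      funext l; fin_cases l <;> simp; try ring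
    have e3 : n + 1 = n + Pi.single 0 1 + Pi.single 1 1 + Pi.single 2 1 := by
      funext l; fin_cases l <;> simp
    rw [e1, e2, hsqF n 0 1 2 (by decide) (by decide) (by decide)] at h
    have h2 : E (bcc (n + Pi.single 0 1 + Pi.single 1 1) + halfBasis 2) = _ :=
      hu 2 (n + Pi.single 0 1 + Pi.single 1 1)
    rw [h2, ← e3] at h
    revert h
    generalize E (bcc n + 1) = x
    generalize F (n + Pi.single 0 1 + Pi.single 1 1) = y
    generalize F n = z
    generalize F (n + 1) = w
    revert x y z w; decide
  let Ψ : (Fin 3 → ℤ) → ℤˣ := fun x => F (fun i => (∑ l, x l - x i) / 4)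
  have hΨ : ∀ n, Ψ (bcc n) = F n := by
    intro n
    simp only [Ψ]
    congr 1
    funext i
    simp only [bcc, Fin.sum_univ_three]
    fin_cases i <;> simp <;> omega
  let w : Fin 3 → Fin 3 → ℤ := fun k l => if l = k then 0 else L
  have hw : ∀ k, bcc (w k) = Pi.single k (4 * L : ℤ) := by
    intro k
    funext l
    have hs : ∑ l, w k l = 2 * L := by
      simp only [Fin.sum_univ_three, w]; fin_cases k <;> simp <;> ring
    rw [bcc, hs]
    by_cases h : l = k
    · subst h; simp [w]; ring
    · simp [w, h]; ring
  have hper : ∀ k n, F (n + w k) = F (w k) * F 0 * F n := by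
    intro k n
    have h1 := eq_of_add_single_invariant (G := fun n => F n * F (n + w k)) (by
      intro i n
      have h2 : u i (n + w k) = u i n := by
        simp only [u, hE]
        rw [bcc_add, hw, add_right_comm]
        have := toPoint_add_period (L := L) (bcc n + halfBasis i) k 1
        rw [mul_one] at this
        rw [this]
      rw [add_right_comm, hF, hF, h2]
      generalize F n = x
      generalize F (n + w k) = y
      generalize u i n = z
      revert x y z; decide) n
    simp only [zero_add] at h1
    revert h1
    generalize F n = x
    generalize F (n + w k) = y
    generalize F 0 = z
    generalize F (w k) = t
    revert x y z t; decide
  refine ⟨Ψ, fun k => F (w k) * F 0, ?_, ?_⟩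
  · intro x hx k
    obtain ⟨n, rfl⟩ := hx.exists_bcc
    rw [← hw, ← bcc_add, hΨ, hΨ, hper]
  · have hpos1 : ∀ x, IsCellZ x → E (x + 1) = Ψ x * Ψ (x + 1 + 1) := by
      intro x hx
      obtain ⟨n, rfl⟩ := hx.exists_bcc
      have : bcc n + 1 + 1 = bcc (n + 1) := by
        rw [bcc_add]; funext l; simp [bcc]; ring
      rw [this, hΨ, hΨ, honeF]
    have hposd : ∀ i x, IsCellZ x → E (x + halfBasis i) =
        Ψ x * Ψ (x + halfBasis i + halfBasis i) := by
      intro i x hx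
      obtain ⟨n, rfl⟩ := hx.exists_bcc
      have : bcc n + halfBasis i + halfBasis i = bcc (n + Pi.single i 1) := by
        rw [bcc_add, bcc_single]; module
      rw [this, hΨ, hΨ]
      exact hu i n
    intro p x hx
    have hp : a p = E x := by rw [hE]; simp only; rw [hx, extend_center]
    have c1 := isCellZ_sub_normal hx
    have c2 := isCellZ_add_normal hx
    rw [hp]
    rcases p with q | h
    · have hN : (normal (Sum.inl q : Plaquette L)) = Pi.single q.1.1 2 := rfl
      rw [hN] at c1 c2 ⊢
      obtain ⟨n, hn⟩ := c1.exists_bcc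
      obtain ⟨i, j, hij, hik, hjk⟩ : ∃ i j : Fin 3, i ≠ j ∧ i ≠ q.1.1 ∧ j ≠ q.1.1 := by
        generalize q.1.1 = k; revert k; decide
      have e1 : x = bcc n + Pi.single q.1.1 2 := by rw [← hn]; abel
      have e2 : x + Pi.single q.1.1 2 = bcc (n + Pi.single i 1 + Pi.single j 1) := by
        rw [e1, bcc_add, bcc_add, bcc_single, bcc_single]
        refine ext_three hij hik hjk ?_ ?_ ?_ <;>
        (simp [halfBasis, Pi.single_eq_of_ne, hij, hik, hjk, hij.symm, hik.symm, hjk.symm]; try ring)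
      rw [e2, hn, hΨ, hΨ, e1, hsqF n i j _ hij hik hjk]
    · have hN : ∀ i, normal (Sum.inr h : Plaquette L) i = 1 ∨
          normal (Sum.inr h : Plaquette L) i = -1 := fun i =>
        (normal_hexagon h i).imp And.left And.left
      have fin1 : ∀ N : Fin 3 → ℤ, E (x - N + N) = Ψ (x - N) * Ψ (x - N + N + N) →
          E x = Ψ (x - N) * Ψ (x + N) := by
        intro N hh
        rwa [sub_add_cancel] at hh
      rcases sign_cases _ hN with e | e | ⟨i, e⟩ | ⟨i, e⟩ <;> rw [e] at c1 c2 ⊢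
      · exact fin1 _ (hpos1 _ c1)
      · rw [← sub_eq_add_neg] at c2
        rw [mul_comm, sub_neg_eq_add, ← sub_eq_add_neg]
        exact fin1 _ (hpos1 _ c2)
      · exact fin1 _ (hposd i _ c1)
      · rw [← sub_eq_add_neg] at c2
        rw [mul_comm, sub_neg_eq_add, ← sub_eq_add_neg]
        exact fin1 _ (hposd i _ c2)

end Potential

section Twisted

set_option linter.unusedSectionVars false

variable {L : ℕ} [NeZero L]

theorem bondSign_mul (s t : Fin 3 → ℤˣ) (p : Plaquette L) :
    bondSign (s * t) p = bondSign s p * bondSign t p := by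
  simp only [bondSign, ← Finset.prod_mul_distrib]
  exact Finset.prod_congr rfl fun i _ => by split_ifs <;> simp

/-- `η` on the squares and `1` on the hexagons. -/
def squareSign (η : ℤˣ) : Plaquette L → ℤˣ
  | Sum.inl _ => η
  | Sum.inr _ => 1

/-- The signs of the bonds for Ising spins, boundary conditions, and a sign on the squares. -/
noncomputable def twist (L : ℕ) [NeZero L] : (Cell L → ℤˣ) × (Fin 3 → ℤˣ) × ℤˣ →* (Plaquette L → ℤˣ) where
  toFun g p := squareSign g.2.2 p * (bondSign g.2.1 p * g.1 (cellAbove p) * g.1 (cellBelow p))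
  map_one' := by
    funext p
    rcases p with q | h <;> simp [squareSign, bondSign]
  map_mul' g h := by
    funext p
    simp only [Pi.mul_apply, Prod.fst_mul, Prod.snd_mul]
    rw [bondSign_mul]
    rcases p with q | h <;> simp only [squareSign, one_mul] <;> ac_rfl

theorem twist_apply (g : (Cell L → ℤˣ) × (Fin 3 → ℤˣ) × ℤˣ) (p : Plaquette L) :
    twist L g p =
      squareSign g.2.2 p * (bondSign g.2.1 p * g.1 (cellAbove p) * g.1 (cellBelow p)) := rfl

theorem squareSign_one (p : Plaquette L) : squareSign 1 p = 1 := by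
  rcases p with q | h <;> rfl

open Classical in
/-- The lift of spins on the torus to a quasiperiodic function. -/
noncomputable def liftSpin (σ : Cell L → ℤˣ) (s : Fin 3 → ℤˣ) (x : Fin 3 → ℤ) : ℤˣ :=
  (if h : (∀ i, res (toPoint L x) i = 0) ∨ (∀ i, res (toPoint L x) i = 2)
    then σ ⟨toPoint L x, h⟩ else 1) * ∏ i, s i ^ (x i / (4 * L : ℤ))

theorem ediv_eq_of_le_of_lt {a M k : ℤ} (hM : 0 < M) (h0 : k * M ≤ a) (h1 : a < (k + 1) * M) :
    a / M = k :=
  le_antisymm (Int.le_of_lt_add_one (Int.ediv_lt_of_lt_mul hM h1)) (Int.le_ediv_of_mul_le hM h0)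

theorem cast_pos_four_mul : (0 : ℤ) < 4 * L := by
  have := NeZero.pos L
  positivity

theorem toPoint_val (y : Point L) : toPoint L (fun i => ((y i).val : ℤ)) = y := by
  funext i
  simp [toPoint]

theorem normal_abs_le (p : Plaquette L) (i : Fin 3) : |normal p i| ≤ 2 := by
  rcases p with q | h
  · by_cases hi : i = q.1.1
    · simp only [normal]; rw [hi, Pi.single_eq_same]; decide
    · simp only [normal]; rw [Pi.single_eq_of_ne hi]; decide
  · rcases normal_hexagon h i with ⟨a, -⟩ | ⟨a, -⟩ <;> rw [a] <;> decide

open Classical in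
theorem wraps_sign {p : Plaquette L} {x : Fin 3 → ℤ} (hx : toPoint L x = center p) (i : Fin 3)
    (u : ℤˣ) : u ^ ((x - normal p) i / (4 * L : ℤ)) * u ^ ((x + normal p) i / (4 * L : ℤ)) =
      if Wraps p i then u else 1 := by
  have hM : (0 : ℤ) < 4 * L := cast_pos_four_mul
  have hL : (1 : ℤ) ≤ L := by exact_mod_cast NeZero.pos L
  have hv : ((center p i).val : ℤ) = x i % (4 * L : ℤ) := by
    rw [← hx]
    have := ZMod.val_intCast (n := 4 * L) (x i)
    rw [toPoint, this]; push_cast; rfl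
  set v : ℤ := x i % (4 * L : ℤ) with hvdef
  have hv0 : 0 ≤ v := Int.emod_nonneg _ hM.ne'
  have hv1 : v < 4 * L := Int.emod_lt_of_pos _ hM
  have hxv : x i = v + (x i / (4 * L : ℤ)) * (4 * L : ℤ) := by
    have := Int.emod_add_mul_ediv (x i) (4 * L : ℤ)
    rw [hvdef]; linarith
  set m := x i / (4 * L : ℤ) with hm
  have hN := normal_abs_le p i
  set N := normal p i with hNdef
  have e1 : (x - normal p) i / (4 * L : ℤ) = (v - N) / (4 * L : ℤ) + m := by
    rw [Pi.sub_apply, ← hNdef, hxv, ← Int.add_mul_ediv_right _ _ hM.ne']; congr 1; ring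
  have e2 : (x + normal p) i / (4 * L : ℤ) = (v + N) / (4 * L : ℤ) + m := by
    rw [Pi.add_apply, ← hNdef, hxv, ← Int.add_mul_ediv_right _ _ hM.ne']; congr 1; ring
  have hw : Wraps p i ↔ (v < |N| ∨ 4 * L ≤ v + |N|) := by
    rw [Wraps, ← hNdef, ← hv]
    have : ((N.natAbs : ℕ) : ℤ) = |N| := Int.natCast_natAbs N
    rw [← this]
    norm_cast
  rw [e1, e2, zpow_add, zpow_add, mul_mul_mul_comm, Int.units_mul_self, mul_one]
  have hr : ∀ n : ℤ, -2 ≤ n → n ≤ 2 → (v + n) / (4 * L : ℤ) =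
      if v + n < 0 then -1 else if 4 * L ≤ v + n then 1 else 0 := by
    intro n h1 h2
    split_ifs with h3 h4
    · exact ediv_eq_of_le_of_lt hM (by linarith) (by linarith)
    · exact ediv_eq_of_le_of_lt hM (by linarith) (by linarith)
    · exact ediv_eq_of_le_of_lt hM (by linarith) (by linarith)
  rw [abs_le] at hN
  rw [sub_eq_add_neg, hr N hN.1 hN.2, hr (-N) (by linarith) (by linarith), if_congr hw rfl rfl]
  rcases abs_cases N with ⟨a, b⟩ | ⟨a, b⟩ <;> rw [a] <;> split_ifs <;>
    first | (exfalso; omega) | simp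

theorem isPotential_liftSpin (σ : Cell L → ℤˣ) (s : Fin 3 → ℤˣ) :
    IsPotential (liftSpin σ s) (twist L (σ, s, 1)) := by
  classical
  intro p x hx
  have h1 : (fun i => center p i + ((1 * normal p i : ℤ) : ZMod (4 * L))) =
      toPoint L (x + normal p) := by
    funext i; rw [← hx]; simp [toPoint]
  have h2 : (fun i => center p i + ((-1 * normal p i : ℤ) : ZMod (4 * L))) =
      toPoint L (x - normal p) := by
    funext i; rw [← hx]; simp [toPoint, sub_eq_add_neg]
  have c1 := end_isCell p 1 (Or.inl rfl)
  have c2 := end_isCell p (-1) (Or.inr rfl)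
  simp only [h1] at c1
  simp only [h2] at c2
  have e1 : cellAbove p = ⟨toPoint L (x + normal p), c1⟩ := Subtype.ext h1
  have e2 : cellBelow p = ⟨toPoint L (x - normal p), c2⟩ := Subtype.ext h2
  rw [twist_apply, squareSign_one, one_mul, liftSpin, liftSpin, dif_pos c1, dif_pos c2, e1, e2,
    bondSign, mul_mul_mul_comm, ← Finset.prod_mul_distrib]
  simp only [wraps_sign hx]
  have key : ∀ u v w : ℤˣ, u * v * w = w * v * u := by decide
  exact key _ _ _

theorem hexagon_of_isCellZ {y ε : Fin 3 → ℤ} (hy : IsCellZ y) (hε : ∀ i, ε i = 1 ∨ ε i = -1) :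
    ∃ h : Hexagon L, center (Sum.inr h) = toPoint L (y + ε) ∧
      (normal (Sum.inr h) = ε ∨ normal (Sum.inr h) = -ε) := by
  have hodd : ∀ i, res (toPoint L (y + ε)) i = 1 ∨ res (toPoint L (y + ε)) i = 3 := by
    intro i
    rw [res_toPoint, Pi.add_apply, Int.cast_add]
    rcases hy with h | h <;> rw [h i] <;> rcases hε i with e | e <;> rw [e] <;> decide
  refine ⟨⟨_, hodd⟩, rfl, ?_⟩
  rcases hy with h | h
  · left
    funext i
    rcases normal_hexagon (⟨_, hodd⟩ : Hexagon L) i with ⟨a, b⟩ | ⟨a, b⟩ <;> rw [a] <;>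
    rw [res_toPoint, Pi.add_apply, Int.cast_add, h i] at b <;>
    rcases hε i with e | e <;> rw [e] at b ⊢ <;> revert b <;> decide
  · right
    funext i
    rcases normal_hexagon (⟨_, hodd⟩ : Hexagon L) i with ⟨a, b⟩ | ⟨a, b⟩ <;> rw [a] <;>
    rw [res_toPoint, Pi.add_apply, Int.cast_add, h i] at b <;>
    rw [Pi.neg_apply] <;>
    rcases hε i with e | e <;> rw [e] at b ⊢ <;> revert b <;> decide

theorem IsPotential.hexagon {Ψ : (Fin 3 → ℤ) → ℤˣ} {a : Plaquette L → ℤˣ} (h : IsPotential Ψ a)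
    {y ε : Fin 3 → ℤ} (hy : IsCellZ y) (hε : ∀ i, ε i = 1 ∨ ε i = -1) :
    extend a (toPoint L (y + ε)) = Ψ y * Ψ (y + ε + ε) := by
  obtain ⟨hx, hc, hn⟩ := hexagon_of_isCellZ (L := L) hy hε
  rw [← hc, extend_center, h _ _ hc.symm]
  rcases hn with e | e <;> rw [e]
  · rw [add_sub_cancel_right]
  · rw [sub_neg_eq_add, add_neg_cancel_right, mul_comm]

theorem IsPotential.curl_eq_one {Ψ : (Fin 3 → ℤ) → ℤˣ} {a : Plaquette L → ℤˣ}
    (h : IsPotential Ψ a) {c : Point L} {i j k : Fin 3} (hc : IsSq c i j k) (δ δ' : ℤˣ) :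
    curl (extend a) c i j k δ δ' = 1 := by
  obtain ⟨x, rfl⟩ := toPoint_surjective c
  obtain ⟨q, hq⟩ := hc.exists_square
  have hcen : toPoint L x = center (Sum.inl q) := by simp [center, hq]
  have hnor : normal (Sum.inl q) = Pi.single i 2 := by simp [normal, hq]
  have hcell := isCellZ_sub_normal hcen
  rw [hnor] at hcell
  have hsign : ∀ (δ δ' ε : ℤˣ) (l : Fin 3), (Pi.single i (ε : ℤ) - Pi.single j (δ : ℤ) -
      Pi.single k (δ' : ℤ) : Fin 3 → ℤ) l = 1 ∨ (Pi.single i (ε : ℤ) - Pi.single j (δ : ℤ) -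
      Pi.single k (δ' : ℤ) : Fin 3 → ℤ) l = -1 := by
    intro δ δ' ε l
    have hu : ∀ u : ℤˣ, (u : ℤ) = 1 ∨ (u : ℤ) = -1 := fun u => by
      rcases Int.units_eq_one_or u with rfl | rfl <;> simp
    rcases eq_of_three hc.ij hc.ik hc.jk l with rfl | rfl | rfl
    · simpa [Pi.single_eq_of_ne, hc.ij, hc.ik] using hu ε
    · simpa [Pi.single_eq_of_ne, hc.ij.symm, hc.jk, or_comm, neg_eq_iff_eq_neg] using hu δ
    · simpa [Pi.single_eq_of_ne, hc.ik.symm, hc.jk.symm, or_comm, neg_eq_iff_eq_neg] using hu δ'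
  set D : Fin 3 → ℤ := x + Pi.single j (2 * (δ : ℤ)) + Pi.single k (2 * (δ' : ℤ)) with hD
  have hDc : IsCellZ D := by
    have h1 : ∀ l, (D l : ZMod 4) = ((x - Pi.single i 2 : Fin 3 → ℤ) l : ZMod 4) + 2 := by
      intro l
      rcases eq_of_three hc.ij hc.ik hc.jk l with rfl | rfl | rfl
      · simp [hD, Pi.single_eq_of_ne, hc.ij, hc.ik]
      · rcases Int.units_eq_one_or δ with rfl | rfl <;>
          simp [hD, Pi.single_eq_of_ne, hc.ij.symm, hc.jk]; rfl
      · rcases Int.units_eq_one_or δ' with rfl | rfl <;>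
          simp [hD, Pi.single_eq_of_ne, hc.ik.symm, hc.jk.symm]; rfl
    rcases hcell with h2 | h2
    · right; intro l; rw [h1, h2]; decide
    · left; intro l; rw [h1, h2]; decide
  have a0 : extend a (toPoint L x) = Ψ (x - Pi.single i 2) * Ψ (x + Pi.single i 2) := by
    rw [hcen, extend_center, h _ _ hcen, hnor]
  have a1 := h.hexagon hDc (hsign δ δ' 1)
  have a2 := h.hexagon hDc (hsign δ δ' (-1))
  have s2 : ∀ (l : Fin 3) (n : ℤ), (Pi.single l (2 * n) : Fin 3 → ℤ) =
      Pi.single l n + Pi.single l n := fun l n => by rw [two_mul, Pi.single_add]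
  have sn : ∀ (l : Fin 3) (n : ℤ), (Pi.single l (-n) : Fin 3 → ℤ) = - Pi.single l n :=
    fun l n => Pi.single_neg _ _
  have s22 : ∀ (l : Fin 3), (Pi.single l 2 : Fin 3 → ℤ) =
      Pi.single l 1 + Pi.single l 1 := fun l => by rw [← Pi.single_add]; rfl
  have p1 : D + (Pi.single i ((1 : ℤˣ) : ℤ) - Pi.single j (δ : ℤ) - Pi.single k (δ' : ℤ)) =
      x + Pi.single i 1 + Pi.single j (δ : ℤ) + Pi.single k (δ' : ℤ) := by
    rw [hD, s2, s2, Units.val_one]; abel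
  have p2 : D + (Pi.single i (((-1 : ℤˣ)) : ℤ) - Pi.single j (δ : ℤ) - Pi.single k (δ' : ℤ)) =
      x - Pi.single i 1 + Pi.single j (δ : ℤ) + Pi.single k (δ' : ℤ) := by
    rw [hD, s2, s2, Units.val_neg, Units.val_one, sn]; abel
  rw [p1] at a1
  rw [p2] at a2
  have q1 : x + Pi.single i 1 + Pi.single j (δ : ℤ) + Pi.single k (δ' : ℤ) +
      (Pi.single i ((1 : ℤˣ) : ℤ) - Pi.single j (δ : ℤ) - Pi.single k (δ' : ℤ)) =
      x + Pi.single i 2 := by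
    rw [s22, Units.val_one]; abel
  have q2 : x - Pi.single i 1 + Pi.single j (δ : ℤ) + Pi.single k (δ' : ℤ) +
      (Pi.single i (((-1 : ℤˣ)) : ℤ) - Pi.single j (δ : ℤ) - Pi.single k (δ' : ℤ)) =
      x - Pi.single i 2 := by
    rw [s22, Units.val_neg, Units.val_one, sn]; abel
  rw [q1] at a1
  rw [q2] at a2
  simp only [toPoint_add, toPoint_sub, toPoint_single, one_smul] at a1 a2
  rw [curl, a0, a1, a2]
  generalize Ψ (x - Pi.single i 2) = y₁
  generalize Ψ (x + Pi.single i 2) = y₂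
  generalize Ψ D = y₃
  revert y₁ y₂ y₃; decide

theorem curl_squareSign {c : Point L} {i j k : Fin 3} (hc : IsSq c i j k) (δ δ' η : ℤˣ) :
    curl (extend (squareSign η)) c i j k δ δ' = η := by
  obtain ⟨q, hq⟩ := hc.exists_square
  have hcen : c = center (Sum.inl q) := by simp [center, hq]
  have hhex : ∀ ε : ℤˣ, extend (squareSign η)
      (c + (ε : ℤ) • unit L i + (δ : ℤ) • unit L j + (δ' : ℤ) • unit L k) = 1 := by
    intro ε
    have : ∀ l, res (c + (ε : ℤ) • unit L i + (δ : ℤ) • unit L j + (δ' : ℤ) • unit L k) l = 1 ∨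
        res (c + (ε : ℤ) • unit L i + (δ : ℤ) • unit L j + (δ' : ℤ) • unit L k) l = 3 := by
      have key : ∀ (u : ℤˣ) (r : ZMod 4), (r = 0 ∨ r = 2) →
          (r + (u : ℤ) = 1 ∨ r + (u : ℤ) = 3) := by decide
      intro l
      rcases eq_of_three hc.ij hc.ik hc.jk l with rfl | rfl | rfl <;>
      simp only [res_add, res_zsmul_unit_self, res_zsmul_unit_ne, hc.ij, hc.ik, hc.jk, hc.ij.symm,
        hc.ik.symm, hc.jk.symm, ne_eq, not_false_eq_true, add_zero]
      · exact key ε _ hc.even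
      · exact key δ _ (by rw [hc.resj]; rcases hc.even with e | e <;> rw [e] <;> decide)
      · exact key δ' _ (by rw [hc.resk]; rcases hc.even with e | e <;> rw [e] <;> decide)
    have h2 := extend_center (squareSign η) (Sum.inr (⟨_, this⟩ : Hexagon L))
    exact h2
  have h1 := hhex 1
  have h2 := hhex (-1)
  simp only [Units.val_one, one_smul, Units.val_neg, neg_smul, ← sub_eq_add_neg] at h1 h2
  rw [curl, h1, h2, hcen, extend_center]
  simp [squareSign]

theorem curl_mul (a b : Plaquette L → ℤˣ) (c : Point L) (i j k : Fin 3) (δ δ' : ℤˣ) :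
    curl (extend (a * b)) c i j k δ δ' =
      curl (extend a) c i j k δ δ' * curl (extend b) c i j k δ δ' := by
  simp only [curl, extend_mul]
  ac_rfl

theorem twist_eq_mul (σ : Cell L → ℤˣ) (s : Fin 3 → ℤˣ) (η : ℤˣ) :
    twist L (σ, s, η) = squareSign η * twist L (σ, s, 1) := by
  funext p
  simp only [Pi.mul_apply, twist_apply, squareSign_one, one_mul]

theorem curl_twist {c : Point L} {i j k : Fin 3} (hc : IsSq c i j k) (δ δ' : ℤˣ)
    (g : (Cell L → ℤˣ) × (Fin 3 → ℤˣ) × ℤˣ) :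
    curl (extend (twist L g)) c i j k δ δ' = g.2.2 := by
  obtain ⟨σ, s, η⟩ := g
  rw [twist_eq_mul, curl_mul, curl_squareSign hc,
    (isPotential_liftSpin σ s).curl_eq_one hc, mul_one]

theorem twist_mem (g : (Cell L → ℤˣ) × (Fin 3 → ℤˣ) × ℤˣ) : twist L g ∈ plaquetteKernel L :=
  mem_plaquetteKernel_iff_curl.2 ⟨g.2.2, fun _ _ _ _ hc δ δ' => curl_twist hc δ δ' g⟩

theorem isCellZ_add_period {x : Fin 3 → ℤ} (hx : IsCellZ x) (k : Fin 3) (n : ℤ) :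
    IsCellZ (x + Pi.single k (4 * L * n : ℤ)) := by
  have : ∀ i, ((x + Pi.single k (4 * L * n : ℤ) : Fin 3 → ℤ) i : ZMod 4) = (x i : ZMod 4) := by
    intro i
    by_cases h : i = k
    · subst h
      have h4 : (4 : ZMod 4) = 0 := rfl
      simp [h4]
    · simp [Pi.single_eq_of_ne h]
  exact hx.imp (fun h i => by rw [this, h]) (fun h i => by rw [this, h])

theorem quasiperiodic_zpow {Ψ : (Fin 3 → ℤ) → ℤˣ} {s : Fin 3 → ℤˣ}
    (hΨ : ∀ x, IsCellZ x → ∀ k, Ψ (x + Pi.single k (4 * L : ℤ)) = s k * Ψ x)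
    {x : Fin 3 → ℤ} (hx : IsCellZ x) (k : Fin 3) (n : ℤ) :
    Ψ (x + Pi.single k (4 * L * n : ℤ)) = s k ^ n * Ψ x := by
  induction n using Int.induction_on with
  | zero => simp
  | succ n ih =>
    rw [mul_add, mul_one, Pi.single_add, ← add_assoc, hΨ _ (isCellZ_add_period hx k _), ih,
      zpow_add_one, ← mul_assoc, mul_comm (s k)]
  | pred n ih =>
    have h1 := hΨ _ (isCellZ_add_period (L := L) hx k (-(n : ℤ) - 1)) k
    rw [add_assoc, ← Pi.single_add, show (4 * L * (-(n : ℤ) - 1) + 4 * L : ℤ) = 4 * L * (-n) by ring,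
      ih] at h1
    have h2 : Ψ (x + Pi.single k (4 * L * (-(n : ℤ) - 1))) =
        s k * (s k * Ψ (x + Pi.single k (4 * L * (-(n : ℤ) - 1)))) := (units_mul_cancel _ _).symm
    rw [h2, ← h1, zpow_sub_one, Int.units_inv_eq_self, ← mul_assoc, mul_comm (s k)]

theorem quasiperiodic_eq_liftSpin {Ψ : (Fin 3 → ℤ) → ℤˣ} {s : Fin 3 → ℤˣ}
    (hΨ : ∀ x, IsCellZ x → ∀ k, Ψ (x + Pi.single k (4 * L : ℤ)) = s k * Ψ x)
    {x : Fin 3 → ℤ} (hx : IsCellZ x) :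
    Ψ x = liftSpin (fun c : Cell L => Ψ fun i => ((c.1 i).val : ℤ)) s x := by
  have hM : (0 : ℤ) < 4 * L := cast_pos_four_mul
  have hres : (∀ i, res (toPoint L x) i = 0) ∨ (∀ i, res (toPoint L x) i = 2) := by
    simp only [res_toPoint]; exact hx
  rw [liftSpin, dif_pos hres]
  have hval : (fun i => ((toPoint L x i).val : ℤ)) = fun i => x i % (4 * L : ℤ) := by
    funext i
    have := ZMod.val_intCast (n := 4 * L) (x i)
    rw [toPoint, this]; push_cast; rfl
  simp only [hval]
  set y : Fin 3 → ℤ := fun i => x i % (4 * L : ℤ) with hy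
  have hxy : x = y + Pi.single 0 (4 * L * (x 0 / (4 * L : ℤ))) +
      Pi.single 1 (4 * L * (x 1 / (4 * L : ℤ))) + Pi.single 2 (4 * L * (x 2 / (4 * L : ℤ))) := by
    have e : ∀ i, x i = y i + 4 * L * (x i / (4 * L : ℤ)) := fun i =>
      (Int.emod_add_mul_ediv (x i) (4 * L : ℤ)).symm
    funext i
    fin_cases i
    · simpa using e 0
    · simpa using e 1
    · simpa using e 2
  have hyc : IsCellZ y := by
    have : ∀ i, (y i : ZMod 4) = (x i : ZMod 4) := by
      intro i
      have h4 : (4 : ZMod 4) = 0 := rfl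
      conv_rhs => rw [← Int.emod_add_mul_ediv (x i) (4 * L : ℤ)]
      simp [hy, h4]
    exact hx.imp (fun h i => by rw [this, h]) (fun h i => by rw [this, h])
  conv_lhs => rw [hxy]
  rw [quasiperiodic_zpow hΨ (isCellZ_add_period (isCellZ_add_period hyc _ _) _ _),
    quasiperiodic_zpow hΨ (isCellZ_add_period hyc _ _), quasiperiodic_zpow hΨ hyc,
    Fin.prod_univ_three]
  ac_rfl

theorem exists_twist {a : Plaquette L → ℤˣ} (ha : a ∈ plaquetteKernel L) :
    ∃ g, twist L g = a := by
  obtain ⟨κ, hκ⟩ := mem_plaquetteKernel_iff_curl.1 ha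
  obtain ⟨Ψ, s, hq, hp⟩ := exists_isPotential (a := squareSign κ * a) (fun c i j k hc δ δ' => by
    rw [curl_mul, curl_squareSign hc, hκ c i j k hc, Int.units_mul_self])
  refine ⟨(fun c : Cell L => Ψ fun i => ((c.1 i).val : ℤ), s, κ), ?_⟩
  rw [twist_eq_mul]
  funext p
  have h1 := hp p _ (toPoint_val _)
  have h2 := isPotential_liftSpin (fun c : Cell L => Ψ fun i => ((c.1 i).val : ℤ)) s p _
    (toPoint_val _)
  rw [Pi.mul_apply, h2, ← quasiperiodic_eq_liftSpin hq (isCellZ_sub_normal (toPoint_val _)),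
    ← quasiperiodic_eq_liftSpin hq (isCellZ_add_normal (toPoint_val _)), ← h1, Pi.mul_apply,
    units_mul_cancel]

theorem liftSpin_add_period (σ : Cell L → ℤˣ) (s : Fin 3 → ℤˣ) (x : Fin 3 → ℤ) (k : Fin 3) :
    liftSpin σ s (x + Pi.single k (4 * L : ℤ)) = s k * liftSpin σ s x := by
  have h1 : toPoint L (x + Pi.single k (4 * L : ℤ)) = toPoint L x := by
    simpa using toPoint_add_period (L := L) x k 1
  have hM : (4 * L : ℤ) ≠ 0 := (cast_pos_four_mul (L := L)).ne'
  have h2 : ∏ i, s i ^ ((x + Pi.single k (4 * L : ℤ) : Fin 3 → ℤ) i / (4 * L : ℤ)) =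
      s k * ∏ i, s i ^ (x i / (4 * L : ℤ)) := by
    have : ∀ i, s i ^ ((x + Pi.single k (4 * L : ℤ) : Fin 3 → ℤ) i / (4 * L : ℤ)) =
        (if i = k then s k else 1) * s i ^ (x i / (4 * L : ℤ)) := by
      intro i
      by_cases h : i = k
      · subst h
        rw [Pi.add_apply, Pi.single_eq_same, Int.add_ediv_of_dvd_right (dvd_refl _),
          Int.ediv_self hM, zpow_add_one, if_pos rfl, mul_comm]
      · simp [h]
    simp only [this, Finset.prod_mul_distrib, Finset.prod_ite_eq', Finset.mem_univ, if_true]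
  simp only [liftSpin, h1, h2]
  ac_rfl

theorem twist_eq_one {g : (Cell L → ℤˣ) × (Fin 3 → ℤˣ) × ℤˣ} (hg : twist L g = 1) :
    g = 1 ∨ g = (-1, 1, 1) := by
  obtain ⟨σ, s, η⟩ := g
  have hη : η = 1 := by
    have h0 := isSq_bcc (L := L) 0 (show (0 : Fin 3) ≠ 1 by decide) (show (0 : Fin 3) ≠ 2 by decide)
      (show (1 : Fin 3) ≠ 2 by decide)
    have h1 : _ = η := curl_twist h0 1 1 (σ, s, η)
    rw [hg] at h1
    rw [← h1]
    simp [curl, extend]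
  subst hη
  have hp := isPotential_liftSpin σ s
  rw [hg] at hp
  have hconst : ∀ x, IsCellZ x → liftSpin σ s x = liftSpin σ s 0 := by
    intro x hx
    obtain ⟨n, rfl⟩ := hx.exists_bcc
    have key : ∀ u v : ℤˣ, u * v = 1 → u = v := by decide
    have h1 := eq_of_add_single_invariant (G := fun n => liftSpin σ s (bcc n)) (by
      intro i n
      have h2 := hp.hexagon (isCellZ_bcc n) (ε := halfBasis i) (by
        intro l
        by_cases h : l = i
        · right; simp [halfBasis, h]
        · left; simp [halfBasis, Pi.single_eq_of_ne h])
      have e : bcc n + halfBasis i + halfBasis i = bcc (n + Pi.single i 1) := by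
        rw [bcc_add, bcc_single]; module
      have e0 : extend (1 : Plaquette L → ℤˣ) (toPoint L (bcc n + halfBasis i)) = 1 := by
        simp [extend]
      rw [e, e0] at h2
      exact (key _ _ h2.symm).symm) n
    have e0 : bcc 0 = 0 := by funext l; simp [bcc]
    exact h1.trans (by simp only [e0])
  have hs : s = 1 := by
    funext k
    have h0 : IsCellZ (0 : Fin 3 → ℤ) := Or.inl fun i => by simp
    have h1 := liftSpin_add_period σ s 0 k
    rw [hconst _ (by simpa using isCellZ_add_period (L := L) h0 k 1)] at h1
    simpa using h1.symm
  subst hs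
  have hσ : ∀ c, σ c = liftSpin σ 1 0 := by
    intro c
    have hc : IsCellZ fun i => ((c.1 i).val : ℤ) := by
      have := c.2
      rw [← toPoint_val c.1] at this
      simp only [res_toPoint] at this
      exact this
    rw [← hconst _ hc, liftSpin, dif_pos (by rw [toPoint_val]; exact c.2)]
    simp only [toPoint_val]
    simp only [Pi.one_apply, one_zpow, Finset.prod_const_one, mul_one]
    rfl
  rcases Int.units_eq_one_or (liftSpin σ 1 0) with e | e
  · left
    have : σ = 1 := funext fun c => by rw [hσ, e]; rfl
    rw [this]; rfl
  · right
    have : σ = -1 := funext fun c => by rw [hσ, e]; rfl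
    rw [this]

theorem twist_neg : twist L ((-1, 1, 1) : (Cell L → ℤˣ) × (Fin 3 → ℤˣ) × ℤˣ) = 1 := by
  funext p
  rw [twist_apply]
  simp [squareSign_one, bondSign]

theorem cell_nonempty : Nonempty (Cell L) := ⟨⟨0, Or.inl fun i => by simp [res]⟩⟩

open Classical in
/-- The twisted Ising configurations cover the kernel twice. -/
theorem sum_twist (f : (Plaquette L → ℤˣ) → ℝ) :
    ∑ g, f (twist L g) = 2 * ∑ a, if a ∈ plaquetteKernel L then f a else 0 := by
  rw [← Finset.sum_fiberwise_of_maps_to (s := Finset.univ) (t := Finset.univ) (g := twist L)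
    (fun _ _ => Finset.mem_univ _), Finset.mul_sum]
  refine Finset.sum_congr rfl fun a _ => ?_
  split_ifs with ha
  · obtain ⟨g₀, rfl⟩ := exists_twist ha
    have hset : (Finset.univ.filter fun g => twist L g = twist L g₀) =
        {g₀, (-1, 1, 1) * g₀} := by
      ext g
      simp only [Finset.mem_filter, Finset.mem_univ, true_and, Finset.mem_insert,
        Finset.mem_singleton]
      constructor
      · intro h
        have h1 : twist L (g * g₀⁻¹) = 1 := by rw [map_mul, map_inv, h, mul_inv_cancel]
        rcases twist_eq_one h1 with e | e
        · left; exact mul_inv_eq_one.1 e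
        · right; rw [← e, inv_mul_cancel_right]
      · rintro (rfl | rfl)
        · rfl
        · rw [map_mul, twist_neg, one_mul]
    have hne : g₀ ≠ (-1, 1, 1) * g₀ := by
      intro h
      have h1 : ((-1, 1, 1) : (Cell L → ℤˣ) × (Fin 3 → ℤˣ) × ℤˣ) = 1 := by
        rw [← mul_eq_right (b := g₀)]; exact h.symm
      have h2 : (-1 : Cell L → ℤˣ) = 1 := congrArg Prod.fst h1
      obtain ⟨c⟩ := cell_nonempty (L := L)
      exact absurd (congrFun h2 c) (by simp)
    rw [hset, Finset.sum_pair hne, map_mul, twist_neg, one_mul, two_mul]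
  · rw [mul_zero]
    refine Finset.sum_eq_zero fun g hg => ?_
    rw [Finset.mem_filter] at hg
    exact absurd (hg.2 ▸ twist_mem g) ha

end Twisted

section Phase

set_option linter.unusedSectionVars false

variable {L : ℕ} [NeZero L]

theorem card_eq_two_mul_of_involution {α : Type*} [DecidableEq α] {S : Finset α} (f : α → α)
    (b : α → Prop) [DecidablePred b] (hf : ∀ x ∈ S, f x ∈ S) (hff : ∀ x ∈ S, f (f x) = x)
    (hb : ∀ x ∈ S, b (f x) ↔ ¬ b x) : S.card = 2 * (S.filter b).card := by
  rw [← Finset.card_filter_add_card_filter_not (s := S) b, two_mul]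
  congr 1
  symm
  refine Finset.card_bij (fun x _ => f x) ?_ ?_ ?_
  · intro x hx
    rw [Finset.mem_filter] at hx ⊢
    exact ⟨hf x hx.1, fun h => (hb x hx.1).1 h hx.2⟩
  · intro x hx y hy h
    rw [Finset.mem_filter] at hx hy
    rw [← hff x hx.1, ← hff y hy.1, h]
  · intro y hy
    rw [Finset.mem_filter] at hy
    exact ⟨f y, Finset.mem_filter.2 ⟨hf y hy.1, (hb y hy.1).2 hy.2⟩, hff y hy.1⟩

theorem four_dvd_card {α : Type*} [DecidableEq α] {S : Finset α} (f g : α → α)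
    (b c : α → Prop) (hf : ∀ x ∈ S, f x ∈ S) (hff : ∀ x ∈ S, f (f x) = x)
    (hg : ∀ x ∈ S, g x ∈ S) (hgg : ∀ x ∈ S, g (g x) = x)
    (hb : ∀ x ∈ S, b (f x) ↔ ¬ b x) (hbg : ∀ x ∈ S, b (g x) ↔ b x)
    (hc : ∀ x ∈ S, c (g x) ↔ ¬ c x) : 4 ∣ S.card := by
  classical
  rw [card_eq_two_mul_of_involution f b hf hff hb,
    card_eq_two_mul_of_involution (S := S.filter b) g c]
  · exact ⟨_, (mul_assoc 2 2 _).symm⟩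
  · intro x hx
    rw [Finset.mem_filter] at hx ⊢
    exact ⟨hg x hx.1, (hbg x hx.1).2 hx.2⟩
  · exact fun x hx => hgg x (Finset.mem_filter.1 hx).1
  · exact fun x hx => hc x (Finset.mem_filter.1 hx).1

open Classical in
/-- The vertices where the hexagons of one kind have product `-1`. -/
noncomputable def oddVertices (E : Point L → ℤˣ) : Finset (Point L) :=
  Finset.univ.filter fun x => ∃ α β γ, IsVtx x α β γ ∧
    E (x + unit L α + unit L β) * E (x - unit L α - unit L β) = -1

theorem mem_oddVertices {E : Point L → ℤˣ} {x : Point L} : x ∈ oddVertices E ↔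
    ∃ α β γ, IsVtx x α β γ ∧ E (x + unit L α + unit L β) * E (x - unit L α - unit L β) = -1 := by
  simp [oddVertices]

theorem localSign_of_mem {a : Plaquette L → ℤˣ} (ha : a ∈ plaquetteKernel L) {v : Vertex L}
    {α β γ : Fin 3} (hv : IsVtx v.1 α β γ) :
    localSign (fun (v : Vertex L) p => OnPlaquette v p) kind a v 0 =
      extend a (v.1 + unit L α + unit L β) * extend a (v.1 - unit L α - unit L β) := by
  rw [(ha v).1, localSign_one a hv, (mem_plaquetteKernel.1 ha _ _ _ _ hv).1]

theorem localSign_eq_one_iff {a : Plaquette L → ℤˣ} (ha : a ∈ plaquetteKernel L) (v : Vertex L) :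
    localSign (fun (v : Vertex L) p => OnPlaquette v p) kind a v 0 = 1 ↔
      v.1 ∉ oddVertices (extend a) := by
  rw [mem_oddVertices]
  constructor
  · rintro h ⟨α, β, γ, hv, h'⟩
    rw [localSign_of_mem ha hv, h'] at h
    exact absurd h (by decide)
  · intro h
    obtain ⟨α, β, γ, hv⟩ := v.exists_isVtx
    rw [localSign_of_mem ha hv]
    exact (Int.units_eq_one_or _).resolve_right fun h' => h ⟨α, β, γ, hv, h'⟩

theorem stringPhase_eq_one {a : Plaquette L → ℤˣ} (ha : a ∈ plaquetteKernel L)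
    (h4 : 4 ∣ (oddVertices (extend a)).card) :
    stringPhase (fun (v : Vertex L) p => OnPlaquette v p) kind a = 1 := by
  classical
  have h1 : (Finset.univ.filter fun v : Vertex L => v.1 ∈ oddVertices (extend a)).card =
      (oddVertices (extend a)).card := by
    refine Finset.card_bij (fun v _ => v.1) (fun v hv => (Finset.mem_filter.1 hv).2)
      (fun v _ w _ h => Subtype.ext h) ?_
    intro x hx
    obtain ⟨α, β, γ, hv, -⟩ := mem_oddVertices.1 hx
    obtain ⟨v, rfl⟩ := hv.exists_vertex
    exact ⟨v, Finset.mem_filter.2 ⟨Finset.mem_univ _, hx⟩, rfl⟩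
  obtain ⟨n, hn⟩ := h4
  rw [stringPhase]
  have : ∀ v : Vertex L,
      (if localSign (fun (v : Vertex L) p => OnPlaquette v p) kind a v 0 = 1
        then (1 : ℂ) else Complex.I) =
      if v.1 ∈ oddVertices (extend a) then Complex.I else 1 := by
    intro v
    by_cases h : v.1 ∈ oddVertices (extend a)
    · rw [if_pos h, if_neg fun h' => (localSign_eq_one_iff ha v).1 h' h]
    · rw [if_neg h, if_pos ((localSign_eq_one_iff ha v).2 h)]
  simp only [this]
  rw [Finset.prod_ite, Finset.prod_const, Finset.prod_const_one, mul_one, h1, hn, pow_mul,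
    Complex.I_pow_four, one_pow]

/-- A code for the residues: even residues `0`, `2` and odd residues. -/
def resRank (r : ZMod 4) : ℕ := if r = 0 then 0 else if r = 2 then 2 else 1

/-- The odd coordinate of a vertex is `1` mod `4`. -/
def OddResOne (x : Point L) : Prop := ∃ i, res x i = 1

theorem IsVtx.resRank_lt {x : Point L} {α β γ : Fin 3} (h : IsVtx x α β γ) {j k : Fin 3}
    (hjk : j ≠ k) : resRank (res x j) < resRank (res x k) ↔
      ¬ resRank (res x k) < resRank (res x j) := by
  have key : ∀ l m : Fin 3, l ≠ m → resRank (res x l) ≠ resRank (res x m) := by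
    intro l m hlm
    rcases eq_of_three h.ab h.ac h.bc l with rfl | rfl | rfl <;>
    rcases eq_of_three h.ab h.ac h.bc m with rfl | rfl | rfl <;>
    first
    | exact absurd rfl hlm
    | (rcases h.even with e | e <;> rcases h.odd with o | o <;> simp only [e.1, e.2, o] <;> decide)
  have := key j k hjk
  omega

theorem IsVtx.oddResOne_iff {x : Point L} {α β γ : Fin 3} (h : IsVtx x α β γ) :
    OddResOne x ↔ res x γ = 1 := by
  constructor
  · rintro ⟨i, hi⟩
    rcases eq_of_three h.ab h.ac h.bc i with rfl | rfl | rfl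
    · exact (odd_ne_even (Or.inl hi) (h.even.imp And.left And.left)).elim
    · exact (odd_ne_even (Or.inl hi) (h.even.symm.imp And.right And.right)).elim
    · exact hi
  · exact fun h => ⟨_, h⟩

theorem IsVtx.comp_perm {x y : Point L} {α β γ : Fin 3} (h : IsVtx x α β γ)
    (e : Equiv.Perm (Fin 3)) (hy : ∀ i, res y i = res x (e.symm i)) :
    IsVtx y (e α) (e β) (e γ) := by
  refine ⟨e.injective.ne h.ab, e.injective.ne h.ac, e.injective.ne h.bc, ?_, ?_⟩ <;>
  simp only [hy, Equiv.symm_apply_apply]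
  · exact h.even
  · exact h.odd

theorem IsVtx.exists_hexagon {x : Point L} {α β γ : Fin 3} (h : IsVtx x α β γ) (ε δ : ℤˣ) :
    ∃ h : Hexagon L, h.1 = x + (ε : ℤ) • unit L α + (δ : ℤ) • unit L β := by
  have key : ∀ (u : ℤˣ) (r : ZMod 4), (r = 0 ∨ r = 2) →
      (r + (u : ℤ) = 1 ∨ r + (u : ℤ) = 3) := by decide
  refine ⟨⟨_, ?_⟩, rfl⟩
  intro l
  rcases eq_of_three h.ab h.ac h.bc l with rfl | rfl | rfl <;>
  simp only [res_add, res_zsmul_unit_self, res_zsmul_unit_ne, h.ab, h.ab.symm,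
    h.ac.symm, h.bc.symm, ne_eq, not_false_eq_true, add_zero]
  · exact key ε _ (h.even.imp And.left And.left)
  · exact key δ _ (h.even.symm.imp And.right And.right)
  · exact h.odd

theorem oddVertices_congr {E E' : Point L → ℤˣ}
    (h : ∀ x : Point L, (∀ i, res x i = 1 ∨ res x i = 3) → E x = E' x) :
    oddVertices E = oddVertices E' := by
  have key : ∀ {x : Point L} {α β γ : Fin 3}, IsVtx x α β γ →
      E (x + unit L α + unit L β) * E (x - unit L α - unit L β) =
      E' (x + unit L α + unit L β) * E' (x - unit L α - unit L β) := by
    intro x α β γ hx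
    obtain ⟨h1, e1⟩ := hx.exists_hexagon 1 1
    obtain ⟨h2, e2⟩ := hx.exists_hexagon (-1) (-1)
    simp only [Units.val_one, one_smul, Units.val_neg, neg_smul, ← sub_eq_add_neg] at e1 e2
    rw [← e1, ← e2, h _ h1.2, h _ h2.2]
  ext x
  simp only [mem_oddVertices]
  constructor <;> rintro ⟨α, β, γ, hx, e⟩
  · exact ⟨α, β, γ, hx, by rw [← key hx, e]⟩
  · exact ⟨α, β, γ, hx, by rw [key hx, e]⟩

theorem res_two_mul_even {r : ZMod 4} (h : r = 0 ∨ r = 2) : r + r = 0 := by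
  revert r; decide

open Classical in
theorem four_dvd_card_star (c : Cell L) :
    4 ∣ (oddVertices fun x => if ∀ i, x i = c.1 i + 1 ∨ x i = c.1 i - 1 then (-1 : ℤˣ) else 1).card
    := by
  set Q : Point L → Prop := fun x => ∀ i, x i = c.1 i + 1 ∨ x i = c.1 i - 1 with hQ
  have hc : ∀ i, res c.1 i = 0 ∨ res c.1 i = 2 := fun i => c.2.imp (fun h => h i) fun h => h i
  have hcc : ∀ i j, res c.1 i = res c.1 j := by
    intro i j
    rcases c.2 with h | h <;> rw [h, h]
  set e : Equiv.Perm (Fin 3) := Equiv.swap 0 1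
  have hee : ∀ i, e (e i) = i := fun i => Equiv.swap_apply_self 0 1 i
  let f : Point L → Point L := fun x => c.1 + c.1 - x
  let g : Point L → Point L := fun x i => x (e i) - c.1 (e i) + c.1 i
  have rf : ∀ x i, res (f x) i = - res x i := by
    intro x i
    simp only [f, res_sub, res_add, res_two_mul_even (hc i), zero_sub]
  have rg : ∀ x i, res (g x) i = res x (e i) := by
    intro x i
    have : res (g x) i = res x (e i) - res c.1 (e i) + res c.1 i := by simp [g, res]
    rw [this, hcc (e i) i, sub_add_cancel]
  have hneg : ∀ {x : Point L} {α β γ : Fin 3}, IsVtx x α β γ → IsVtx (f x) α β γ := by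
    intro x α β γ h
    refine ⟨h.ab, h.ac, h.bc, ?_, ?_⟩ <;> simp only [rf]
    · rcases h.even with e | e <;> simp only [e.1, e.2] <;> decide
    · rcases h.odd with e | e <;> simp only [e] <;> decide
  have Qf : ∀ x, Q (f x) ↔ Q x := by
    intro x
    refine forall_congr' fun i => ?_
    simp only [f, Pi.sub_apply, Pi.add_apply]
    constructor
    · rintro (h | h)
      · right; linear_combination -h
      · left; linear_combination -h
    · rintro (h | h)
      · right; linear_combination -h
      · left; linear_combination -h
  have Qg : ∀ x, Q (g x) ↔ Q x := by
    intro x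
    constructor
    · intro h i
      have := h (e i)
      simp only [g, hee] at this
      rcases this with h | h
      · left; linear_combination h
      · right; linear_combination h
    · intro h i
      rcases h (e i) with h | h
      · left; simp only [g]; linear_combination h
      · right; simp only [g]; linear_combination h
  have ug : ∀ i j, unit L (e j) i = unit L j (e i) := by
    intro i j
    by_cases h : i = e j
    · rw [h, hee, unit_self, unit_self]
    · rw [unit_ne h, unit_ne fun h' => h (by rw [← h', hee])]
  refine four_dvd_card f g OddResOne (fun x => resRank (res x 0) < resRank (res x 1))
    ?_ ?_ ?_ ?_ ?_ ?_ ?_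
  · intro x hx
    obtain ⟨α, β, γ, hv, h⟩ := mem_oddVertices.1 hx
    refine mem_oddVertices.2 ⟨α, β, γ, hneg hv, ?_⟩
    have e1 : f x + unit L α + unit L β = f (x - unit L α - unit L β) := by
      simp only [f]; abel
    have e2 : f x - unit L α - unit L β = f (x + unit L α + unit L β) := by
      simp only [f]; abel
    rw [e1, e2, if_congr (Qf _) rfl rfl, if_congr (Qf _) rfl rfl, mul_comm]
    exact h
  · intro x _; simp only [f]; abel
  · intro x hx
    obtain ⟨α, β, γ, hv, h⟩ := mem_oddVertices.1 hx
    refine mem_oddVertices.2 ⟨e α, e β, e γ, hv.comp_perm e (rg x), ?_⟩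
    have e1 : g x + unit L (e α) + unit L (e β) = g (x + unit L α + unit L β) := by
      funext i
      simp only [g, Pi.add_apply, ug]
      ring
    have e2 : g x - unit L (e α) - unit L (e β) = g (x - unit L α - unit L β) := by
      funext i
      simp only [g, Pi.sub_apply, ug]
      ring
    rw [e1, e2, if_congr (Qg _) rfl rfl, if_congr (Qg _) rfl rfl]
    exact h
  · intro x _
    funext i
    simp only [g, hee]
    ring
  · intro x hx
    obtain ⟨α, β, γ, hv, -⟩ := mem_oddVertices.1 hx
    rw [(hneg hv).oddResOne_iff, hv.oddResOne_iff, rf]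
    rcases hv.odd with e | e <;> rw [e] <;> decide
  · intro x _
    constructor
    · rintro ⟨i, hi⟩
      exact ⟨e i, by rw [← rg, hi]⟩
    · rintro ⟨i, hi⟩
      exact ⟨e i, by rw [rg, hee, hi]⟩
  · intro x hx
    obtain ⟨α, β, γ, hv, -⟩ := mem_oddVertices.1 hx
    simp only [rg]
    exact hv.resRank_lt (j := 1) (k := 0) (by decide)

open Classical in
theorem four_dvd_card_plane (i : Fin 3) :
    4 ∣ (oddVertices fun x : Point L => if x i = -1 then (-1 : ℤˣ) else 1).card := by
  obtain ⟨j, k, hij, hik, hjk⟩ : ∃ j k : Fin 3, i ≠ j ∧ i ≠ k ∧ j ≠ k := by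
    revert i; decide
  set e : Equiv.Perm (Fin 3) := Equiv.swap j k
  have hee : ∀ l, e (e l) = l := fun l => Equiv.swap_apply_self j k l
  have hei : e i = i := Equiv.swap_apply_of_ne_of_ne hij hik
  let f : Point L → Point L := fun x l => if l = i then x l else - x l
  let g : Point L → Point L := fun x l => x (e l)
  have rf : ∀ x l, l ≠ i → res (f x) l = - res x l := by
    intro x l h
    simp [f, res, h]
  have rfi : ∀ x, res (f x) i = res x i := by
    intro x
    simp [f, res]
  have rg : ∀ x l, res (g x) l = res x (e l) := fun x l => rfl
  have hne : ∀ {x : Point L} {α β γ : Fin 3}, (if (x + unit L α + unit L β) i = -1 then (-1 : ℤˣ)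
      else 1) * (if (x - unit L α - unit L β) i = -1 then -1 else 1) = -1 →
      α ≠ γ → β ≠ γ → γ ≠ i := by
    intro x α β γ h hα hβ hi
    subst hi
    simp only [Pi.add_apply, Pi.sub_apply, unit_ne hα.symm, unit_ne hβ.symm, add_zero, sub_zero,
      Int.units_mul_self] at h
    exact absurd h (by decide)
  have hneg : ∀ {x : Point L} {α β γ : Fin 3}, IsVtx x α β γ → IsVtx (f x) α β γ := by
    intro x α β γ h
    have key : ∀ l, res (f x) l = res x l ∨ res (f x) l = - res x l := by
      intro l
      by_cases h : l = i
      · left; rw [h]; exact rfi x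
      · right; exact rf x l h
    refine ⟨h.ab, h.ac, h.bc, ?_, ?_⟩
    · rcases h.even with e | e <;> rcases key α with u | u <;> rcases key β with w | w <;>
        simp only [u, w, e.1, e.2] <;> decide
    · rcases h.odd with e | e <;> rcases key γ with u | u <;> simp only [u, e] <;> decide
  have ug : ∀ l, unit L (e l) i = unit L l i := by
    intro l
    by_cases h : i = e l
    · have : i = l := by rw [← hei, h, hee]
      rw [← h, ← this]
    · rw [unit_ne h, unit_ne fun h' => h (by rw [← h', hei])]
  have fi : ∀ x, f x i = x i := fun x => if_pos rfl
  have gi : ∀ x, g x i = x i := fun x => congrArg x hei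
  refine four_dvd_card f g OddResOne (fun x => resRank (res x j) < resRank (res x k))
    ?_ ?_ ?_ ?_ ?_ ?_ ?_
  · intro x hx
    obtain ⟨α, β, γ, hv, h⟩ := mem_oddVertices.1 hx
    refine mem_oddVertices.2 ⟨α, β, γ, hneg hv, ?_⟩
    simp only [Pi.add_apply, Pi.sub_apply, fi] at h ⊢
    exact h
  · intro x _
    funext l
    by_cases h : l = i <;> simp [f, h]
  · intro x hx
    obtain ⟨α, β, γ, hv, h⟩ := mem_oddVertices.1 hx
    refine mem_oddVertices.2 ⟨e α, e β, e γ, hv.comp_perm e (rg x), ?_⟩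
    simp only [Pi.add_apply, Pi.sub_apply, gi, ug] at h ⊢
    exact h
  · intro x _
    funext l
    simp only [g, hee]
  · intro x hx
    obtain ⟨α, β, γ, hv, h⟩ := mem_oddVertices.1 hx
    rw [(hneg hv).oddResOne_iff, hv.oddResOne_iff, rf x γ (hne h hv.ac hv.bc)]
    rcases hv.odd with e | e <;> rw [e] <;> decide
  · intro x _
    constructor
    · rintro ⟨l, hl⟩
      exact ⟨e l, by rw [← rg, hl]⟩
    · rintro ⟨l, hl⟩
      exact ⟨e l, by rw [rg, hee, hl]⟩
  · intro x hx
    obtain ⟨α, β, γ, hv, -⟩ := mem_oddVertices.1 hx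
    simp only [rg, e, Equiv.swap_apply_left, Equiv.swap_apply_right]
    exact hv.resRank_lt hjk.symm

theorem cellAbove_hexagon_apply (h : Hexagon L) (i : Fin 3) :
    (cellAbove (Sum.inr h)).1 i = h.1 i + ((normal (Sum.inr h) i : ℤ) : ZMod (4 * L)) := by
  simp [cellAbove, center]

theorem cellBelow_hexagon_apply (h : Hexagon L) (i : Fin 3) :
    (cellBelow (Sum.inr h)).1 i = h.1 i - ((normal (Sum.inr h) i : ℤ) : ZMod (4 * L)) := by
  simp [cellBelow, center, sub_eq_add_neg]

theorem res_cellAbove_hexagon (h : Hexagon L) (i : Fin 3) :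
    res (cellAbove (Sum.inr h)).1 i = 2 := by
  have : res (cellAbove (Sum.inr h)).1 i = res h.1 i + ((normal (Sum.inr h) i : ℤ) : ZMod 4) := by
    rw [res, cellAbove_hexagon_apply, map_add, map_intCast]; rfl
  rw [this]
  rcases normal_hexagon h i with ⟨a, b⟩ | ⟨a, b⟩ <;> rw [a, b] <;> decide

theorem res_cellBelow_hexagon (h : Hexagon L) (i : Fin 3) :
    res (cellBelow (Sum.inr h)).1 i = 0 := by
  have : res (cellBelow (Sum.inr h)).1 i = res h.1 i - ((normal (Sum.inr h) i : ℤ) : ZMod 4) := by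
    rw [res, cellBelow_hexagon_apply, map_sub, map_intCast]; rfl
  rw [this]
  rcases normal_hexagon h i with ⟨a, b⟩ | ⟨a, b⟩ <;> rw [a, b] <;> decide

theorem end_hexagon_iff (h : Hexagon L) (c : Cell L) :
    (cellAbove (Sum.inr h) = c ∨ cellBelow (Sum.inr h) = c) ↔
      ∀ i, h.1 i = c.1 i + 1 ∨ h.1 i = c.1 i - 1 := by
  constructor
  · rintro (rfl | rfl) i
    · rw [cellAbove_hexagon_apply]
      rcases normal_hexagon h i with ⟨a, -⟩ | ⟨a, -⟩ <;> rw [a] <;> simp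
    · rw [cellBelow_hexagon_apply]
      rcases normal_hexagon h i with ⟨a, -⟩ | ⟨a, -⟩ <;> rw [a] <;> simp
  · intro hc
    have hr : ∀ i, (h.1 i = c.1 i + 1 ∧ res h.1 i = res c.1 i + 1) ∨
        (h.1 i = c.1 i - 1 ∧ res h.1 i = res c.1 i - 1) := by
      intro i
      rcases hc i with e | e
      · left; exact ⟨e, by rw [res, e, map_add, map_one]; rfl⟩
      · right; exact ⟨e, by rw [res, e, map_sub, map_one]; rfl⟩
    rcases c.2 with h0 | h0
    · right
      refine Subtype.ext (funext fun i => ?_)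
      rw [cellBelow_hexagon_apply]
      rcases hr i with ⟨e1, e2⟩ | ⟨e1, e2⟩ <;> rw [h0 i] at e2 <;>
      rcases normal_hexagon h i with ⟨a, b⟩ | ⟨a, b⟩ <;> rw [a, e1] <;> rw [b] at e2
      · simp
      · exact absurd e2 (by decide)
      · exact absurd e2 (by decide)
      · simp
    · left
      refine Subtype.ext (funext fun i => ?_)
      rw [cellAbove_hexagon_apply]
      rcases hr i with ⟨e1, e2⟩ | ⟨e1, e2⟩ <;> rw [h0 i] at e2 <;>
      rcases normal_hexagon h i with ⟨a, b⟩ | ⟨a, b⟩ <;> rw [a, e1] <;> rw [b] at e2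
      · exact absurd e2 (by decide)
      · simp
      · simp
      · exact absurd e2 (by decide)

theorem cellAbove_ne_cellBelow_hexagon (h : Hexagon L) :
    cellAbove (Sum.inr h) ≠ cellBelow (Sum.inr h) := by
  intro e
  have h1 := res_cellAbove_hexagon h 0
  rw [e, res_cellBelow_hexagon] at h1
  exact absurd h1 (by decide)

theorem wraps_hexagon_iff (h : Hexagon L) (i : Fin 3) :
    Wraps (Sum.inr h) i ↔ h.1 i = -1 := by
  have hL := NeZero.pos L
  have hn : (normal (Sum.inr h) i).natAbs = 1 := by
    rcases normal_hexagon h i with ⟨a, -⟩ | ⟨a, -⟩ <;> rw [a] <;> rfl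
  have h0 : (h.1 i).val ≠ 0 := by
    intro h0
    rw [ZMod.val_eq_zero] at h0
    have : res h.1 i = 0 := by rw [res, h0, map_zero]
    exact odd_ne_even (h.2 i) (Or.inl this)
  have hlt := ZMod.val_lt (h.1 i)
  rw [Wraps, hn]
  simp only [center]
  constructor
  · intro hw
    have h1 : (h.1 i).val + 1 = 4 * L := by omega
    have h2 : (((h.1 i).val + 1 : ℕ) : ZMod (4 * L)) = 0 := by rw [h1]; exact ZMod.natCast_self _
    rw [Nat.cast_add, ZMod.natCast_zmod_val, Nat.cast_one] at h2
    exact eq_neg_of_add_eq_zero_left h2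
  · intro hw
    right
    have h2 : (((h.1 i).val + 1 : ℕ) : ZMod (4 * L)) = 0 := by
      rw [Nat.cast_add, ZMod.natCast_zmod_val, hw]; simp
    exact Nat.le_of_dvd (by omega) ((ZMod.natCast_eq_zero_iff _ _).1 h2)

theorem extend_hexagon (a : Plaquette L → ℤˣ) (h : Hexagon L) :
    extend a h.1 = a (Sum.inr h) := extend_center a (Sum.inr h)

theorem stringPhase_twist_star (c : Cell L) (u : ℤˣ) :
    stringPhase (fun (v : Vertex L) p => OnPlaquette v p) kind
      (twist L (Pi.mulSingle c u, 1, 1)) = 1 := by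
  classical
  refine stringPhase_eq_one (twist_mem _) ?_
  rcases Int.units_eq_one_or u with rfl | rfl
  · have : oddVertices (extend (twist L (Pi.mulSingle c 1, 1, 1))) = ∅ := by
      ext x
      simp only [mem_oddVertices, Pi.mulSingle_one, Finset.notMem_empty, iff_false]
      rintro ⟨α, β, γ, -, h⟩
      have h1 : twist L (1, 1, 1) = 1 := map_one _
      rw [h1] at h
      exact absurd h (by simp [extend])
    rw [this]
    exact dvd_zero _
  · convert four_dvd_card_star c using 2
    refine oddVertices_congr fun x hx => ?_
    have h1 := extend_hexagon (twist L (Pi.mulSingle c (-1), 1, 1)) ⟨x, hx⟩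
    rw [h1, ← if_congr (end_hexagon_iff ⟨x, hx⟩ c) rfl rfl, twist_apply, squareSign_one]
    have h2 := cellAbove_ne_cellBelow_hexagon (⟨x, hx⟩ : Hexagon L)
    have h3 : bondSign (1 : Fin 3 → ℤˣ) (Sum.inr (⟨x, hx⟩ : Hexagon L)) = 1 := by simp [bondSign]
    simp only [h3, one_mul]
    by_cases e1 : cellAbove (Sum.inr ⟨x, hx⟩) = c
    · have e2 : cellBelow (Sum.inr ⟨x, hx⟩) ≠ c := fun e => h2 (e1.trans e.symm)
      simp [e1, e2, Pi.mulSingle_eq_same]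
    · by_cases e2 : cellBelow (Sum.inr ⟨x, hx⟩) = c
      · simp [e1, e2, Pi.mulSingle_eq_same]
      · simp [e1, e2]

theorem stringPhase_twist_plane (i : Fin 3) (u : ℤˣ) :
    stringPhase (fun (v : Vertex L) p => OnPlaquette v p) kind
      (twist L (1, Pi.mulSingle i u, 1)) = 1 := by
  classical
  refine stringPhase_eq_one (twist_mem _) ?_
  rcases Int.units_eq_one_or u with rfl | rfl
  · have : oddVertices (extend (twist L (1, Pi.mulSingle i 1, 1))) = ∅ := by
      ext x
      simp only [mem_oddVertices, Pi.mulSingle_one, Finset.notMem_empty, iff_false]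
      rintro ⟨α, β, γ, -, h⟩
      have h1 : twist L (1, 1, 1) = 1 := map_one _
      rw [h1] at h
      exact absurd h (by simp [extend])
    rw [this]
    exact dvd_zero _
  · convert four_dvd_card_plane (L := L) i using 2
    refine oddVertices_congr fun x hx => ?_
    have h1 := extend_hexagon (twist L (1, Pi.mulSingle i (-1), 1)) ⟨x, hx⟩
    rw [h1, ← if_congr (wraps_hexagon_iff ⟨x, hx⟩ i) rfl rfl, twist_apply, squareSign_one]
    simp only [Pi.one_apply, mul_one, one_mul, bondSign]
    rw [Finset.prod_eq_single i]
    · rw [Pi.mulSingle_eq_same]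
    · intro j _ hj
      rw [Pi.mulSingle_eq_of_ne hj, ite_self]
    · simp

theorem stringPhase_twist_square (u : ℤˣ) :
    stringPhase (fun (v : Vertex L) p => OnPlaquette v p) kind
      (twist L (1, 1, u)) = 1 := by
  refine stringPhase_eq_one (twist_mem _) ?_
  have : oddVertices (extend (twist L (1, 1, u))) = oddVertices 1 := by
    refine oddVertices_congr fun x hx => ?_
    have h1 := extend_hexagon (twist L (1, 1, u)) ⟨x, hx⟩
    rw [h1, twist_apply]
    simp [squareSign, bondSign]
  rw [this]
  have : oddVertices (1 : Point L → ℤˣ) = ∅ := by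
    ext x
    simp only [mem_oddVertices, Finset.notMem_empty, iff_false]
    rintro ⟨α, β, γ, -, h⟩
    exact absurd h (by simp)
  rw [this]
  exact dvd_zero _

theorem stringPhase_of_mem {a : Plaquette L → ℤˣ} (ha : a ∈ plaquetteKernel L) :
    stringPhase (fun (v : Vertex L) p => OnPlaquette v p) kind a = 1 := by
  obtain ⟨⟨σ, s, η⟩, rfl⟩ := exists_twist ha
  have hone : stringPhase (fun (v : Vertex L) p => OnPlaquette v p) kind
      (1 : Plaquette L → ℤˣ) = 1 := by
    have := stringPhase_twist_square (L := L) 1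
    rwa [show twist L (1, 1, 1) = 1 from map_one _] at this
  let φ : (Cell L → ℤˣ) × (Fin 3 → ℤˣ) × ℤˣ →* ℂ :=
    { toFun := fun g => stringPhase (fun (v : Vertex L) p => OnPlaquette v p) kind (twist L g)
      map_one' := by rw [map_one, hone]
      map_mul' := fun g h => by
        rw [map_mul]
        exact stringPhase_mul _ _ evenOverlap_onPlaquette (twist_mem g) (twist_mem h) }
  have h1 : φ.comp (MonoidHom.inl (Cell L → ℤˣ) ((Fin 3 → ℤˣ) × ℤˣ)) = 1 :=
    MonoidHom.functions_ext _ _ _ fun c u => stringPhase_twist_star c u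
  have h2 : (φ.comp (MonoidHom.inr (Cell L → ℤˣ) ((Fin 3 → ℤˣ) × ℤˣ))).comp
      (MonoidHom.inl (Fin 3 → ℤˣ) ℤˣ) = 1 :=
    MonoidHom.functions_ext _ _ _ fun i u => stringPhase_twist_plane i u
  have h3 : (σ, s, η) = (σ, 1, 1) * ((1, s, 1) * (1, 1, η)) := by simp
  change φ (σ, s, η) = 1
  rw [h3, map_mul, map_mul]
  have e1 : φ (σ, 1, 1) = 1 := DFunLike.congr_fun h1 σ
  have e2 : φ (1, s, 1) = 1 := DFunLike.congr_fun h2 s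
  have e3 : φ (1, 1, η) = 1 := stringPhase_twist_square η
  rw [e1, e2, e3, one_mul, one_mul]

open Classical in
/-- The partition function as a sum over the sets of plaquettes whose product is scalar. -/
theorem partitionFunction_eq (β : ℝ) (g : Plaquette L → ℝ) :
    partitionFunction L β g = 2 ^ Fintype.card (Vertex L) *
      ∑ a : Plaquette L → ℤˣ, if a ∈ plaquetteKernel L then
        ∏ p, (if a p = 1 then Real.cosh (β * g p) else Real.sinh (β * g p)) else 0 := by
  have h1 : -(β : ℂ) • hamiltonian L g = ∑ p, ((β * g p : ℝ) : ℂ) •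
      pauliString (fun (v : Vertex L) p => OnPlaquette v p) kind p := by
    rw [hamiltonian, neg_smul, smul_neg, neg_neg, Finset.smul_sum]
    refine Finset.sum_congr rfl fun p _ => ?_
    rw [smul_smul, ← Complex.ofReal_mul]
    congr 1
    simp only [plaquetteOp, pauliString, plaquettePauli_eq]
  have h2 := trace_exp_eq L β g
  rw [h1, trace_exp_sum_pauliString _ _ evenOverlap_onPlaquette] at h2
  have h3 : ∀ a : Plaquette L → ℤˣ, (if a ∈ scalarKernel (fun (v : Vertex L) p => OnPlaquette v p) kind
      then stringPhase (fun (v : Vertex L) p => OnPlaquette v p) kind a *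
        ∏ p, (if a p = 1 then Complex.cosh ((β * g p : ℝ) : ℂ)
          else Complex.sinh ((β * g p : ℝ) : ℂ)) else 0) =
      ((if a ∈ plaquetteKernel L then
        ∏ p, (if a p = 1 then Real.cosh (β * g p) else Real.sinh (β * g p)) else 0 : ℝ) : ℂ) := by
    intro a
    by_cases ha : a ∈ plaquetteKernel L
    · have ha' : a ∈ scalarKernel (fun (v : Vertex L) p => OnPlaquette v p) kind := ha
      rw [if_pos ha, if_pos ha', stringPhase_of_mem ha, one_mul, Complex.ofReal_prod]
      refine Finset.prod_congr rfl fun p _ => ?_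
      split_ifs <;> simp
    · have ha' : a ∉ scalarKernel (fun (v : Vertex L) p => OnPlaquette v p) kind := ha
      rw [if_neg ha, if_neg ha', Complex.ofReal_zero]
  simp only [h3] at h2
  rw [← Complex.ofReal_sum] at h2
  refine Complex.ofReal_injective (h2.trans ?_)
  push_cast
  congr!

end Phase

/-! ### Counting cells -/

section Counting

variable {L : ℕ} [NeZero L]

omit [NeZero L] in
theorem res_surjective : Function.Surjective (res : Point L → Fin 3 → ZMod 4) := by
  intro r
  choose y hy using fun i => ZMod.castHom_surjective (Dvd.intro L rfl : 4 ∣ 4 * L) (r i)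
  exact ⟨y, funext hy⟩

open Classical in
theorem card_res_fiber (r : Fin 3 → ZMod 4) :
    (Finset.univ.filter fun x : Point L => res x = r).card = L ^ 3 := by
  let φ : Point L →+ (Fin 3 → ZMod 4) :=
    { toFun := res, map_zero' := by funext i; simp [res]
      map_add' := fun x y => by funext i; exact res_add x y i }
  have hs : Function.Surjective φ := res_surjective
  have h1 : ∀ r', (Finset.univ.filter fun x : Point L => res x = r').card =
      (Finset.univ.filter fun x : Point L => res x = r).card := fun r' =>
    AddMonoidHom.card_fiber_eq_of_mem_range φ (hs r') (hs r)
  have h2 := Finset.card_eq_sum_card_fiberwise (f := (res : Point L → Fin 3 → ZMod 4))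
    (s := Finset.univ) (t := Finset.univ) (fun _ _ => Finset.mem_univ _)
  simp only [h1, Finset.sum_const, Finset.card_univ, Fintype.card_fun, ZMod.card, Fintype.card_fin,
    smul_eq_mul] at h2
  have h3 : (4 * L) ^ 3 = 4 ^ 3 * L ^ 3 := by ring
  rw [h3] at h2
  exact (Nat.eq_of_mul_eq_mul_left (by norm_num) h2).symm

theorem card_filter_res {ι : Type*} [Fintype ι] [DecidableEq ι] (S : Finset (ι × (Fin 3 → ZMod 4))) :
    (Finset.univ.filter fun q : ι × Point L => (q.1, res q.2) ∈ S).card = S.card * L ^ 3 := by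
  have hm : Set.MapsTo (fun q : ι × Point L => (q.1, res q.2))
      (Finset.univ.filter fun q : ι × Point L => (q.1, res q.2) ∈ S : Finset _) S :=
    fun q hq => (Finset.mem_filter.1 hq).2
  rw [Finset.card_eq_sum_card_fiberwise hm, Finset.sum_const_nat]
  rintro ⟨i, r⟩ hir
  classical
  rw [← card_res_fiber (L := L) r]
  refine Finset.card_bij (fun q _ => q.2) ?_ ?_ ?_
  · intro q hq
    simp only [Finset.mem_filter, Finset.mem_univ, true_and, Prod.mk.injEq] at hq ⊢
    exact hq.2.2
  · intro q hq q' hq' h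
    simp only [Finset.mem_filter, Finset.mem_univ, true_and, Prod.mk.injEq] at hq hq'
    exact Prod.ext (hq.2.1.trans hq'.2.1.symm) h
  · intro x hx
    simp only [Finset.mem_filter, Finset.mem_univ, true_and] at hx
    refine ⟨(i, x), ?_, rfl⟩
    simp only [Finset.mem_filter, Finset.mem_univ, true_and, hx]
    exact ⟨hir, trivial⟩

theorem card_subtype_res {T : Type*} [Fintype T] (P : (Fin 3 → ZMod 4) → Prop) [DecidablePred P]
    (f : T → Point L) (hf : Function.Injective f) (hP : ∀ x, (∃ t, f t = x) ↔ P (res x)) :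
    Fintype.card T = (Finset.univ.filter P).card * L ^ 3 := by
  have h := card_filter_res (L := L) (ι := Unit)
    ((Finset.univ.filter P).map ⟨fun r => ((), r), fun _ _ h => (Prod.ext_iff.1 h).2⟩)
  have hm : ∀ x : Point L, ((), res x) ∈ (Finset.univ.filter P).map
      ⟨fun r => ((), r), fun _ _ h => (Prod.ext_iff.1 h).2⟩ ↔ P (res x) := by
    intro x
    rw [Finset.mem_map]
    constructor
    · rintro ⟨r, hr, e⟩
      have e2 : r = res x := (Prod.ext_iff.1 e).2
      rw [← e2]
      exact (Finset.mem_filter.1 hr).2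
    · exact fun h => ⟨_, Finset.mem_filter.2 ⟨Finset.mem_univ _, h⟩, rfl⟩
  rw [Finset.card_map] at h
  rw [← h, ← Finset.card_univ]
  refine Finset.card_bij (fun t _ => ((), f t)) ?_ ?_ ?_
  · intro t _
    exact Finset.mem_filter.2 ⟨Finset.mem_univ _, (hm _).2 ((hP _).1 ⟨t, rfl⟩)⟩
  · exact fun t _ t' _ h => hf (Prod.ext_iff.1 h).2
  · rintro ⟨u, x⟩ hx
    obtain ⟨t, rfl⟩ := (hP x).2 ((hm x).1 (Finset.mem_filter.1 hx).2)
    exact ⟨t, Finset.mem_univ _, rfl⟩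

theorem card_vertex : Fintype.card (Vertex L) = 12 * L ^ 3 := by
  rw [card_subtype_res (fun r : Fin 3 → ZMod 4 => ∃ α β γ : Fin 3, α ≠ β ∧ α ≠ γ ∧ β ≠ γ ∧
    r α = 0 ∧ r β = 2 ∧ (r γ = 1 ∨ r γ = 3)) (fun v : Vertex L => v.1) Subtype.val_injective]
  · congr 1
  · intro x
    constructor
    · rintro ⟨⟨v, π, h0, h1, h2⟩, rfl⟩
      exact ⟨π 0, π 1, π 2, by simp, by simp, by simp, h0, h1, h2⟩
    · rintro ⟨α, β, γ, h1, h2, h3, h4, h5, h6⟩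
      exact IsVtx.exists_vertex (α := α) (β := β) (γ := γ) ⟨h1, h2, h3, Or.inl ⟨h4, h5⟩, h6⟩

theorem card_cell : Fintype.card (Cell L) = 2 * L ^ 3 := by
  rw [card_subtype_res (fun r : Fin 3 → ZMod 4 => (∀ i, r i = 0) ∨ ∀ i, r i = 2)
    (fun v : Cell L => v.1) Subtype.val_injective]
  · congr 1
  · intro x
    constructor
    · rintro ⟨⟨v, h⟩, rfl⟩
      exact h
    · intro h
      exact ⟨⟨x, h⟩, rfl⟩

theorem card_hexagon : Fintype.card (Hexagon L) = 8 * L ^ 3 := by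
  rw [card_subtype_res (fun r : Fin 3 → ZMod 4 => ∀ i, r i = 1 ∨ r i = 3)
    (fun v : Hexagon L => v.1) Subtype.val_injective]
  · congr 1
  · intro x
    constructor
    · rintro ⟨⟨v, h⟩, rfl⟩
      exact h
    · intro h
      exact ⟨⟨x, h⟩, rfl⟩

theorem card_square : Fintype.card (Square L) = 6 * L ^ 3 := by
  classical
  have h := card_filter_res (L := L) (Finset.univ.filter fun q : Fin 3 × (Fin 3 → ZMod 4) =>
    (q.2 q.1 = 0 ∨ q.2 q.1 = 2) ∧ ∀ j, j ≠ q.1 → q.2 j = q.2 q.1 + 2)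
  have h6 : (Finset.univ.filter fun q : Fin 3 × (Fin 3 → ZMod 4) =>
    (q.2 q.1 = 0 ∨ q.2 q.1 = 2) ∧ ∀ j, j ≠ q.1 → q.2 j = q.2 q.1 + 2).card = 6 := by decide
  rw [← h6]
  rw [show (Finset.univ.filter fun q : Fin 3 × (Fin 3 → ZMod 4) =>
    (q.2 q.1 = 0 ∨ q.2 q.1 = 2) ∧ ∀ j, j ≠ q.1 → q.2 j = q.2 q.1 + 2).card * L ^ 3 = _ from h.symm,
    ← Finset.card_univ]
  refine Finset.card_bij (fun q _ => q.1) ?_ (fun q _ q' _ h => Subtype.ext h) ?_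
  · intro q _
    simpa using q.2
  · intro q hq
    exact ⟨⟨q, by simpa using hq⟩, Finset.mem_univ _, rfl⟩

theorem card_plaquette : Fintype.card (Plaquette L) = 14 * L ^ 3 := by
  rw [Fintype.card_sum, card_square, card_hexagon]; ring

end Counting

/-! ### The duality -/

section Duality

variable (L : ℕ) [NeZero L]

/-- Ising spins, boundary conditions, and a sign on the squares. -/
abbrev TwistGroup : Type := (Cell L → ℤˣ) × (Fin 3 → ℤˣ) × ℤˣ

variable {L}

/-- The sign of a bond as a character. -/
noncomputable def bondChar (p : Plaquette L) : TwistGroup L →* ℤˣ :=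
  (Pi.evalMonoidHom _ p).comp (twist L)

theorem bondChar_apply (p : Plaquette L) (g : TwistGroup L) : bondChar p g = twist L g p := rfl

theorem tanh_pos {x : ℝ} (hx : 0 < x) : 0 < Real.tanh x := by
  rw [Real.tanh_eq_sinh_div_cosh]
  exact div_pos (Real.sinh_pos_iff.2 hx) (Real.cosh_pos x)

theorem exp_dualCoupling_sq {x : ℝ} (hx : 0 < x) :
    Real.exp (dualCoupling x) ^ 2 = Real.cosh x / Real.sinh x := by
  rw [← Real.exp_nat_mul, dualCoupling]
  have : ((2 : ℕ) : ℝ) * (-(1 / 2) * Real.log (Real.tanh x)) = Real.log (Real.tanh x)⁻¹ := by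
    rw [Real.log_inv]; push_cast; ring
  rw [this, Real.exp_log (inv_pos.2 (tanh_pos hx)), Real.tanh_eq_sinh_div_cosh, inv_div]

theorem dualCoupling_pos {x : ℝ} (hx : 0 < x) : 0 < dualCoupling x := by
  rw [dualCoupling]
  have := Real.log_neg (tanh_pos hx) (Real.tanh_lt_one x)
  linarith

theorem cosh_or_sinh_eq {x : ℝ} (hx : 0 < x) (u : ℤˣ) :
    (if u = 1 then Real.cosh x else Real.sinh x) =
      √(Real.sinh (2 * x) / 2) * Real.exp (dualCoupling x * ((u : ℤ) : ℝ)) := by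
  have hs := Real.sinh_pos_iff.2 hx
  have hc := Real.cosh_pos x
  have hsq := exp_dualCoupling_sq hx
  have hE := Real.exp_pos (dualCoupling x)
  have h2 : Real.sinh (2 * x) / 2 = Real.cosh x * Real.sinh x := by
    rw [Real.sinh_two_mul]; ring
  have hr : √(Real.sinh (2 * x) / 2) ^ 2 = Real.cosh x * Real.sinh x := by
    rw [Real.sq_sqrt (by rw [h2]; positivity), h2]
  have hr0 : 0 ≤ √(Real.sinh (2 * x) / 2) := Real.sqrt_nonneg _
  rcases Int.units_eq_one_or u with rfl | rfl
  · simp only [if_true, Units.val_one, Int.cast_one, mul_one]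
    refine (pow_left_inj₀ hc.le (by positivity) two_ne_zero).1 ?_
    rw [mul_pow, hr, hsq]
    field_simp
  · simp only [show (-1 : ℤˣ) ≠ 1 by decide, if_false, Units.val_neg, Units.val_one, Int.cast_neg,
      Int.cast_one, mul_neg, mul_one, Real.exp_neg]
    refine (pow_left_inj₀ hs.le (by positivity) two_ne_zero).1 ?_
    rw [mul_pow, hr, inv_pow, hsq]
    field_simp

/-- The product of the bonds crossed by the defect line. -/
noncomputable def lineChar (L : ℕ) [NeZero L] (m : ℕ) : TwistGroup L →* ℤˣ :=
  open Classical in ∏ p : Plaquette L, if OnDefectLine m p then bondChar p else 1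

open Classical in
theorem lineChar_apply (m : ℕ) (g : TwistGroup L) :
    lineChar L m g = ∏ p : Plaquette L, if OnDefectLine m p then twist L g p else 1 := by
  rw [lineChar, MonoidHom.finsetProd_apply]
  refine Finset.prod_congr rfl fun p _ => ?_
  split_ifs <;> rfl

theorem partitionFunction_defect (m : ℕ) {β J : ℝ} (hx : 0 < β * J) :
    partitionFunction L β (defectCoupling m J) = dualityConstant L (β * J) *
      ∑ g : TwistGroup L, ((lineChar L m g : ℤ) : ℝ) *
        Real.exp (∑ p, dualCoupling (β * J) * ((bondChar p g : ℤ) : ℝ)) := by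
  classical
  set x := β * J with hxdef
  set A := √(Real.sinh (2 * x) / 2) with hA
  have hA2 : A ^ 2 = Real.sinh (2 * x) / 2 :=
    Real.sq_sqrt (div_nonneg (Real.sinh_nonneg_iff.2 (by linarith)) (by norm_num))
  have hterm : ∀ (a : Plaquette L → ℤˣ) (p : Plaquette L),
      (if a p = 1 then Real.cosh (β * defectCoupling m J p)
        else Real.sinh (β * defectCoupling m J p)) =
      (((if OnDefectLine m p then a p else 1 : ℤˣ) : ℤ) : ℝ) *
        (A * Real.exp (dualCoupling x * ((a p : ℤ) : ℝ))) := by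
    intro a p
    rw [← cosh_or_sinh_eq hx, defectCoupling]
    by_cases h : OnDefectLine m p
    · rw [if_pos h, if_pos h, mul_neg, Real.cosh_neg, Real.sinh_neg, ← hxdef]
      rcases Int.units_eq_one_or (a p) with e | e <;> simp [e]
    · rw [if_neg h, if_neg h, ← hxdef]
      simp
  have hsum := sum_twist (L := L) fun a =>
    ((∏ p, (if OnDefectLine m p then a p else 1) : ℤˣ) : ℤ) *
      Real.exp (∑ p, dualCoupling x * ((a p : ℤ) : ℝ))
  have hL : 1 ≤ 12 * L ^ 3 := by
    have := pow_pos (NeZero.pos L) 3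
    omega
  rw [partitionFunction_eq, card_vertex, dualityConstant]
  simp only [bondChar_apply, lineChar_apply]
  rw [hsum]
  have h1 : ∀ a : Plaquette L → ℤˣ, ∏ p, (if a p = 1 then Real.cosh (β * defectCoupling m J p)
        else Real.sinh (β * defectCoupling m J p)) = (Real.sinh (2 * x) / 2) ^ (7 * L ^ 3) *
      ((((∏ p, (if OnDefectLine m p then a p else 1) : ℤˣ) : ℤ) : ℝ) *
      Real.exp (∑ p, dualCoupling x * ((a p : ℤ) : ℝ))) := by
    intro a
    simp only [hterm, Finset.prod_mul_distrib, Finset.prod_const, Finset.card_univ, card_plaquette,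
      Real.exp_sum]
    rw [← hA2, ← pow_mul, show 2 * (7 * L ^ 3) = 14 * L ^ 3 by ring]
    push_cast
    ring
  simp only [h1]
  simp only [← mul_ite_zero, ← Finset.mul_sum]
  rw [← pow_sub_mul_pow 2 hL]
  ring

theorem partitionFunction_const {β J : ℝ} (hx : 0 < β * J) :
    partitionFunction L β (fun _ => J) = dualityConstant L (β * J) *
      ∑ g : TwistGroup L, Real.exp (∑ p, dualCoupling (β * J) * ((bondChar p g : ℤ) : ℝ)) := by
  classical
  have h0 : ∀ p : Plaquette L, ¬ OnDefectLine 0 p := by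
    rintro (q | h) <;> simp [OnDefectLine]
  have h1 : (fun _ : Plaquette L => J) = defectCoupling 0 J := by
    funext p
    rw [defectCoupling, if_neg (h0 p)]
  rw [h1, partitionFunction_defect 0 hx]
  congr 1
  refine Finset.sum_congr rfl fun g _ => ?_
  rw [lineChar_apply]
  simp [h0]

/-- The partition function of the Ising model with an additional sign `η` on the squares. -/
noncomputable def isingSigned (L : ℕ) [NeZero L] (s : Fin 3 → ℤˣ) (η : ℤˣ) (K : ℝ) : ℝ :=
  ∑ σ : Cell L → ℤˣ, Real.exp (∑ p, K * ((twist L (σ, s, η) p : ℤ) : ℝ))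

theorem isingSigned_one (s : Fin 3 → ℤˣ) (K : ℝ) : isingSigned L s 1 K = isingTwisted L s K := by
  simp only [isingSigned, isingTwisted, twist_apply, squareSign_one, one_mul, Finset.mul_sum]

theorem sum_twistGroup (f : TwistGroup L → ℝ) :
    ∑ g, f g = ∑ s, ((∑ σ, f (σ, s, 1)) + ∑ σ, f (σ, s, -1)) := by
  rw [Fintype.sum_prod_type_right, Fintype.sum_prod_type]
  refine Finset.sum_congr rfl fun s _ => ?_
  rw [show (Finset.univ : Finset ℤˣ) = {1, -1} from rfl, Finset.sum_pair (by decide)]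

theorem sum_exp_bondChar (K : ℝ) :
    ∑ g : TwistGroup L, Real.exp (∑ p, K * ((bondChar p g : ℤ) : ℝ)) =
      ∑ s, (isingSigned L s 1 K + isingSigned L s (-1) K) := by
  rw [sum_twistGroup]; rfl

/-- The character of the bond of a plaquette on the Ising spins. -/
noncomputable def spinChar (p : Plaquette L) : (Cell L → ℤˣ) →* ℤˣ where
  toFun σ := σ (cellAbove p) * σ (cellBelow p)
  map_one' := by simp
  map_mul' σ τ := by simp only [Pi.mul_apply]; ac_rfl

theorem isingSigned_eq_prod (s : Fin 3 → ℤˣ) (η : ℤˣ) (K : ℝ) : isingSigned L s η K =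
    ∑ σ, ∏ p : Plaquette L, Real.exp (K * ((squareSign η p * bondSign s p * spinChar p σ : ℤˣ) : ℤ)) := by
  simp only [isingSigned, Real.exp_sum]
  refine Finset.sum_congr rfl fun σ _ => Finset.prod_congr rfl fun p _ => ?_
  rw [twist_apply]
  have : ∀ u v w z : ℤˣ, u * (v * w * z) = u * v * (w * z) := by decide
  rw [this]
  rfl

theorem isingPartition_eq_prod (K : ℝ) : isingPartition L K =
    ∑ σ, ∏ p : Plaquette L, Real.exp (K * ((spinChar p σ : ℤˣ) : ℤ)) := by
  have : isingPartition L K = isingTwisted L 1 K := rfl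
  rw [this, ← isingSigned_one, isingSigned_eq_prod]
  have h : ∀ p : Plaquette L, bondSign 1 p = 1 := fun p => by simp [bondSign]
  simp only [squareSign_one, h, one_mul]

theorem isingSigned_pos (s : Fin 3 → ℤˣ) (η : ℤˣ) (K : ℝ) : 0 < isingSigned L s η K :=
  Finset.sum_pos (fun _ _ => Real.exp_pos _) ⟨1, Finset.mem_univ _⟩

theorem isingPartition_pos (K : ℝ) : 0 < isingPartition L K := by
  have : isingPartition L K = isingTwisted L 1 K := rfl
  rw [this, ← isingSigned_one]
  exact isingSigned_pos _ _ _

theorem isingSigned_le (s : Fin 3 → ℤˣ) (η : ℤˣ) {K : ℝ} (hK : 0 ≤ K) :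
    isingSigned L s η K ≤ isingPartition L K := by
  rw [isingSigned_eq_prod, isingPartition_eq_prod]
  exact (le_abs_self _).trans (Dominated.abs_sum_le (.prod _ fun p _ => dominated_exp hK _ _))

omit [NeZero L] in
theorem dualityConstant_pos {x : ℝ} (hx : 0 < x) : 0 < dualityConstant L x := by
  have := Real.sinh_pos_iff.2 (show 0 < 2 * x by linarith)
  rw [dualityConstant]
  positivity

theorem card_units_fun : Fintype.card (Fin 3 → ℤˣ) = 8 := by
  rw [Fintype.card_fun, Fintype.card_fin]; rfl

theorem finite_volume_duality {β J : ℝ} (hx : 0 < β * J) :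
    dualityConstant L (β * J) * isingPartition L (dualCoupling (β * J))
        ≤ partitionFunction L β (fun _ => J) ∧
      partitionFunction L β (fun _ => J)
        ≤ 16 * (dualityConstant L (β * J) * isingPartition L (dualCoupling (β * J))) := by
  have hK := (dualCoupling_pos hx).le
  have hC := dualityConstant_pos (L := L) hx
  rw [partitionFunction_const hx, sum_exp_bondChar]
  set K := dualCoupling (β * J)
  constructor
  · refine mul_le_mul_of_nonneg_left ?_ hC.le
    calc isingPartition L K = isingSigned L 1 1 K := (isingSigned_one _ _).symm
      _ ≤ isingSigned L 1 1 K + isingSigned L 1 (-1) K :=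
        le_add_of_nonneg_right (isingSigned_pos _ _ _).le
      _ ≤ _ := Finset.single_le_sum (f := fun s => isingSigned L s 1 K + isingSigned L s (-1) K)
        (fun s _ => (add_pos (isingSigned_pos _ _ _) (isingSigned_pos _ _ _)).le)
        (Finset.mem_univ _)
  · have : ∑ s, (isingSigned L s 1 K + isingSigned L s (-1) K) ≤
        ∑ _s : Fin 3 → ℤˣ, 2 * isingPartition L K :=
      Finset.sum_le_sum fun s _ => by
        linarith [isingSigned_le (L := L) s 1 hK, isingSigned_le (L := L) s (-1) hK]
    rw [Finset.sum_const, Finset.card_univ, card_units_fun, nsmul_eq_mul] at this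
    push_cast at this
    calc _ ≤ dualityConstant L (β * J) * (8 * (2 * isingPartition L K)) :=
          mul_le_mul_of_nonneg_left this hC.le
      _ = _ := by ring

end Duality

/-! ### Suppression of the odd sector -/

section OddSector

variable {L : ℕ} [NeZero L]

/-- The centres of disjoint triangles of bonds along a line of cells. -/
def triangleCenter (L : ℕ) (i : ℕ) (j : Fin 3) : Point L :=
  ![((4 * i + (![2, 3, 1] : Fin 3 → ℕ) j : ℕ) : ZMod (4 * L)), if j = 0 then 0 else 1,
    if j = 0 then 0 else 1]

omit [NeZero L] in
theorem res_triangleCenter (i : ℕ) (j : Fin 3) : res (triangleCenter L i j) =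
    ![(((![2, 3, 1] : Fin 3 → ℕ) j : ℕ) : ZMod 4), if j = 0 then 0 else 1,
      if j = 0 then 0 else 1] := by
  have h4 : (4 : ZMod 4) = 0 := rfl
  funext l
  fin_cases l
  · change ZMod.castHom _ (ZMod 4) ((4 * i + (![2, 3, 1] : Fin 3 → ℕ) j : ℕ) : ZMod (4 * L)) = _
    rw [map_natCast, Nat.cast_add, Nat.cast_mul, Nat.cast_ofNat, h4, zero_mul, zero_add]
    rfl
  · simp [res, triangleCenter]
  · simp [res, triangleCenter]

omit [NeZero L] in
theorem exists_triangle (i : ℕ) (j : Fin 3) :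
    ∃ p : Plaquette L, center p = triangleCenter L i j := by
  have hr := res_triangleCenter (L := L) i j
  by_cases hj : j = 0
  · subst hj
    refine ⟨Sum.inl ⟨(0, triangleCenter L i 0), ?_⟩, rfl⟩
    simp only [hr]
    decide
  · refine ⟨Sum.inr ⟨triangleCenter L i j, ?_⟩, rfl⟩
    simp only [hr]
    clear hr
    revert j; decide

/-- The bonds of the triangles. -/
noncomputable def triangle (L : ℕ) (x : Fin L × Fin 3) : Plaquette L :=
  (exists_triangle (L := L) x.1 x.2).choose

omit [NeZero L] in
theorem center_triangle (x : Fin L × Fin 3) : center (triangle L x) = triangleCenter L x.1 x.2 :=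
  (exists_triangle (L := L) x.1 x.2).choose_spec

omit [NeZero L] in
theorem triangle_injective : Function.Injective (triangle L) := by
  rintro ⟨i, j⟩ ⟨i', j'⟩ h
  have h1 : triangleCenter L i j 0 = triangleCenter L i' j' 0 := by
    rw [← center_triangle (i, j), h, center_triangle]
  have hb : ∀ j : Fin 3, 1 ≤ (![2, 3, 1] : Fin 3 → ℕ) j ∧ (![2, 3, 1] : Fin 3 → ℕ) j ≤ 3 := by
    decide
  have h2 := congrArg ZMod.val h1
  simp only [triangleCenter, Matrix.cons_val_zero] at h2
  have a1 := hb j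
  have a2 := hb j'
  rw [ZMod.val_natCast_of_lt (by omega), ZMod.val_natCast_of_lt (by omega)] at h2
  have hi : i = i' := Fin.ext (by omega)
  subst hi
  have hj : (![2, 3, 1] : Fin 3 → ℕ) j = (![2, 3, 1] : Fin 3 → ℕ) j' := by omega
  have : j = j' := by
    clear h h1 h2 a1 a2
    revert j j'; decide
  rw [this]

omit [NeZero L] in
theorem isSq_triangle (i : ℕ) : IsSq (triangleCenter L i 0) 0 1 2 := by
  refine ⟨by decide, by decide, by decide, ?_, ?_, ?_⟩ <;> rw [res_triangleCenter] <;> decide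

omit [NeZero L] in
theorem unit_apply (i l : Fin 3) : unit L i l = if l = i then 1 else 0 := Pi.single_apply _ _ _

theorem curl_triangle (a : Plaquette L → ℤˣ) (i : Fin L) :
    curl (extend a) (triangleCenter L i 0) 0 1 2 1 1 =
      a (triangle L (i, 0)) * a (triangle L (i, 1)) * a (triangle L (i, 2)) := by
  have h1 : triangleCenter L i 0 + unit L 0 + unit L 1 + unit L 2 = triangleCenter L i 1 := by
    funext l
    simp only [Pi.add_apply, unit_apply]
    fin_cases l <;> simp [triangleCenter]
    ring
  have h2 : triangleCenter L i 0 - unit L 0 + unit L 1 + unit L 2 = triangleCenter L i 2 := by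
    funext l
    simp only [Pi.add_apply, Pi.sub_apply, unit_apply]
    fin_cases l <;> simp [triangleCenter]
    ring
  rw [← extend_center a (triangle L (i, 0)), ← extend_center a (triangle L (i, 1)),
    ← extend_center a (triangle L (i, 2)), center_triangle, center_triangle, center_triangle, curl]
  simp only [Units.val_one, one_smul, h1, h2]

/-- The ratio of the weights of a frustrated and an unfrustrated triangle. -/
noncomputable def frustration (K : ℝ) : ℝ := (1 - Real.tanh K ^ 3) / (1 + Real.tanh K ^ 3)

theorem frustration_nonneg {K : ℝ} (hK : 0 < K) : 0 ≤ frustration K := by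
  have h0 := tanh_pos hK
  have h1 : Real.tanh K ^ 3 ≤ 1 := pow_le_one₀ h0.le (Real.tanh_lt_one K).le
  exact div_nonneg (by linarith) (by positivity)

theorem frustration_lt_one {K : ℝ} (hK : 0 < K) : frustration K < 1 := by
  have h0 := pow_pos (tanh_pos hK) 3
  rw [frustration, div_lt_one (by linarith)]
  linarith

theorem isingSigned_neg_le (s : Fin 3 → ℤˣ) {K : ℝ} (hK : 0 ≤ K) :
    isingSigned L s (-1) K ≤ frustration K ^ L * isingPartition L K := by
  classical
  rw [isingSigned_eq_prod, isingPartition_eq_prod]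
  set u : Plaquette L → ℤˣ := fun p => squareSign (-1) p * bondSign s p with hu
  set S : Finset (Plaquette L) := Finset.univ.map ⟨triangle L, triangle_injective⟩ with hS
  have split : ∀ f : Plaquette L → ℝ, ∏ p, f p =
      (∏ i : Fin L, ∏ j : Fin 3, f (triangle L (i, j))) * ∏ p ∈ Sᶜ, f p := by
    intro f
    rw [← Finset.prod_mul_prod_compl S, hS, Finset.prod_map, Fintype.prod_prod_type]
    rfl
  have htri : ∀ i : Fin L, Dominated
      (fun σ : Cell L → ℤˣ => ∏ j : Fin 3, Real.exp (K *
        ((u (triangle L (i, j)) * spinChar (triangle L (i, j)) σ : ℤˣ) : ℤ)))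
      fun σ => frustration K *
        ∏ j : Fin 3, Real.exp (K * ((spinChar (triangle L (i, j)) σ : ℤˣ) : ℤ)) := by
    intro i
    refine dominated_triangle hK (fun j => u (triangle L (i, j))) ?_
      (fun j => spinChar (triangle L (i, j))) ?_
    · have h1 := curl_twist (isSq_triangle (L := L) i) 1 1 (1, s, -1)
      rw [curl_triangle] at h1
      simpa [twist_apply] using h1
    · refine MonoidHom.ext fun σ => ?_
      have h1 := curl_twist (isSq_triangle (L := L) i) 1 1 (σ, 1, 1)
      rw [curl_triangle] at h1
      have hb : ∀ p : Plaquette L, bondSign 1 p = 1 := fun p => by simp [bondSign]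
      simp only [twist_apply, squareSign_one, one_mul, hb] at h1
      exact h1
  have hdom : Dominated
      (fun σ : Cell L → ℤˣ => ∏ p : Plaquette L, Real.exp (K * ((u p * spinChar p σ : ℤˣ) : ℤ)))
      fun σ => frustration K ^ L *
        ∏ p : Plaquette L, Real.exp (K * ((spinChar p σ : ℤˣ) : ℤ)) := by
    simp only [split]
    have := (Dominated.prod Finset.univ fun i _ => htri i).mul
      (Dominated.prod Sᶜ fun p _ => dominated_exp hK (u p) (spinChar p))
    simp only [Finset.prod_mul_distrib, Finset.prod_const, Finset.card_univ, Fintype.card_fin,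
      mul_assoc] at this
    exact this
  refine (le_abs_self _).trans (hdom.abs_sum_le.trans_eq ?_)
  rw [← Finset.mul_sum]

theorem isingPartition_le_sum (K : ℝ) : isingPartition L K ≤ ∑ s, isingSigned L s 1 K := by
  have : isingPartition L K = isingSigned L 1 1 K := (isingSigned_one _ _).symm
  rw [this]
  exact Finset.single_le_sum (f := fun s => isingSigned L s 1 K)
    (fun s _ => (isingSigned_pos _ _ _).le) (Finset.mem_univ _)

theorem sum_isingSigned_neg_le {K : ℝ} (hK : 0 < K) :
    ∑ s, isingSigned L s (-1) K ≤ 8 * frustration K ^ L * ∑ s, isingSigned L s 1 K := by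
  calc ∑ s, isingSigned L s (-1) K
      ≤ ∑ _s : Fin 3 → ℤˣ, frustration K ^ L * isingPartition L K :=
        Finset.sum_le_sum fun s _ => isingSigned_neg_le s hK.le
    _ = 8 * frustration K ^ L * isingPartition L K := by
        rw [Finset.sum_const, Finset.card_univ, card_units_fun, nsmul_eq_mul]; push_cast; ring
    _ ≤ _ := mul_le_mul_of_nonneg_left (isingPartition_le_sum K)
        (by have := frustration_nonneg hK; positivity)

theorem tendsto_duality {β J : ℝ} (hx : 0 < β * J) :
    Tendsto (fun L : ℕ => partitionFunction (L + 1) β (fun _ => J) /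
        (dualityConstant (L + 1) (β * J) *
          ∑ s : Fin 3 → ℤˣ, isingTwisted (L + 1) s (dualCoupling (β * J))))
      atTop (𝓝 1) := by
  have hK := dualCoupling_pos hx
  set K := dualCoupling (β * J) with hKdef
  have h0 := frustration_nonneg hK
  have h1 := frustration_lt_one hK
  have hpow : Tendsto (fun L : ℕ => 1 + 8 * frustration K ^ (L + 1)) atTop (𝓝 1) := by
    have := ((tendsto_pow_atTop_nhds_zero_of_lt_one h0 h1).comp (tendsto_add_atTop_nat 1)).const_mul 8
    simpa using this.const_add 1
  have key : ∀ L : ℕ, partitionFunction (L + 1) β (fun _ => J) /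
        (dualityConstant (L + 1) (β * J) * ∑ s : Fin 3 → ℤˣ, isingTwisted (L + 1) s K) =
      1 + (∑ s, isingSigned (L + 1) s (-1) K) / ∑ s, isingSigned (L + 1) s 1 K := by
    intro L
    have hC := dualityConstant_pos (L := L + 1) hx
    have hS : 0 < ∑ s, isingSigned (L + 1) s 1 K :=
      Finset.sum_pos (fun s _ => isingSigned_pos _ _ _) Finset.univ_nonempty
    rw [partitionFunction_const hx, sum_exp_bondChar, Finset.sum_add_distrib]
    simp only [← isingSigned_one]
    rw [mul_div_mul_left _ _ hC.ne', add_div, div_self hS.ne']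
  refine tendsto_of_tendsto_of_tendsto_of_le_of_le tendsto_const_nhds hpow ?_ ?_ <;> intro L <;>
    dsimp only <;> rw [key]
  · exact le_add_of_nonneg_right (div_nonneg
      (Finset.sum_nonneg fun s _ => (isingSigned_pos _ _ _).le)
      (Finset.sum_nonneg fun s _ => (isingSigned_pos _ _ _).le))
  · gcongr
    rw [div_le_iff₀ (Finset.sum_pos (fun s _ => isingSigned_pos _ _ _) Finset.univ_nonempty)]
    exact sum_isingSigned_neg_le hK

end OddSector

/-! ### Subsystems of Ising models -/

section Subsystem

/-- The partition function of the ferromagnetic Ising model with free boundary conditions: sites `V`,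
bonds `P`, and the two ends of each bond. -/
noncomputable def graphIsing {V P : Type*} [Fintype V] [DecidableEq V] [Fintype P] (e : P → V × V)
    (K : ℝ) : ℝ :=
  ∑ σ : V → ℤˣ, ∏ p, Real.exp (K * (((σ (e p).1 * σ (e p).2 : ℤˣ) : ℤ) : ℝ))

/-- The product of two spins as a character. -/
def pairChar {V : Type*} (v w : V) : (V → ℤˣ) →* ℤˣ where
  toFun σ := σ v * σ w
  map_one' := by simp
  map_mul' σ τ := by simp only [Pi.mul_apply]; ac_rfl

theorem sum_le_sum_mul_exp {G : Type*} [CommGroup G] [Fintype G] {f : G → ℝ} (hf : PosType f)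
    {ι : Type*} (s : Finset ι) {K : ℝ} (hK : 0 ≤ K) (χ : ι → G →* ℤˣ) :
    ∑ g, f g ≤ ∑ g, f g * ∏ i ∈ s, Real.exp (K * ((χ i g : ℤ) : ℝ)) := by
  classical
  induction s using Finset.induction_on with
  | empty => simp
  | insert a s ha ih =>
    refine ih.trans ?_
    have hp : PosType fun g => f g * ∏ i ∈ s, Real.exp (K * ((χ i g : ℤ) : ℝ)) :=
      hf.mul (.prod s fun i _ => .exp_char hK _)
    have h1 : PosType fun g => (f g * ∏ i ∈ s, Real.exp (K * ((χ i g : ℤ) : ℝ))) *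
        ((Real.cosh K - 1) + Real.sinh K * ((χ a g : ℤ) : ℝ)) :=
      hp.mul (.add _ _ (.const (by linarith [Real.one_le_cosh K]))
        (.char _ (Real.sinh_nonneg_iff.2 hK) _))
    have h2 := h1.sum_nonneg
    rw [← sub_nonneg, ← Finset.sum_sub_distrib]
    refine h2.trans_eq (Finset.sum_congr rfl fun g _ => ?_)
    rw [Finset.prod_insert ha, exp_mul_sign K (χ a g)]
    ring

theorem graphIsing_pow_le {V P V' P' : Type*} [Fintype V] [DecidableEq V] [Fintype P]
    [Fintype V'] [DecidableEq V'] [Fintype P'] {e : P → V × V} {e' : P' → V' × V'}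
    {N : Type*} [Fintype N] [DecidableEq N] {K : ℝ} (hK : 0 ≤ K) (f : N × V' → V)
    (hf : Function.Injective f) (τ : N × P' → P) (hτ : Function.Injective τ)
    (hends : ∀ n p, e (τ (n, p)) = (f (n, (e' p).1), f (n, (e' p).2))) :
    graphIsing e' K ^ Fintype.card N ≤ graphIsing e K := by
  classical
  let h : (V' → ℤˣ) → ℝ := fun σ => ∏ p, Real.exp (K * (((σ (e' p).1 * σ (e' p).2 : ℤˣ) : ℤ) : ℝ))
  have h1 : graphIsing e' K ^ Fintype.card N =
      ∑ ρ : N → V' → ℤˣ, ∏ n, h (ρ n) := by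
    rw [← Fintype.piFinset_univ, ← Finset.prod_univ_sum (fun _ : N => Finset.univ) fun _ σ => h σ,
      Finset.prod_const, Finset.card_univ]
    rfl
  let ext : (N → V' → ℤˣ) → V → ℤˣ := fun ρ v =>
    if hv : ∃ x, f x = v then ρ hv.choose.1 hv.choose.2 else 1
  have hext : ∀ ρ x, ext ρ (f x) = ρ x.1 x.2 := by
    intro ρ x
    have hv : ∃ y, f y = f x := ⟨x, rfl⟩
    simp only [ext, dif_pos hv]
    rw [hf hv.choose_spec]
  have hinj : Function.Injective ext := by
    intro ρ ρ' hh
    funext n v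
    have := congrFun hh (f (n, v))
    rwa [hext, hext] at this
  let g : (V → ℤˣ) → ℝ := fun σ => ∏ x : N × P', Real.exp (K * ((pairChar (e (τ x)).1
    (e (τ x)).2 σ : ℤ) : ℝ))
  have h2 : ∑ ρ : N → V' → ℤˣ, ∏ n, h (ρ n) ≤ ∑ σ, g σ := by
    have : ∀ ρ : N → V' → ℤˣ, ∏ n, h (ρ n) = g (ext ρ) := by
      intro ρ
      simp only [h, g, Fintype.prod_prod_type]
      refine Finset.prod_congr rfl fun n _ => Finset.prod_congr rfl fun p _ => ?_
      have hp : pairChar (e (τ (n, p))).1 (e (τ (n, p))).2 (ext ρ) =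
          ext ρ (e (τ (n, p))).1 * ext ρ (e (τ (n, p))).2 := rfl
      rw [hp, hends, hext, hext]
    simp only [this]
    rw [← Finset.sum_image (f := g) (s := Finset.univ) (g := ext) (fun x _ y _ h => hinj h)]
    exact Finset.sum_le_sum_of_subset_of_nonneg (Finset.subset_univ _) fun σ _ _ =>
      Finset.prod_nonneg fun _ _ => (Real.exp_pos _).le
  have hg : PosType g := .prod _ fun x _ => .exp_char hK _
  refine h1.trans_le (h2.trans ((sum_le_sum_mul_exp hg (Finset.univ.map ⟨τ, hτ⟩)ᶜ hK
    fun p => pairChar (e p).1 (e p).2).trans_eq ?_))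
  refine Finset.sum_congr rfl fun σ _ => ?_
  rw [← Finset.prod_mul_prod_compl (Finset.univ.map ⟨τ, hτ⟩), Finset.prod_map]
  rfl

theorem graphIsing_le_restrict {V P : Type*} [Fintype V] [DecidableEq V] [Fintype P]
    (e : P → V × V) {K : ℝ} (hK : 0 ≤ K) (Q : P → Prop) [DecidablePred Q] :
    graphIsing e K ≤ Real.exp (K * (Finset.univ.filter fun p => ¬ Q p).card) *
      graphIsing (fun p : {p // Q p} => e p) K := by
  rw [graphIsing, graphIsing, Finset.mul_sum]
  refine Finset.sum_le_sum fun σ _ => ?_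
  rw [← Finset.prod_filter_mul_prod_filter_not Finset.univ Q, mul_comm]
  refine mul_le_mul ?_ (le_of_eq ?_) (Finset.prod_nonneg fun _ _ => (Real.exp_pos _).le)
    (Real.exp_pos _).le
  · rw [← Real.exp_sum, mul_comm K, ← nsmul_eq_mul, ← Finset.sum_const]
    refine Real.exp_le_exp.2 (Finset.sum_le_sum fun p _ => ?_)
    rcases Int.units_eq_one_or (σ (e p).1 * σ (e p).2) with h | h <;> rw [h] <;> simp [hK]
  · rw [← Finset.prod_subtype (Finset.univ.filter Q) (by simp)
      fun p => Real.exp (K * (((σ (e p).1 * σ (e p).2 : ℤˣ) : ℤ) : ℝ))]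

end Subsystem

/-! ### Blocks -/

section Blocks

variable {k L : ℕ} [NeZero k] [NeZero L]

/-- The two ends of a bond. -/
def bondEnds (p : Plaquette L) : Cell L × Cell L := (cellAbove p, cellBelow p)

theorem isingPartition_eq_graphIsing (K : ℝ) : isingPartition L K = graphIsing (bondEnds (L := L)) K :=
  isingPartition_eq_prod K

/-- The point of the larger torus in the block `b` that corresponds to `x`. -/
def blockPoint (L : ℕ) (b : Fin 3 → ℕ) (x : Point k) : Point L :=
  fun i => (((x i).val + 4 * k * b i : ℕ) : ZMod (4 * L))

omit [NeZero L] in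
theorem res_blockPoint (b : Fin 3 → ℕ) (x : Point k) (i : Fin 3) :
    res (blockPoint L b x) i = res x i := by
  have h4 : (4 : ZMod 4) = 0 := rfl
  have h1 : res (blockPoint L b x) i = (((x i).val + 4 * k * b i : ℕ) : ZMod 4) :=
    map_natCast _ _
  have h2 : res x i = (((x i).val : ℕ) : ZMod 4) := by
    rw [← map_natCast (ZMod.castHom (Dvd.intro k rfl : 4 ∣ 4 * k) (ZMod 4)), ZMod.natCast_zmod_val]
    rfl
  rw [h1, h2]
  push_cast
  rw [h4]; ring

omit [NeZero L] in
theorem blockPoint_injective {q : ℕ} (hq : q * k ≤ L) {b b' : Fin 3 → Fin q} {x x' : Point k}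
    (h : blockPoint L (fun i => (b i : ℕ)) x = blockPoint L (fun i => (b' i : ℕ)) x') :
    b = b' ∧ x = x' := by
  have key : ∀ i, b i = b' i ∧ x i = x' i := by
    intro i
    have hlt : ∀ (c : Fin q) (y : ZMod (4 * k)), y.val + 4 * k * (c : ℕ) < 4 * L := by
      intro c y
      have h1 := ZMod.val_lt y
      have h2 : k * ((c : ℕ) + 1) ≤ L := by
        calc k * ((c : ℕ) + 1) ≤ k * q := Nat.mul_le_mul_left _ c.2
          _ ≤ L := by rwa [mul_comm]
      nlinarith
    have h1 := congrArg ZMod.val (congrFun h i)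
    simp only [blockPoint] at h1
    rw [ZMod.val_natCast_of_lt (hlt _ _), ZMod.val_natCast_of_lt (hlt _ _)] at h1
    have h2 := ZMod.val_lt (x i)
    have h3 := ZMod.val_lt (x' i)
    have hx : (x i).val = (x' i).val := by
      have := congrArg (· % (4 * k)) h1
      simpa [Nat.add_mul_mod_self_left, Nat.mod_eq_of_lt h2, Nat.mod_eq_of_lt h3] using this
    have hb : (b i : ℕ) = b' i := by
      rw [hx] at h1
      exact Nat.eq_of_mul_eq_mul_left (show 0 < 4 * k by have := NeZero.pos k; omega)
        (Nat.add_left_cancel h1)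
    exact ⟨Fin.ext hb, ZMod.val_injective _ hx⟩
  exact ⟨funext fun i => (key i).1, funext fun i => (key i).2⟩

/-- The cell of a block. -/
def blockCell (L : ℕ) (b : Fin 3 → ℕ) (c : Cell k) : Cell L :=
  ⟨blockPoint L b c.1, by simpa only [res_blockPoint] using c.2⟩

/-- The plaquette of a block. -/
def blockPlaquette (L : ℕ) (b : Fin 3 → ℕ) : Plaquette k → Plaquette L
  | Sum.inl q => Sum.inl ⟨(q.1.1, blockPoint L b q.1.2), by simpa only [res_blockPoint] using q.2⟩
  | Sum.inr h => Sum.inr ⟨blockPoint L b h.1, by simpa only [res_blockPoint] using h.2⟩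

omit [NeZero L] in
theorem center_blockPlaquette (b : Fin 3 → ℕ) (p : Plaquette k) :
    center (blockPlaquette L b p) = blockPoint L b (center p) := by
  rcases p with q | h <;> rfl

omit [NeZero L] in
theorem normal_blockPlaquette (b : Fin 3 → ℕ) (p : Plaquette k) :
    normal (blockPlaquette L b p) = normal p := by
  rcases p with q | h
  · rfl
  · funext i
    simp only [blockPlaquette, normal, res_blockPoint]

omit [NeZero L] in
theorem blockPoint_add (b : Fin 3 → ℕ) {p : Plaquette k} {i : Fin 3} (hw : ¬ Wraps p i) {n : ℤ}
    (hn : n.natAbs = (normal p i).natAbs) :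
    (((center p i + (n : ℤ) : ZMod (4 * k)).val + 4 * k * b i : ℕ) : ZMod (4 * L)) =
      (((center p i).val + 4 * k * b i : ℕ) : ZMod (4 * L)) + (n : ℤ) := by
  rw [Wraps] at hw
  push Not at hw
  obtain ⟨m, hm⟩ : ∃ m : ℕ, (m : ℤ) = (center p i).val + n :=
    ⟨((center p i).val + n).toNat, Int.toNat_of_nonneg (by omega)⟩
  have hlt : m < 4 * k := by omega
  have h1 : (center p i + (n : ℤ) : ZMod (4 * k)) = (m : ℕ) := by
    have : ((m : ℤ) : ZMod (4 * k)) = (((center p i).val + n : ℤ) : ZMod (4 * k)) := by rw [hm]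
    push_cast at this
    rw [this, ZMod.natCast_zmod_val]
  have h2 : ((m : ℤ) : ZMod (4 * L)) = (((center p i).val + n : ℤ) : ZMod (4 * L)) := by rw [hm]
  push_cast at h2
  rw [h1, ZMod.val_natCast_of_lt hlt]
  push_cast
  rw [h2]
  ring

omit [NeZero L] in
theorem bondEnds_blockPlaquette (b : Fin 3 → ℕ) {p : Plaquette k} (hw : ∀ i, ¬ Wraps p i) :
    bondEnds (blockPlaquette L b p) =
      (blockCell L b (cellAbove p), blockCell L b (cellBelow p)) := by
  refine Prod.ext (Subtype.ext (funext fun i => ?_)) (Subtype.ext (funext fun i => ?_))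
  · have h1 : (bondEnds (blockPlaquette L b p)).1.1 i = center (blockPlaquette L b p) i +
        ((1 * normal (blockPlaquette L b p) i : ℤ) : ZMod (4 * L)) := rfl
    rw [h1, center_blockPlaquette, normal_blockPlaquette]
    exact (blockPoint_add b (hw i) (by simp)).symm
  · have h1 : (bondEnds (blockPlaquette L b p)).2.1 i = center (blockPlaquette L b p) i +
        ((-1 * normal (blockPlaquette L b p) i : ℤ) : ZMod (4 * L)) := rfl
    rw [h1, center_blockPlaquette, normal_blockPlaquette]
    exact (blockPoint_add b (hw i) (by simp)).symm

open Classical in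
/-- The number of bonds that cross the boundary of the box. -/
theorem card_wraps_le : (Finset.univ.filter fun p : Plaquette k => ¬ ∀ i, ¬ Wraps p i).card ≤
    192 * k ^ 2 := by
  have h1 : ∀ i : Fin 3, (Finset.univ.filter fun p : Plaquette k => Wraps p i).card ≤
      64 * k ^ 2 := by
    intro i
    let T : Fin 3 → Finset (ZMod (4 * k)) := fun j =>
      if j = i then {0, 1, -1, -2} else Finset.univ
    have hT : (Fintype.piFinset T).card ≤ 64 * k ^ 2 := by
      rw [Fintype.card_piFinset]
      have hi : (T i).card ≤ 4 := by
        simp only [T, if_true]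
        exact (Finset.card_insert_le _ _).trans (Nat.succ_le_succ ((Finset.card_insert_le _ _).trans
          (Nat.succ_le_succ (Finset.card_le_two))))
      obtain ⟨j, l, hij, hil, hjl⟩ : ∃ j l : Fin 3, i ≠ j ∧ i ≠ l ∧ j ≠ l := by
        clear hi T; revert i; decide
      have hj : (T j).card = 4 * k := by simp [T, hij.symm]
      have hl : (T l).card = 4 * k := by simp [T, hil.symm]
      rw [prod_three hij hil hjl, hj, hl]
      nlinarith [Nat.mul_le_mul_right (4 * k * (4 * k)) hi]
    refine le_trans ?_ hT
    refine Finset.card_le_card_of_injOn center ?_ center_injective.injOn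
    intro p hp
    have hw := (Finset.mem_filter.1 hp).2
    rw [Finset.mem_coe, Fintype.mem_piFinset]
    intro j
    by_cases hj : j = i
    · subst hj
      simp only [T, if_true, Finset.mem_insert, Finset.mem_singleton]
      have hn := normal_abs_le p j
      have hn' : (normal p j).natAbs ≤ 2 := by
        rw [← Int.natCast_natAbs] at hn; exact_mod_cast hn
      have hv := ZMod.natCast_zmod_val (center p j)
      have hlt := ZMod.val_lt (center p j)
      have h0 : ((4 * k : ℕ) : ZMod (4 * k)) = 0 := ZMod.natCast_self _
      rw [Wraps] at hw
      have hc : (center p j).val = 0 ∨ (center p j).val = 1 ∨ (center p j).val + 1 = 4 * k ∨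
          (center p j).val + 2 = 4 * k := by omega
      rcases hc with h | h | h | h
      · left; rw [← hv, h]; simp
      · right; left; rw [← hv, h]; simp
      · right; right; left
        have := congrArg (Nat.cast : ℕ → ZMod (4 * k)) h
        rw [h0] at this
        push_cast at this
        rw [hv] at this
        linear_combination this
      · right; right; right
        have := congrArg (Nat.cast : ℕ → ZMod (4 * k)) h
        rw [h0] at this
        push_cast at this
        rw [hv] at this
        linear_combination this
    · simp [T, hj]
  have h2 : (Finset.univ.filter fun p : Plaquette k => ¬ ∀ i, ¬ Wraps p i) ⊆
      Finset.univ.biUnion fun i : Fin 3 => Finset.univ.filter fun p : Plaquette k => Wraps p i := by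
    intro p hp
    have := (Finset.mem_filter.1 hp).2
    push Not at this
    obtain ⟨i, hi⟩ := this
    exact Finset.mem_biUnion.2 ⟨i, Finset.mem_univ _, Finset.mem_filter.2 ⟨Finset.mem_univ _, hi⟩⟩
  refine (Finset.card_le_card h2).trans (Finset.card_biUnion_le.trans ?_)
  refine (Finset.sum_le_sum fun i _ => h1 i).trans ?_
  simp
  omega

omit [NeZero L] in
theorem blockPlaquette_injective {q : ℕ} (hq : q * k ≤ L) {b b' : Fin 3 → Fin q}
    {p p' : Plaquette k} (h : blockPlaquette L (fun i => (b i : ℕ)) p =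
      blockPlaquette L (fun i => (b' i : ℕ)) p') : b = b' ∧ p = p' := by
  have h1 := congrArg center h
  rw [center_blockPlaquette, center_blockPlaquette] at h1
  obtain ⟨h2, h3⟩ := blockPoint_injective hq h1
  exact ⟨h2, center_injective h3⟩

/-- Superadditivity of the free energy up to boundary terms. -/
theorem log_isingPartition_block {q : ℕ} (hq : q * k ≤ L) {K : ℝ} (hK : 0 ≤ K) :
    (q : ℝ) ^ 3 * (Real.log (isingPartition k K) - K * (192 * k ^ 2)) ≤
      Real.log (isingPartition L K) := by
  classical
  set F := graphIsing (fun p : {p : Plaquette k // ∀ i, ¬ Wraps p i} => bondEnds p.1) K with hF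
  have h1 := graphIsing_le_restrict (bondEnds (L := k)) hK fun p => ∀ i, ¬ Wraps p i
  have h2 : F ^ Fintype.card (Fin 3 → Fin q) ≤ graphIsing (bondEnds (L := L)) K := by
    refine graphIsing_pow_le hK (fun x : (Fin 3 → Fin q) × Cell k =>
      blockCell L (fun i => (x.1 i : ℕ)) x.2) ?_
      (fun x => blockPlaquette L (fun i => (x.1 i : ℕ)) x.2.1) ?_ ?_
    · rintro ⟨b, c⟩ ⟨b', c'⟩ h
      obtain ⟨h1, h2⟩ := blockPoint_injective hq (congrArg Subtype.val h)
      exact Prod.ext h1 (Subtype.ext h2)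
    · rintro ⟨b, c⟩ ⟨b', c'⟩ h
      obtain ⟨h1, h2⟩ := blockPlaquette_injective hq h
      exact Prod.ext h1 (Subtype.ext h2)
    · rintro n ⟨p, hp⟩
      exact bondEnds_blockPlaquette _ hp
  rw [← isingPartition_eq_graphIsing] at h1 h2
  have hFpos : 0 < F := Finset.sum_pos (fun _ _ => Finset.prod_pos fun _ _ => Real.exp_pos _)
    Finset.univ_nonempty
  have h3 := Real.log_le_log (isingPartition_pos K) h1
  rw [Real.log_mul (Real.exp_pos _).ne' hFpos.ne', Real.log_exp] at h3
  have h4 := Real.log_le_log (pow_pos hFpos _) h2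
  rw [Real.log_pow, Fintype.card_fun, Fintype.card_fin, Fintype.card_fin, Nat.cast_pow] at h4
  refine le_trans (mul_le_mul_of_nonneg_left ?_ (by positivity)) h4
  have h5 : ((Finset.univ.filter fun p : Plaquette k => ¬ ∀ i, ¬ Wraps p i).card : ℝ) ≤
      192 * k ^ 2 := by exact_mod_cast card_wraps_le
  have h6 := mul_le_mul_of_nonneg_left h5 hK
  linarith

theorem log_isingPartition_le {K : ℝ} (hK : 0 ≤ K) :
    Real.log (isingPartition L K) ≤ 2 * L ^ 3 * (Real.log 2 + 7 * K) := by
  have h1 : isingPartition L K ≤ 2 ^ (2 * L ^ 3) * Real.exp (K * (14 * L ^ 3)) := by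
    rw [isingPartition_eq_prod]
    have : ∀ σ : Cell L → ℤˣ, ∏ p : Plaquette L, Real.exp (K * ((spinChar p σ : ℤˣ) : ℤ)) ≤
        Real.exp (K * (14 * L ^ 3)) := by
      intro σ
      have hc : ((14 * L ^ 3 : ℕ) : ℝ) = 14 * (L : ℝ) ^ 3 := by push_cast; ring
      rw [← Real.exp_sum, mul_comm K, ← hc, ← card_plaquette (L := L), ← Finset.card_univ,
        ← nsmul_eq_mul, ← Finset.sum_const]
      refine Real.exp_le_exp.2 (Finset.sum_le_sum fun p _ => ?_)
      rcases Int.units_eq_one_or (spinChar p σ) with h | h <;> rw [h] <;> simp [hK]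
    refine (Finset.sum_le_sum fun σ _ => this σ).trans_eq ?_
    rw [Finset.sum_const, Finset.card_univ, Fintype.card_fun, card_cell, nsmul_eq_mul]
    norm_num
  refine (Real.log_le_log (isingPartition_pos K) h1).trans_eq ?_
  rw [Real.log_mul (by positivity) (Real.exp_pos _).ne', Real.log_exp, Real.log_pow]
  push_cast
  ring

theorem log_isingPartition_nonneg {K : ℝ} (hK : 0 ≤ K) : 0 ≤ Real.log (isingPartition L K) := by
  have h := log_isingPartition_block (k := L) (L := L) (q := 0) (by simp) hK
  simpa using h

end Blocks

/-! ### The thermodynamic limit -/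

section Limit

/-- A bounded sequence that is superadditive up to boundary terms converges. -/
theorem exists_tendsto_of_block {a : ℕ → ℝ} {B C : ℝ} (h0 : ∀ L, 0 ≤ a L) (hB : ∀ L, 0 < L → a L ≤ B)
    (hC : 0 ≤ C)
    (hblock : ∀ k q L : ℕ, 0 < k → 0 < L → q * k ≤ L →
      ((q * k : ℕ) / L : ℝ) ^ 3 * (a k - C / k) ≤ a L) :
    ∃ c, Tendsto a atTop (𝓝 c) := by
  set S : Set ℝ := (fun k : ℕ => a k - C / k) '' {k | 0 < k} with hS
  have hbdd : BddAbove S := by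
    refine ⟨B, ?_⟩
    rintro _ ⟨k, hk, rfl⟩
    have : (0 : ℝ) ≤ C / k := by positivity
    have := hB k hk
    simp only
    linarith
  have hne : S.Nonempty := ⟨_, 1, by simp, rfl⟩
  refine ⟨sSup S, tendsto_order.2 ⟨fun c hc => ?_, fun c hc => ?_⟩⟩
  · obtain ⟨_, ⟨k, hk, rfl⟩, hck⟩ := exists_lt_of_lt_csSup hne hc
    simp only at hck
    have hlim : Tendsto (fun L : ℕ => (1 - (k : ℝ) / L) ^ 3 * (a k - C / k)) atTop
        (𝓝 (a k - C / k)) := by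
      have h1 : Tendsto (fun L : ℕ => (k : ℝ) / L) atTop (𝓝 0) :=
        tendsto_const_div_atTop_nhds_zero_nat _
      simpa using ((h1.const_sub 1).pow 3).mul_const (a k - C / k)
    filter_upwards [hlim.eventually (lt_mem_nhds hck), eventually_ge_atTop k] with L hL hkL
    have hLpos : 0 < L := lt_of_lt_of_le hk hkL
    have hLr : (0 : ℝ) < L := by exact_mod_cast hLpos
    refine hL.trans_le ?_
    by_cases hs : 0 ≤ a k - C / k
    · refine le_trans ?_ (hblock k (L / k) L hk hLpos (Nat.div_mul_le_self L k))
      refine mul_le_mul_of_nonneg_right ?_ hs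
      have hk1 : (k : ℝ) ≤ L := by exact_mod_cast hkL
      refine pow_le_pow_left₀ (sub_nonneg.2 ((div_le_one hLr).2 hk1)) ?_ 3
      rw [one_sub_div hLr.ne']
      refine div_le_div_of_nonneg_right ?_ hLr.le
      have h1 := Nat.div_add_mod L k
      have h2 := Nat.mod_lt L hk
      have h3 : L ≤ L / k * k + k := by rw [mul_comm (L / k)]; omega
      have h4 : (L : ℝ) ≤ (L / k * k : ℕ) + k := by exact_mod_cast h3
      linarith
    · push Not at hs
      have hk1 : (k : ℝ) / L ≤ 1 := (div_le_one hLr).2 (by exact_mod_cast hkL)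
      exact (mul_nonpos_of_nonneg_of_nonpos (pow_nonneg (sub_nonneg.2 hk1) 3) hs.le).trans (h0 L)
  · have hlim : Tendsto (fun L : ℕ => sSup S + C / L) atTop (𝓝 (sSup S)) := by
      simpa using (tendsto_const_div_atTop_nhds_zero_nat C).const_add (sSup S)
    filter_upwards [hlim.eventually (gt_mem_nhds hc), eventually_gt_atTop 0] with L hL hLpos
    have := le_csSup hbdd ⟨L, hLpos, rfl⟩
    simp only at this
    linarith

open Classical in
theorem exists_tendsto_log_isingPartition {K : ℝ} (hK : 0 < K) :
    ∃ c, Tendsto (fun L : ℕ => Real.log (isingPartition (L + 1) K) / (2 * ((L : ℝ) + 1) ^ 3))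
      atTop (𝓝 c) := by
  set a : ℕ → ℝ := fun L => if h : L = 0 then 0 else
    have : NeZero L := ⟨h⟩
    Real.log (isingPartition L K) / (2 * (L : ℝ) ^ 3) with ha
  have haL : ∀ (L : ℕ) [NeZero L], a L = Real.log (isingPartition L K) / (2 * (L : ℝ) ^ 3) :=
    fun L _ => dif_neg (NeZero.ne L)
  obtain ⟨c, hc⟩ := exists_tendsto_of_block (a := a) (B := Real.log 2 + 7 * K) (C := 96 * K)
    (fun L => by
      by_cases h : L = 0
      · simp [ha, h]
      · have : NeZero L := ⟨h⟩
        rw [haL]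
        exact div_nonneg (log_isingPartition_nonneg hK.le) (by positivity))
    (fun L hL => by
      have : NeZero L := ⟨hL.ne'⟩
      have hLr : (0 : ℝ) < L := by exact_mod_cast hL
      rw [haL, div_le_iff₀ (by positivity)]
      exact (log_isingPartition_le hK.le).trans_eq (by ring))
    (by positivity)
    (fun k q L hk hL hq => by
      have : NeZero k := ⟨hk.ne'⟩
      have : NeZero L := ⟨hL.ne'⟩
      have hkr : (0 : ℝ) < k := by exact_mod_cast hk
      have hLr : (0 : ℝ) < L := by exact_mod_cast hL
      rw [haL, haL, le_div_iff₀ (by positivity)]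
      refine le_trans (le_of_eq ?_) (log_isingPartition_block (k := k) hq hK.le)
      push_cast
      field_simp
      ring)
  refine ⟨c, ?_⟩
  have h1 := hc.comp (tendsto_add_atTop_nat 1)
  refine h1.congr fun L => ?_
  simp only [Function.comp]
  rw [haL]
  push_cast
  rfl

theorem tendsto_log_partitionFunction {β J c : ℝ} (hx : 0 < β * J)
    (hc : Tendsto (fun L : ℕ => Real.log (isingPartition (L + 1) (dualCoupling (β * J))) /
      (2 * ((L : ℝ) + 1) ^ 3)) atTop (𝓝 c)) :
    Tendsto (fun L : ℕ => Real.log (partitionFunction (L + 1) β (fun _ => J)) /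
      (2 * ((L : ℝ) + 1) ^ 3)) atTop
      (𝓝 (6 * Real.log 2 + 7 / 2 * Real.log (Real.sinh (2 * (β * J)) / 2) + c)) := by
  set x := β * J with hxdef
  have hsinh : 0 < Real.sinh (2 * x) / 2 :=
    div_pos (Real.sinh_pos_iff.2 (by linarith)) two_pos
  have hinv : ∀ D : ℝ, Tendsto (fun L : ℕ => D / (2 * ((L : ℝ) + 1) ^ 3)) atTop (𝓝 0) := by
    intro D
    refine tendsto_const_nhds.div_atTop ?_
    refine Tendsto.const_mul_atTop two_pos ?_
    exact (tendsto_pow_atTop (by norm_num)).comp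
      (tendsto_atTop_add_const_right _ 1 tendsto_natCast_atTop_atTop)
  have hlogC : ∀ L : ℕ, Real.log (dualityConstant (L + 1) x) / (2 * ((L : ℝ) + 1) ^ 3) =
      6 * Real.log 2 + 7 / 2 * Real.log (Real.sinh (2 * x) / 2) -
        Real.log 2 / (2 * ((L : ℝ) + 1) ^ 3) := by
    intro L
    have hL : 1 ≤ 12 * (L + 1) ^ 3 := by
      have := pow_pos (Nat.succ_pos L) 3
      simp only [Nat.succ_eq_add_one] at this
      omega
    have hr : (0 : ℝ) < (L : ℝ) + 1 := by positivity
    rw [dualityConstant, Real.log_mul (by positivity) (by positivity), Real.log_pow, Real.log_pow,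
      Nat.cast_sub hL]
    push_cast
    field_simp
    ring
  have hlow : Tendsto (fun L : ℕ => Real.log (dualityConstant (L + 1) x) / (2 * ((L : ℝ) + 1) ^ 3) +
      Real.log (isingPartition (L + 1) (dualCoupling x)) / (2 * ((L : ℝ) + 1) ^ 3)) atTop
      (𝓝 (6 * Real.log 2 + 7 / 2 * Real.log (Real.sinh (2 * x) / 2) + c)) := by
    simp only [hlogC]
    simpa using (tendsto_const_nhds.sub (hinv (Real.log 2))).add hc
  have hup := hlow.add (hinv (Real.log 16))
  rw [add_zero] at hup
  refine tendsto_of_tendsto_of_tendsto_of_le_of_le hlow hup ?_ ?_ <;> intro L <;> dsimp only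
  · have hC := dualityConstant_pos (L := L + 1) hx
    have hI := isingPartition_pos (L := L + 1) (dualCoupling x)
    rw [← add_div, ← Real.log_mul hC.ne' hI.ne']
    exact div_le_div_of_nonneg_right
      (Real.log_le_log (mul_pos hC hI) (finite_volume_duality hx).1) (by positivity)
  · have hC := dualityConstant_pos (L := L + 1) hx
    have hI := isingPartition_pos (L := L + 1) (dualCoupling x)
    have hd := finite_volume_duality (L := L + 1) hx
    rw [← add_div, ← Real.log_mul hC.ne' hI.ne', ← add_div, add_comm (Real.log _) (Real.log 16),
      ← Real.log_mul (by norm_num) (mul_pos hC hI).ne']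
    exact div_le_div_of_nonneg_right
      (Real.log_le_log ((mul_pos hC hI).trans_le hd.1) hd.2) (by positivity)

theorem dualCoupling_dualCoupling {x : ℝ} (hx : 0 < x) : dualCoupling (dualCoupling x) = x := by
  have hs := Real.sinh_pos_iff.2 hx
  have hc := Real.cosh_pos x
  have hE := Real.exp_pos (dualCoupling x)
  have h1 : Real.tanh (dualCoupling x) = Real.exp (-(2 * x)) := by
    have h2 := exp_dualCoupling_sq hx
    rw [Real.tanh_eq_sinh_div_cosh, Real.sinh_eq, Real.cosh_eq, Real.exp_neg]
    have h3 : (Real.exp (dualCoupling x) - (Real.exp (dualCoupling x))⁻¹) / 2 /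
        ((Real.exp (dualCoupling x) + (Real.exp (dualCoupling x))⁻¹) / 2) =
        (Real.exp (dualCoupling x) ^ 2 - 1) / (Real.exp (dualCoupling x) ^ 2 + 1) := by
      field_simp
    rw [h3, h2]
    have h4 : (Real.cosh x / Real.sinh x - 1) / (Real.cosh x / Real.sinh x + 1) =
        (Real.cosh x - Real.sinh x) / (Real.cosh x + Real.sinh x) := by
      field_simp
    rw [h4, Real.cosh_sub_sinh, Real.cosh_add_sinh, ← Real.exp_sub]
    congr 1; ring
  rw [dualCoupling, h1, Real.log_exp]
  ring

theorem analyticAt_dualCoupling {x : ℝ} (hx : 0 < x) : AnalyticAt ℝ dualCoupling x := by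
  have h1 : AnalyticAt ℝ (fun x => Real.sinh x / Real.cosh x) x :=
    Real.analyticAt_sinh.div Real.analyticAt_cosh (Real.cosh_pos x).ne'
  have h2 : dualCoupling = fun x => -(1 / 2) * Real.log (Real.sinh x / Real.cosh x) := by
    funext y
    rw [dualCoupling, Real.tanh_eq_sinh_div_cosh]
  rw [h2]
  exact analyticAt_const.mul (h1.log (div_pos (Real.sinh_pos_iff.2 hx) (Real.cosh_pos x)))

theorem analyticAt_log_sinh {x : ℝ} (hx : 0 < x) :
    AnalyticAt ℝ (fun x => 6 * Real.log 2 + 7 / 2 * Real.log (Real.sinh (2 * x) / 2)) x := by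
  have h1 : AnalyticAt ℝ (fun x => Real.sinh (2 * x) / 2) x :=
    (Real.analyticAt_sinh.comp_of_eq (analyticAt_const.mul analyticAt_id) rfl).div
      analyticAt_const two_ne_zero
  exact analyticAt_const.add (analyticAt_const.mul
    (h1.log (div_pos (Real.sinh_pos_iff.2 (by linarith)) two_pos)))

theorem analyticAt_add_comp_dualCoupling_iff {A ψ : ℝ → ℝ} (hA : ∀ x, 0 < x → AnalyticAt ℝ A x)
    {x : ℝ} (hx : 0 < x) :
    AnalyticAt ℝ (fun y => A y + ψ (dualCoupling y)) x ↔ AnalyticAt ℝ ψ (dualCoupling x) := by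
  constructor
  · intro h
    have hK := dualCoupling_pos hx
    have hinv := dualCoupling_dualCoupling hx
    have h1 : AnalyticAt ℝ (fun y => A y + ψ (dualCoupling y) - A y) x := h.sub (hA x hx)
    have h2 := h1.comp_of_eq (analyticAt_dualCoupling hK) hinv
    refine h2.congr ?_
    filter_upwards [lt_mem_nhds hK] with y hy
    simp only [Function.comp, add_sub_cancel_left, dualCoupling_dualCoupling hy]
  · intro h
    exact (hA x hx).add (h.comp (analyticAt_dualCoupling hx))

end Limit

/-! ### Neighbouring plaquettes and defect lines -/

section Neighbours

variable {L : ℕ}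

/-- The centre of `p` is within distance `2` of `c` in each direction. -/
def Near (c : Point L) (p : Plaquette L) : Prop :=
  ∃ d : Fin 3 → ℤ, (∀ l, |d l| ≤ 2) ∧ center p = c + toPoint L d

/-- The centres of `p` and `q` are within distance `4` in each direction. -/
def Adjacent (p q : Plaquette L) : Prop :=
  ∃ d : Fin 3 → ℤ, (∀ l, |d l| ≤ 4) ∧ center q = center p + toPoint L d

theorem Near.adjacent {c : Point L} {p q : Plaquette L} (hp : Near c p) (hq : Near c q) :
    Adjacent p q := by
  obtain ⟨d, hd, e⟩ := hp
  obtain ⟨d', hd', e'⟩ := hq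
  refine ⟨d' - d, fun l => ?_, ?_⟩
  · have h1 := abs_le.1 (hd l)
    have h2 := abs_le.1 (hd' l)
    rw [Pi.sub_apply, abs_le]
    constructor <;> linarith
  · rw [e, e', toPoint_sub]; abel

open Classical in
theorem exists_finset_center [NeZero L] (c : Point L) :
    ∃ s : Finset (Plaquette L), s.card ≤ 729 ∧
      ∀ b, (∃ d : Fin 3 → ℤ, (∀ l, |d l| ≤ 4) ∧ center b = c + toPoint L d) → b ∈ s := by
  refine ⟨Finset.univ.filter fun b => ∃ d : Fin 3 → ℤ, (∀ l, |d l| ≤ 4) ∧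
    center b = c + toPoint L d, ?_, fun b hb => Finset.mem_filter.2 ⟨Finset.mem_univ _, hb⟩⟩
  have h1 : ((Fintype.piFinset fun _ : Fin 3 => Finset.Icc (-4 : ℤ) 4).image
      fun d => c + toPoint L d).card ≤ 729 := by
    refine Finset.card_image_le.trans ?_
    rw [Fintype.card_piFinset]
    simp
  refine le_trans (Finset.card_le_card_of_injOn center ?_ center_injective.injOn) h1
  intro b hb
  obtain ⟨d, hd, e⟩ := (Finset.mem_filter.1 hb).2
  refine Finset.mem_coe.2 (Finset.mem_image.2 ⟨d, ?_, e.symm⟩)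
  rw [Fintype.mem_piFinset]
  exact fun l => Finset.mem_Icc.2 (abs_le.1 (hd l))

theorem exists_finset_adjacent [NeZero L] (a : Plaquette L) :
    ∃ s : Finset (Plaquette L), s.card ≤ 729 ∧ ∀ b, Adjacent a b → b ∈ s :=
  exists_finset_center (center a)

theorem exists_finset_near [NeZero L] (c : Point L) :
    ∃ s : Finset (Plaquette L), s.card ≤ 729 ∧ ∀ b, Near c b → b ∈ s := by
  obtain ⟨s, h1, h2⟩ := exists_finset_center c
  refine ⟨s, h1, fun b ⟨d, hd, e⟩ => h2 b ⟨d, fun l => (hd l).trans (by norm_num), e⟩⟩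

theorem near_cellAbove [NeZero L] (p : Plaquette L) : Near (cellAbove p).1 p := by
  refine ⟨-normal p, fun l => by rw [Pi.neg_apply, abs_neg]; exact normal_abs_le p l, ?_⟩
  funext l
  simp [cellAbove, toPoint]

theorem near_cellBelow [NeZero L] (p : Plaquette L) : Near (cellBelow p).1 p := by
  refine ⟨normal p, normal_abs_le p, ?_⟩
  funext l
  simp [cellBelow, toPoint]

theorem exists_triangle_of_isSq [NeZero L] {c : Point L} {i j k : Fin 3} (hc : IsSq c i j k)
    (δ δ' : ℤˣ) : ∃ p q r : Plaquette L, Near c p ∧ Near c q ∧ Near c r ∧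
      ∀ a, curl (extend a) c i j k δ δ' = a p * a q * a r := by
  obtain ⟨s, hs⟩ := hc.exists_square
  have hcen : c = center (Sum.inl s) := by simp [center, hs]
  have hhex : ∀ ε : ℤˣ, ∃ h : Hexagon L, h.1 =
      c + (ε : ℤ) • unit L i + (δ : ℤ) • unit L j + (δ' : ℤ) • unit L k := by
    intro ε
    have key : ∀ (u : ℤˣ) (r : ZMod 4), (r = 0 ∨ r = 2) →
        (r + (u : ℤ) = 1 ∨ r + (u : ℤ) = 3) := by decide
    refine ⟨⟨_, ?_⟩, rfl⟩
    intro l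
    rcases eq_of_three hc.ij hc.ik hc.jk l with rfl | rfl | rfl <;>
    simp only [res_add, res_zsmul_unit_self, res_zsmul_unit_ne, hc.ij, hc.ik, hc.jk, hc.ij.symm,
      hc.ik.symm, hc.jk.symm, ne_eq, not_false_eq_true, add_zero]
    · exact key ε _ hc.even
    · exact key δ _ (by rw [hc.resj]; rcases hc.even with e | e <;> rw [e] <;> decide)
    · exact key δ' _ (by rw [hc.resk]; rcases hc.even with e | e <;> rw [e] <;> decide)
  have hnear : ∀ (ε : ℤˣ) (h : Hexagon L), h.1 =
      c + (ε : ℤ) • unit L i + (δ : ℤ) • unit L j + (δ' : ℤ) • unit L k → Near c (Sum.inr h) := by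
    intro ε h hh
    refine ⟨Pi.single i (ε : ℤ) + Pi.single j (δ : ℤ) + Pi.single k (δ' : ℤ), fun l => ?_, ?_⟩
    · have hu : ∀ u : ℤˣ, |(u : ℤ)| ≤ 2 := by decide
      rcases eq_of_three hc.ij hc.ik hc.jk l with rfl | rfl | rfl <;>
      simp [Pi.single_eq_of_ne, hc.ij, hc.ik, hc.jk, hc.ij.symm, hc.ik.symm, hc.jk.symm, hu]
    · simp only [toPoint_add, toPoint_single]
      rw [show center (Sum.inr h) = _ from hh]
      abel
  obtain ⟨h1, e1⟩ := hhex 1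
  obtain ⟨h2, e2⟩ := hhex (-1)
  refine ⟨Sum.inl s, Sum.inr h1, Sum.inr h2, ⟨0, by simp, ?_⟩, hnear _ _ e1, hnear _ _ e2,
    fun a => ?_⟩
  · rw [← hcen]; funext l; simp [toPoint]
  · rw [← extend_center a, ← extend_center a (Sum.inr h1), ← extend_center a (Sum.inr h2), ← hcen,
      show center (Sum.inr h1) = _ from e1, show center (Sum.inr h2) = _ from e2, curl]
    simp [sub_eq_add_neg]

/-- The integer point `(4i, 4j, 0)`. -/
def gridPoint (i j : ℕ) : Fin 3 → ℤ := ![4 * i, 4 * j, 0]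

theorem isCellZ_gridPoint (i j : ℕ) : IsCellZ (gridPoint i j) := by
  have h4 : (4 : ZMod 4) = 0 := rfl
  left
  intro l
  fin_cases l <;> simp [gridPoint, h4]

theorem exists_lineSquare (L : ℕ) (i j : ℕ) :
    ∃ q : Square L, q.1 = (0, toPoint L (gridPoint i j + Pi.single 0 2)) := by
  have h4 : (4 : ZMod 4) = 0 := rfl
  refine ⟨⟨(0, toPoint L (gridPoint i j + Pi.single 0 2)), ?_⟩, rfl⟩
  have : res (toPoint L (gridPoint i j + Pi.single 0 2)) = ![2, 0, 0] := by
    funext l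
    rw [res_toPoint]
    fin_cases l <;> simp [gridPoint, h4]
  simp only [this]
  decide

theorem exists_sideSquare (L : ℕ) (i j : ℕ) :
    ∃ q : Square L, q.1 = (1, toPoint L (gridPoint i j + Pi.single 1 2)) := by
  have h4 : (4 : ZMod 4) = 0 := rfl
  refine ⟨⟨(1, toPoint L (gridPoint i j + Pi.single 1 2)), ?_⟩, rfl⟩
  have : res (toPoint L (gridPoint i j + Pi.single 1 2)) = ![0, 2, 0] := by
    funext l
    rw [res_toPoint]
    fin_cases l <;> simp [gridPoint, h4]
  simp only [this]
  decide

/-- The square between the cells at `(4i, 4j, 0)` and `(4i + 4, 4j, 0)`. -/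
noncomputable def lineSquare (L : ℕ) (i j : ℕ) : Plaquette L :=
  Sum.inl (exists_lineSquare L i j).choose

/-- The square between the cells at `(4i, 4j, 0)` and `(4i, 4j + 4, 0)`. -/
noncomputable def sideSquare (L : ℕ) (i j : ℕ) : Plaquette L :=
  Sum.inl (exists_sideSquare L i j).choose

theorem center_lineSquare (i j : ℕ) :
    center (lineSquare L i j) = toPoint L (gridPoint i j + Pi.single 0 2) :=
  congrArg Prod.snd (exists_lineSquare L i j).choose_spec

theorem normal_lineSquare (i j : ℕ) : normal (lineSquare L i j) = Pi.single 0 2 := by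
  have := congrArg Prod.fst (exists_lineSquare L i j).choose_spec
  simp only [lineSquare, normal, this]

theorem center_sideSquare (i j : ℕ) :
    center (sideSquare L i j) = toPoint L (gridPoint i j + Pi.single 1 2) :=
  congrArg Prod.snd (exists_sideSquare L i j).choose_spec

theorem normal_sideSquare (i j : ℕ) : normal (sideSquare L i j) = Pi.single 1 2 := by
  have := congrArg Prod.fst (exists_sideSquare L i j).choose_spec
  simp only [sideSquare, normal, this]

theorem IsPotential.lineSquare {Ψ : (Fin 3 → ℤ) → ℤˣ} {a : Plaquette L → ℤˣ}
    (h : IsPotential Ψ a) (i j : ℕ) :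
    a (lineSquare L i j) = Ψ (gridPoint i j) * Ψ (gridPoint (i + 1) j) := by
  have e : gridPoint i j + Pi.single 0 2 + Pi.single 0 2 = gridPoint (i + 1) j := by
    funext l
    simp only [Pi.add_apply, Pi.single_apply]
    fin_cases l <;> simp [gridPoint]
    ring
  rw [h _ _ (center_lineSquare i j).symm, normal_lineSquare, add_sub_cancel_right, e]

theorem IsPotential.sideSquare {Ψ : (Fin 3 → ℤ) → ℤˣ} {a : Plaquette L → ℤˣ}
    (h : IsPotential Ψ a) (i j : ℕ) :
    a (sideSquare L i j) = Ψ (gridPoint i j) * Ψ (gridPoint i (j + 1)) := by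
  have e : gridPoint i j + Pi.single 1 2 + Pi.single 1 2 = gridPoint i (j + 1) := by
    funext l
    simp only [Pi.add_apply, Pi.single_apply]
    fin_cases l <;> simp [gridPoint]
    ring
  rw [h _ _ (center_sideSquare i j).symm, normal_sideSquare, add_sub_cancel_right, e]

/-- The product of the signs on a line of squares telescopes. -/
theorem IsPotential.prod_lineSquare {Ψ : (Fin 3 → ℤ) → ℤˣ} {a : Plaquette L → ℤˣ}
    (h : IsPotential Ψ a) (m j : ℕ) :
    ∏ i ∈ Finset.range m, a (BitruncatedCubic.lineSquare L i j) =
      Ψ (gridPoint 0 j) * Ψ (gridPoint m j) := by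
  induction m with
  | zero => simp [Int.units_mul_self]
  | succ m ih =>
    rw [Finset.prod_range_succ, ih, h.lineSquare, mul_assoc, units_mul_cancel]

theorem lineSquare_inj {i i' j j' : ℕ} (hi : i < L) (hi' : i' < L) (hj : j < L) (hj' : j' < L)
    (h : lineSquare L i j = lineSquare L i' j') : i = i' ∧ j = j' := by
  have h1 : toPoint L (gridPoint i j + Pi.single 0 2) =
      toPoint L (gridPoint i' j' + Pi.single 0 2) := by
    rw [← center_lineSquare, h, center_lineSquare]
  have h2 : ((4 * i + 2 : ℕ) : ZMod (4 * L)) = ((4 * i' + 2 : ℕ) : ZMod (4 * L)) := by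
    have := congrFun h1 0
    simpa [toPoint, gridPoint] using this
  have h3 : ((4 * j : ℕ) : ZMod (4 * L)) = ((4 * j' : ℕ) : ZMod (4 * L)) := by
    have := congrFun h1 1
    simpa [toPoint, gridPoint] using this
  replace h2 := congrArg ZMod.val h2
  replace h3 := congrArg ZMod.val h3
  rw [ZMod.val_natCast_of_lt (by omega), ZMod.val_natCast_of_lt (by omega)] at h2 h3
  omega

theorem onDefectLine_iff {m : ℕ} (p : Plaquette L) :
    OnDefectLine m p ↔ ∃ i < m, p = lineSquare L i 0 := by
  have hc : ∀ i : ℕ, toPoint L (gridPoint i 0 + Pi.single 0 2) =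
      Pi.single 0 ((4 * i + 2 : ℕ) : ZMod (4 * L)) := by
    intro i
    funext l
    fin_cases l <;> simp [toPoint, gridPoint]
  rcases p with q | h
  · simp only [OnDefectLine]
    constructor
    · rintro ⟨h1, i, hi, h2⟩
      refine ⟨i, hi, center_injective ?_⟩
      rw [center_lineSquare, hc]
      exact h2
    · rintro ⟨i, hi, h⟩
      have h1 : q = (exists_lineSquare L i 0).choose := Sum.inl_injective h
      have h2 := (exists_lineSquare L i 0).choose_spec
      rw [← h1] at h2
      exact ⟨by rw [h2], i, hi, by rw [h2, hc]⟩
  · simp only [OnDefectLine, false_iff]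
    rintro ⟨i, -, h⟩
    exact absurd h (by simp [lineSquare])

/-- The product of the signs on the defect line. -/
noncomputable def lineSign (m : ℕ) (a : Plaquette L → ℤˣ) : ℤˣ :=
  ∏ i ∈ Finset.range m, a (lineSquare L i 0)

theorem lineSign_mul (m : ℕ) (a b : Plaquette L → ℤˣ) :
    lineSign m (a * b) = lineSign m a * lineSign m b := by
  simp [lineSign, Finset.prod_mul_distrib]

theorem lineChar_eq [NeZero L] {m : ℕ} (hm : m ≤ L) (g : TwistGroup L) :
    lineChar L m g = lineSign m (twist L g) := by
  classical
  rw [lineChar_apply, lineSign, ← Finset.prod_filter]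
  symm
  refine Finset.prod_bij (fun i _ => lineSquare L i 0) ?_ ?_ ?_ (fun _ _ => rfl)
  · intro i hi
    exact Finset.mem_filter.2 ⟨Finset.mem_univ _,
      (onDefectLine_iff _).2 ⟨i, Finset.mem_range.1 hi, rfl⟩⟩
  · intro i hi i' hi' h
    rw [Finset.mem_range] at hi hi'
    have hL := NeZero.pos L
    exact (lineSquare_inj (by omega) (by omega) hL hL h).1
  · intro p hp
    obtain ⟨i, hi, rfl⟩ := (onDefectLine_iff _).1 (Finset.mem_filter.1 hp).2
    exact ⟨i, Finset.mem_range.2 hi, rfl⟩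

end Neighbours

/-! ### The Peierls argument -/

section Peierls

set_option linter.unusedSectionVars false

variable {L : ℕ} [NeZero L]

/-- The signs whose product around every triangle of bonds is `1`. -/
def IsFlat (a : Plaquette L → ℤˣ) : Prop :=
  ∀ c i j k, IsSq c i j k → ∀ δ δ', curl (extend a) c i j k δ δ' = 1

theorem IsFlat.mul {a b : Plaquette L → ℤˣ} (ha : IsFlat a) (hb : IsFlat b) : IsFlat (a * b) :=
  fun c i j k h δ δ' => by rw [curl_mul, ha c i j k h, hb c i j k h, one_mul]

/-- The twisted Ising configurations without additional sign on the squares. -/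
noncomputable def evenTwist (L : ℕ) [NeZero L] :
    (Cell L → ℤˣ) × (Fin 3 → ℤˣ) →* (Plaquette L → ℤˣ) where
  toFun h := twist L (h.1, h.2, 1)
  map_one' := map_one (twist L)
  map_mul' h h' := by rw [← map_mul]; rfl

theorem isFlat_evenTwist (h : (Cell L → ℤˣ) × (Fin 3 → ℤˣ)) : IsFlat (evenTwist L h) :=
  fun _ _ _ _ hc δ δ' => curl_twist hc δ δ' _

theorem IsFlat.exists_evenTwist {a : Plaquette L → ℤˣ} (ha : IsFlat a) :
    ∃ h, evenTwist L h = a := by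
  obtain ⟨⟨σ, s, η⟩, hg⟩ := exists_twist
    (mem_plaquetteKernel_iff_curl.2 ⟨1, fun c i j k hc δ δ' => ha c i j k hc δ δ'⟩)
  have hη : η = 1 := by
    have h0 := isSq_triangle (L := L) 0
    have h1 : _ = η := curl_twist h0 1 1 (σ, s, η)
    rw [hg, ha _ _ _ _ h0] at h1
    exact h1.symm
  subst hη
  exact ⟨(σ, s), hg⟩

open Classical in
/-- The sign `-1` on `γ`. -/
noncomputable def flipOn (γ : Finset (Plaquette L)) (p : Plaquette L) : ℤˣ :=
  if p ∈ γ then -1 else 1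

theorem flipOn_of_mem {γ : Finset (Plaquette L)} {p : Plaquette L} (h : p ∈ γ) :
    flipOn γ p = -1 := if_pos h

theorem flipOn_of_notMem {γ : Finset (Plaquette L)} {p : Plaquette L} (h : p ∉ γ) :
    flipOn γ p = 1 := if_neg h

theorem flipOn_eq_neg_one_iff {γ : Finset (Plaquette L)} {p : Plaquette L} :
    flipOn γ p = -1 ↔ p ∈ γ := by
  by_cases h : p ∈ γ
  · simp [flipOn_of_mem h, h]
  · rw [flipOn_of_notMem h]
    exact ⟨fun h' => absurd h' (by decide), fun h' => absurd h' h⟩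

theorem isFlat_flipOn_component {γ : Finset (Plaquette L)} (hγ : IsFlat (flipOn γ))
    (p₀ : Plaquette L) : IsFlat (flipOn (component Adjacent γ p₀)) := by
  intro c i j k hc δ δ'
  obtain ⟨p, q, r, hp, hq, hr, h⟩ := exists_triangle_of_isSq hc δ δ'
  have h1 := hγ c i j k hc δ δ'
  rw [h] at h1 ⊢
  set C := component Adjacent γ p₀
  have hsub : C ⊆ γ := component_subset γ p₀
  have key : ∀ x y : Plaquette L, Near c x → Near c y → x ∈ C → (y ∈ C ↔ y ∈ γ) :=
    fun x y hx hy hxC => ⟨fun h => hsub h, fun h => mem_component_of_adj hxC h (hx.adjacent hy)⟩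
  by_cases hne : p ∈ C ∨ q ∈ C ∨ r ∈ C
  · have hall : ∀ y, Near c y → flipOn C y = flipOn γ y := by
      intro y hy
      have : y ∈ C ↔ y ∈ γ := by
        rcases hne with h | h | h
        · exact key p y hp hy h
        · exact key q y hq hy h
        · exact key r y hr hy h
      by_cases hyC : y ∈ C
      · rw [flipOn_of_mem hyC, flipOn_of_mem (this.1 hyC)]
      · rw [flipOn_of_notMem hyC, flipOn_of_notMem fun h => hyC (this.2 h)]
    rw [hall p hp, hall q hq, hall r hr, h1]
  · push Not at hne
    rw [flipOn_of_notMem hne.1, flipOn_of_notMem hne.2.1, flipOn_of_notMem hne.2.2]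
    rfl

theorem flipOn_mul_of_subset [DecidableEq (Plaquette L)] {C γ : Finset (Plaquette L)} (h : C ⊆ γ) :
    flipOn C * flipOn γ = flipOn (γ \ C) := by
  funext p
  rw [Pi.mul_apply]
  by_cases h1 : p ∈ C
  · rw [flipOn_of_mem h1, flipOn_of_mem (h h1), flipOn_of_notMem (by simp [h1])]; rfl
  · by_cases h2 : p ∈ γ
    · rw [flipOn_of_notMem h1, flipOn_of_mem h2, flipOn_of_mem (by simp [h1, h2])]; rfl
    · rw [flipOn_of_notMem h1, flipOn_of_notMem h2, flipOn_of_notMem (by simp [h2])]; rfl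

/-- An odd flat set contains a connected odd flat set. -/
theorem exists_connected_odd (m : ℕ) (S : Finset (Plaquette L)) (hS : IsFlat (flipOn S))
    (hodd : lineSign m (flipOn S) = -1) : ∃ γ ⊆ S, IsFlat (flipOn γ) ∧
      lineSign m (flipOn γ) = -1 ∧ ∀ p ∈ γ, ConnectedFrom Adjacent p γ := by
  classical
  induction S using Finset.strongInduction with
  | H S ih =>
    by_cases hconn : ∀ p ∈ S, ConnectedFrom Adjacent p S
    · exact ⟨S, subset_rfl, hS, hodd, hconn⟩
    push Not at hconn
    obtain ⟨p, hp, hnc⟩ := hconn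
    set C := component Adjacent S p with hC
    have hsub : C ⊆ S := component_subset S p
    have hCS : C ≠ S := fun h => hnc (h ▸ connectedFrom_component hp)
    have hCflat : IsFlat (flipOn C) := isFlat_flipOn_component hS p
    have hmul := flipOn_mul_of_subset hsub
    have hDflat : IsFlat (flipOn (S \ C)) := hmul ▸ hCflat.mul hS
    rcases Int.units_eq_one_or (lineSign m (flipOn C)) with h | h
    · have hD : lineSign m (flipOn (S \ C)) = -1 := by rw [← hmul, lineSign_mul, h, hodd]; rfl
      obtain ⟨γ, h1, h2⟩ := ih (S \ C) (Finset.sdiff_ssubset hsub ⟨p, mem_component_self hp⟩)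
        hDflat hD
      exact ⟨γ, h1.trans Finset.sdiff_subset, h2⟩
    · obtain ⟨γ, h1, h2⟩ := ih C (hsub.ssubset_of_ne hCS) hCflat h
      exact ⟨γ, h1.trans hsub, h2⟩

/-- A flat set that meets the defect line in an odd number of plaquettes meets the segments above the
ends of the line not higher than its size, or is at least as large as the torus. -/
theorem exists_root {m : ℕ} (hm : m < L) {γ : Finset (Plaquette L)} (hγ : IsFlat (flipOn γ))
    (hodd : lineSign m (flipOn γ) = -1) :
    (∃ j < L, j + 1 ≤ γ.card ∧ (sideSquare L 0 j ∈ γ ∨ sideSquare L m j ∈ γ)) ∨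
      (L ≤ γ.card ∧ ∃ i < m, lineSquare L i 0 ∈ γ) := by
  have hmem : ∀ j, ∏ i ∈ Finset.range m, flipOn γ (lineSquare L i j) = -1 →
      ∃ i < m, lineSquare L i j ∈ γ := by
    intro j h
    by_contra! hcon
    rw [Finset.prod_eq_one fun i hi => flipOn_of_notMem (hcon i (Finset.mem_range.1 hi))] at h
    exact absurd h (by decide)
  by_cases hL : L ≤ γ.card
  · exact Or.inr ⟨hL, hmem 0 hodd⟩
  left
  by_contra! hcon
  push Not at hL
  obtain ⟨⟨σ, s⟩, hh⟩ := hγ.exists_evenTwist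
  have hp : IsPotential (liftSpin σ s) (flipOn γ) := hh ▸ isPotential_liftSpin σ s
  set Ψ := liftSpin σ s
  have key : ∀ u v : ℤˣ, u * v = 1 → u = v := by decide
  have hodd' : ∀ j ≤ γ.card, Ψ (gridPoint 0 j) * Ψ (gridPoint m j) = -1 := by
    intro j
    induction j with
    | zero => intro _; rw [← hp.prod_lineSquare]; exact hodd
    | succ j ih =>
      intro hj
      obtain ⟨h1, h2⟩ := hcon j (by omega) hj
      have e1 := key _ _ ((hp.sideSquare 0 j).symm.trans (flipOn_of_notMem h1))
      have e2 := key _ _ ((hp.sideSquare m j).symm.trans (flipOn_of_notMem h2))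
      rw [← e1, ← e2]
      exact ih (by omega)
  have hex : ∀ j : ℕ, ∃ i, j ≤ γ.card → i < m ∧ lineSquare L i j ∈ γ := by
    intro j
    by_cases hj : j ≤ γ.card
    · obtain ⟨i, h1, h2⟩ := hmem j (by rw [hp.prod_lineSquare]; exact hodd' j hj)
      exact ⟨i, fun _ => ⟨h1, h2⟩⟩
    · exact ⟨0, fun h => absurd h hj⟩
  choose f hf using hex
  have := Finset.card_le_card_of_injOn (s := Finset.range (γ.card + 1)) (t := γ)
    (fun j => lineSquare L (f j) j)
    (fun j hj => (hf j (by have := Finset.mem_range.1 (Finset.mem_coe.1 hj); omega)).2) (by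
      intro j hj j' hj' h
      have h1 := Finset.mem_range.1 (Finset.mem_coe.1 hj)
      have h2 := Finset.mem_range.1 (Finset.mem_coe.1 hj')
      have f1 := (hf j (by omega)).1
      have f2 := (hf j' (by omega)).1
      exact (lineSquare_inj (by omega) (by omega) (by omega) (by omega) h).2)
  rw [Finset.card_range] at this
  omega

/-- The Boltzmann weight of a configuration of bonds. -/
noncomputable def bondWeight (K : ℝ) (a : Plaquette L → ℤˣ) : ℝ :=
  Real.exp (∑ p, K * ((a p : ℤ) : ℝ))

theorem bondWeight_pos (K : ℝ) (a : Plaquette L → ℤˣ) : 0 < bondWeight K a := Real.exp_pos _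

theorem bondWeight_flip (K : ℝ) {a : Plaquette L → ℤˣ} {γ : Finset (Plaquette L)}
    (h : ∀ p ∈ γ, a p = -1) :
    bondWeight K a = Real.exp (-(2 * K)) ^ γ.card * bondWeight K (a * flipOn γ) := by
  classical
  rw [bondWeight, bondWeight, ← Real.exp_nat_mul, ← Real.exp_add]
  congr 1
  have h1 : ∀ p, K * ((a p : ℤ) : ℝ) = (if p ∈ γ then -(2 * K) else 0) +
      K * (((a * flipOn γ) p : ℤ) : ℝ) := by
    intro p
    rw [Pi.mul_apply]
    by_cases hp : p ∈ γ
    · rw [if_pos hp, flipOn_of_mem hp, h p hp]; simp; ring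
    · rw [if_neg hp, flipOn_of_notMem hp]; simp
  rw [Finset.sum_congr rfl fun p _ => h1 p, Finset.sum_add_distrib, Finset.sum_ite_mem,
    Finset.univ_inter, Finset.sum_const, nsmul_eq_mul]

/-- The even part of the partition function. -/
noncomputable def evenSum (L : ℕ) [NeZero L] (K : ℝ) : ℝ := ∑ h, bondWeight K (evenTwist L h)

theorem evenSum_pos (K : ℝ) : 0 < evenSum L K :=
  Finset.sum_pos (fun _ _ => bondWeight_pos _ _) ⟨1, Finset.mem_univ _⟩

open Classical in
theorem sum_flip_le (K : ℝ) (γ : Finset (Plaquette L)) (hγ : IsFlat (flipOn γ)) :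
    (∑ h, if ∀ p ∈ γ, evenTwist L h p = -1 then bondWeight K (evenTwist L h) else 0) ≤
      Real.exp (-(2 * K)) ^ γ.card * evenSum L K := by
  obtain ⟨h₀, hh₀⟩ := hγ.exists_evenTwist
  have h1 : evenSum L K = ∑ h, bondWeight K (evenTwist L h * flipOn γ) := by
    rw [evenSum, ← Equiv.sum_comp (Equiv.mulRight h₀)]
    simp only [Equiv.coe_mulRight, map_mul, hh₀]
  rw [h1, Finset.mul_sum]
  refine Finset.sum_le_sum fun h _ => ?_
  split_ifs with hh
  · exact (bondWeight_flip K hh).le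
  · exact (mul_pos (pow_pos (Real.exp_pos _) _) (bondWeight_pos _ _)).le

theorem sum_roots_le {q : ℝ} (hq0 : 0 ≤ q) (hq : q ≤ 1 / 2) {m : ℕ} (hm : m < L) :
    ∑ j : Fin L, q ^ ((j : ℕ) + 1) + ∑ j : Fin L, q ^ ((j : ℕ) + 1) + ∑ _i : Fin m, q ^ L ≤
      5 * q := by
  have h1 : ∀ n : ℕ, ∑ j : Fin n, q ^ ((j : ℕ) + 1) ≤ 2 * q * (1 - (1 / 2) ^ n) := by
    intro n
    induction n with
    | zero => simp
    | succ n ih =>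
      rw [Fin.sum_univ_castSucc]
      simp only [Fin.val_castSucc, Fin.val_last]
      have h2 : q ^ n ≤ (1 / 2) ^ n := pow_le_pow_left₀ hq0 hq n
      have h3 := mul_le_mul_of_nonneg_right h2 hq0
      rw [pow_succ q n, pow_succ (1 / 2 : ℝ) n]
      linarith
  have h2 := h1 L
  have h3 : 0 ≤ 2 * q * (1 / 2 : ℝ) ^ L := by positivity
  have h4 : ∑ _i : Fin m, q ^ L ≤ q := by
    obtain ⟨n, rfl⟩ : ∃ n, L = n + 1 := ⟨L - 1, by have := NeZero.pos L; omega⟩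
    rw [Finset.sum_const, Finset.card_univ, Fintype.card_fin, nsmul_eq_mul, pow_succ, ← mul_assoc]
    refine mul_le_of_le_one_left hq0 ?_
    have h5 : q ^ n ≤ (1 / 2) ^ n := pow_le_pow_left₀ hq0 hq n
    have h6 : (m : ℝ) ≤ 2 ^ n := by
      have h7 : m ≤ 2 ^ n := (Nat.lt_succ_iff.1 hm).trans (Nat.lt_two_pow_self).le
      exact_mod_cast h7
    calc (m : ℝ) * q ^ n ≤ 2 ^ n * (1 / 2) ^ n := by gcongr
      _ = 1 := by rw [← mul_pow]; norm_num
  linarith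

open Classical in
/-- At low temperature the sign of the defect line is rarely `-1` in the even sector. -/
theorem peierls_bound {K : ℝ} (hq : Real.exp (-(2 * K)) * 2 ^ 730 ≤ 1 / 2) {m : ℕ} (hm : m < L) :
    (∑ h, if lineSign m (evenTwist L h) = -1 then bondWeight K (evenTwist L h) else 0) ≤
      5 * (Real.exp (-(2 * K)) * 2 ^ 730) * evenSum L K := by
  set t := Real.exp (-(2 * K)) with ht
  have ht0 : 0 ≤ t := (Real.exp_pos _).le
  set q := t * 2 ^ 730 with hqdef
  have hq0 : 0 ≤ q := by positivity
  let root : (Fin L ⊕ Fin L) ⊕ Fin m → Plaquette L :=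
    Sum.elim (Sum.elim (fun j => sideSquare L 0 j) fun j => sideSquare L m j)
      fun i => lineSquare L i 0
  let size : (Fin L ⊕ Fin L) ⊕ Fin m → ℕ :=
    Sum.elim (Sum.elim (fun j => (j : ℕ) + 1) fun j => (j : ℕ) + 1) fun _ => L
  let F : (Fin L ⊕ Fin L) ⊕ Fin m → Finset (Finset (Plaquette L)) := fun x =>
    Finset.univ.filter fun γ => ConnectedFrom Adjacent (root x) γ ∧ size x ≤ γ.card
  let X : Finset (Plaquette L) → (Cell L → ℤˣ) × (Fin 3 → ℤˣ) → ℝ := fun γ h =>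
    if IsFlat (flipOn γ) then
      (if ∀ p ∈ γ, evenTwist L h p = -1 then bondWeight K (evenTwist L h) else 0) else 0
  have hX0 : ∀ γ h, 0 ≤ X γ h := by
    intro γ h
    simp only [X]
    split_ifs
    · exact (bondWeight_pos _ _).le
    · exact le_rfl
    · exact le_rfl
  have hpoint : ∀ h, (if lineSign m (evenTwist L h) = -1 then bondWeight K (evenTwist L h) else 0) ≤
      ∑ x, ∑ γ ∈ F x, X γ h := by
    intro h
    split_ifs with hodd
    · set S : Finset (Plaquette L) := Finset.univ.filter fun p => evenTwist L h p = -1 with hS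
      have hflip : flipOn S = evenTwist L h := by
        funext p
        by_cases hp : evenTwist L h p = -1
        · rw [hp, flipOn_eq_neg_one_iff]; simp [hS, hp]
        · rw [flipOn_of_notMem (by simp [hS, hp])]
          exact ((Int.units_eq_one_or _).resolve_right hp).symm
      obtain ⟨γ, hγS, hflat, hγodd, hconn⟩ := exists_connected_odd m S
        (hflip ▸ isFlat_evenTwist h) (hflip ▸ hodd)
      have hXγ : X γ h = bondWeight K (evenTwist L h) := by
        simp only [X]
        rw [if_pos hflat, if_pos fun p hp => (Finset.mem_filter.1 (hγS hp)).2]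
      have hx : ∃ x, γ ∈ F x := by
        rcases exists_root hm hflat hγodd with ⟨j, hj, hc, hs | hs⟩ | ⟨hc, i, hi, hs⟩
        · exact ⟨Sum.inl (Sum.inl ⟨j, hj⟩), Finset.mem_filter.2 ⟨Finset.mem_univ _, hconn _ hs, hc⟩⟩
        · exact ⟨Sum.inl (Sum.inr ⟨j, hj⟩), Finset.mem_filter.2 ⟨Finset.mem_univ _, hconn _ hs, hc⟩⟩
        · exact ⟨Sum.inr ⟨i, hi⟩, Finset.mem_filter.2 ⟨Finset.mem_univ _, hconn _ hs, hc⟩⟩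
      obtain ⟨x, hx⟩ := hx
      rw [← hXγ]
      exact (Finset.single_le_sum (f := fun γ => X γ h) (fun γ _ => hX0 γ h) hx).trans
        (Finset.single_le_sum (f := fun x => ∑ γ ∈ F x, X γ h)
          (fun x _ => Finset.sum_nonneg fun γ _ => hX0 γ h) (Finset.mem_univ x))
    · exact Finset.sum_nonneg fun x _ => Finset.sum_nonneg fun γ _ => hX0 γ h
  have hγ : ∀ γ, ∑ h, X γ h ≤ t ^ γ.card * evenSum L K := by
    intro γ
    by_cases hflat : IsFlat (flipOn γ)
    · simp only [X, if_pos hflat]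
      exact sum_flip_le K γ hflat
    · simp only [X, if_neg hflat, Finset.sum_const_zero]
      exact (mul_pos (pow_pos (Real.exp_pos _) _) (evenSum_pos K)).le
  calc (∑ h, if lineSign m (evenTwist L h) = -1 then bondWeight K (evenTwist L h) else 0)
      ≤ ∑ h, ∑ x, ∑ γ ∈ F x, X γ h := Finset.sum_le_sum fun h _ => hpoint h
    _ = ∑ x, ∑ γ ∈ F x, ∑ h, X γ h := by
        rw [Finset.sum_comm]
        exact Finset.sum_congr rfl fun x _ => Finset.sum_comm
    _ ≤ ∑ x, ∑ γ ∈ F x, t ^ γ.card * evenSum L K :=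
        Finset.sum_le_sum fun x _ => Finset.sum_le_sum fun γ _ => hγ γ
    _ = (∑ x, ∑ γ ∈ F x, t ^ γ.card) * evenSum L K := by
        simp only [Finset.sum_mul]
    _ ≤ (∑ x, q ^ size x) * evenSum L K := by
        refine mul_le_mul_of_nonneg_right (Finset.sum_le_sum fun x _ => ?_) (evenSum_pos K).le
        exact sum_connected_large_le exists_finset_adjacent (root x) ht0 (hq.trans (by norm_num)) _
    _ ≤ _ := by
        refine mul_le_mul_of_nonneg_right ?_ (evenSum_pos K).le
        rw [Fintype.sum_sum_type, Fintype.sum_sum_type]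
        exact sum_roots_le hq0 hq hm

/-- The expectation of the product of the bonds on the defect line. -/
noncomputable def lineExpectation (L : ℕ) [NeZero L] (m : ℕ) (K : ℝ) : ℝ :=
  (∑ g : TwistGroup L, ((lineChar L m g : ℤ) : ℝ) *
    Real.exp (∑ p, K * ((bondChar p g : ℤ) : ℝ))) /
    ∑ g : TwistGroup L, Real.exp (∑ p, K * ((bondChar p g : ℤ) : ℝ))

theorem evenSum_eq (K : ℝ) : evenSum L K = ∑ s, isingSigned L s 1 K := by
  rw [evenSum, Fintype.sum_prod_type_right]; rfl

theorem frustration_le {K : ℝ} (hK : 0 < K) : frustration K ≤ 6 * Real.exp (-(2 * K)) := by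
  have h0 := tanh_pos hK
  have h1 := Real.tanh_lt_one K
  set t := Real.tanh K with ht
  have h2 : 1 - t ≤ 2 * Real.exp (-(2 * K)) := by
    have hc := Real.cosh_pos K
    have he : Real.exp K ≤ 2 * Real.cosh K := by
      rw [Real.cosh_eq]; linarith [Real.exp_pos (-K)]
    rw [ht, Real.tanh_eq_sinh_div_cosh, one_sub_div hc.ne', Real.cosh_sub_sinh, div_le_iff₀ hc]
    have : Real.exp (-K) = Real.exp (-(2 * K)) * Real.exp K := by
      rw [← Real.exp_add]; congr 1; ring
    rw [this]
    nlinarith [Real.exp_pos (-(2 * K))]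
  have h3 : 1 - t ^ 3 ≤ 3 * (1 - t) := by nlinarith [sq_nonneg (1 - t), mul_pos h0 h0]
  have h4 : 0 < t ^ 3 := pow_pos h0 3
  have h5 : t ^ 3 ≤ 1 := pow_le_one₀ h0.le h1.le
  rw [frustration]
  calc (1 - t ^ 3) / (1 + t ^ 3) ≤ (1 - t ^ 3) / 1 :=
        div_le_div_of_nonneg_left (by linarith) one_pos (by linarith)
    _ ≤ _ := by rw [div_one]; linarith

/-- At low temperature of the dual Ising model the expectation of the defect line does not decay. -/
theorem half_le_lineExpectation {K : ℝ} (hK : 0 < K)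
    (hq : Real.exp (-(2 * K)) * 2 ^ 730 ≤ 1 / 400) {m : ℕ} (hm : m < L) :
    1 / 2 ≤ lineExpectation L m K := by
  classical
  have hqpos : 0 < Real.exp (-(2 * K)) * 2 ^ 730 := by positivity
  have hP := peierls_bound (L := L) (hq.trans (by norm_num)) hm
  have hr : frustration K ≤ 6 * (Real.exp (-(2 * K)) * 2 ^ 730) :=
    (frustration_le hK).trans (mul_le_mul_of_nonneg_left (le_mul_of_one_le_right
      (Real.exp_pos _).le (one_le_pow₀ one_le_two)) (by norm_num))
  generalize Real.exp (-(2 * K)) * 2 ^ 730 = q at hq hqpos hP hr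
  set D := evenSum L K with hD
  have hDpos : 0 < D := evenSum_pos K
  set M := ∑ s, isingSigned L s (-1) K with hM
  have hM8 : M ≤ 1 / 8 * D := by
    have h1 := sum_isingSigned_neg_le (L := L) hK
    rw [← evenSum_eq, ← hD] at h1
    refine h1.trans (mul_le_mul_of_nonneg_right ?_ hDpos.le)
    have h2 : frustration K ^ L ≤ frustration K :=
      pow_le_of_le_one (frustration_nonneg hK) (frustration_lt_one hK).le (NeZero.ne L)
    linarith
  have hM0 : 0 ≤ M := Finset.sum_nonneg fun s _ => (isingSigned_pos _ _ _).le
  have hden : ∑ g : TwistGroup L, Real.exp (∑ p, K * ((bondChar p g : ℤ) : ℝ)) = D + M := by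
    rw [sum_exp_bondChar, Finset.sum_add_distrib, hD, evenSum_eq]
  have hnum : ∑ g : TwistGroup L, ((lineChar L m g : ℤ) : ℝ) *
      Real.exp (∑ p, K * ((bondChar p g : ℤ) : ℝ)) ≥ (D - 10 * q * D) - M := by
    rw [sum_twistGroup, Finset.sum_add_distrib]
    have h1 : ∑ s : Fin 3 → ℤˣ, ∑ σ : Cell L → ℤˣ, ((lineChar L m (σ, s, 1) : ℤ) : ℝ) *
        Real.exp (∑ p, K * ((bondChar p (σ, s, 1) : ℤ) : ℝ)) ≥ D - 10 * q * D := by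
      have h2 : ∑ s : Fin 3 → ℤˣ, ∑ σ : Cell L → ℤˣ, ((lineChar L m (σ, s, 1) : ℤ) : ℝ) *
        Real.exp (∑ p, K * ((bondChar p (σ, s, 1) : ℤ) : ℝ)) =
          ∑ h, ((lineSign m (evenTwist L h) : ℤ) : ℝ) * bondWeight K (evenTwist L h) := by
        rw [Fintype.sum_prod_type_right]
        refine Finset.sum_congr rfl fun s _ => Finset.sum_congr rfl fun σ _ => ?_
        rw [lineChar_eq hm.le]
        rfl
      have h3 : ∑ h, ((lineSign m (evenTwist L h) : ℤ) : ℝ) * bondWeight K (evenTwist L h) =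
          D - 2 * ∑ h, if lineSign m (evenTwist L h) = -1 then bondWeight K (evenTwist L h)
            else 0 := by
        rw [hD, evenSum, Finset.mul_sum, ← Finset.sum_sub_distrib]
        refine Finset.sum_congr rfl fun h _ => ?_
        rcases Int.units_eq_one_or (lineSign m (evenTwist L h)) with e | e
        · rw [e, if_neg (by decide)]; simp
        · rw [e, if_pos rfl]; simp; ring
      rw [h2, h3]
      linarith
    have h4 : ∑ s : Fin 3 → ℤˣ, ∑ σ : Cell L → ℤˣ, ((lineChar L m (σ, s, -1) : ℤ) : ℝ) *
        Real.exp (∑ p, K * ((bondChar p (σ, s, -1) : ℤ) : ℝ)) ≥ -M := by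
      rw [hM, ← Finset.sum_neg_distrib]
      refine Finset.sum_le_sum fun s _ => ?_
      rw [isingSigned, ← Finset.sum_neg_distrib]
      refine Finset.sum_le_sum fun σ _ => ?_
      have h5 : bondWeight K (twist L (σ, s, -1)) =
        Real.exp (∑ p, K * ((bondChar p (σ, s, -1) : ℤ) : ℝ)) := rfl
      have h6 := bondWeight_pos K (twist L (σ, s, -1))
      change -bondWeight K (twist L (σ, s, -1)) ≤ _
      rw [← h5]
      rcases Int.units_eq_one_or (lineChar L m (σ, s, -1)) with e | e <;> rw [e] <;> simp
      linarith
    linarith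
  rw [lineExpectation, hden, le_div_iff₀ (by linarith)]
  nlinarith

end Peierls

/-! ### Decay of correlations at high temperature -/

section Decay

variable {V P : Type*} [Fintype V] [DecidableEq V] [Fintype P]

open Classical in
/-- The spin configurations that agree along the bonds in `E`. -/
noncomputable def agreeing (e : P → V × V) (E : Finset P) : Finset (V → ℤˣ) :=
  Finset.univ.filter fun σ => ∀ p ∈ E, σ (e p).1 = σ (e p).2

theorem mem_agreeing {e : P → V × V} {E : Finset P} {σ : V → ℤˣ} :
    σ ∈ agreeing e E ↔ ∀ p ∈ E, σ (e p).1 = σ (e p).2 := by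
  simp [agreeing]

open Classical in
/-- The random cluster expansion. -/
theorem sum_mul_exp_eq (e : P → V × V) (K : ℝ) (f : (V → ℤˣ) → ℝ) :
    ∑ σ, f σ * ∏ p, Real.exp (K * (((σ (e p).1 * σ (e p).2 : ℤˣ) : ℤ) : ℝ)) =
      Real.exp (-K) ^ Fintype.card P *
        ∑ E : Finset P, (Real.exp (2 * K) - 1) ^ E.card * ∑ σ ∈ agreeing e E, f σ := by
  set v := Real.exp (2 * K) - 1 with hv
  have h1 : ∀ u w : ℤˣ, Real.exp (K * (((u * w : ℤˣ) : ℤ) : ℝ)) =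
      Real.exp (-K) * (1 + if u = w then v else 0) := by
    intro u w
    by_cases h : u = w
    · subst h
      rw [if_pos rfl, Int.units_mul_self, hv, add_sub_cancel, ← Real.exp_add]
      congr 1
      simp; ring
    · have : u * w = -1 := by revert u w; decide
      rw [if_neg h, this]
      simp
  have h2 : ∀ σ : V → ℤˣ, f σ * ∏ p, Real.exp (K * (((σ (e p).1 * σ (e p).2 : ℤˣ) : ℤ) : ℝ)) =
      Real.exp (-K) ^ Fintype.card P *
        ∑ E : Finset P, v ^ E.card * (if σ ∈ agreeing e E then f σ else 0) := by
    intro σ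
    simp only [h1, Finset.prod_mul_distrib, Finset.prod_const, Finset.card_univ,
      Finset.prod_one_add, Finset.powerset_univ]
    rw [mul_left_comm, Finset.mul_sum]
    congr 1
    refine Finset.sum_congr rfl fun E _ => ?_
    by_cases h : σ ∈ agreeing e E
    · rw [if_pos h, Finset.prod_congr rfl fun p hp => if_pos (mem_agreeing.1 h p hp),
        Finset.prod_const, mul_comm]
    · rw [if_neg h, mul_zero]
      rw [mem_agreeing] at h
      push Not at h
      obtain ⟨p, hp, hne⟩ := h
      rw [Finset.prod_eq_zero hp (if_neg hne), mul_zero]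
  simp only [h2]
  rw [← Finset.mul_sum, Finset.sum_comm]
  congr 1
  refine Finset.sum_congr rfl fun E _ => ?_
  rw [← Finset.mul_sum, Finset.sum_ite_mem, Finset.univ_inter]

theorem agreeing_anti (e : P → V × V) {E E' : Finset P} (h : E ⊆ E') :
    agreeing e E' ⊆ agreeing e E :=
  fun _ hσ => mem_agreeing.2 fun p hp => mem_agreeing.1 hσ p (h hp)

/-- If the bonds in `E` do not tie the spins at `x` and `y`, their correlation vanishes. -/
theorem sum_agreeing_eq_zero (e : P → V × V) (E : Finset P) {x y : V} {τ : V → ℤˣ}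
    (hτ : τ ∈ agreeing e E) (hxy : τ x * τ y = -1) :
    ∑ σ ∈ agreeing e E, (((σ x * σ y : ℤˣ) : ℤ) : ℝ) = 0 := by
  have h1 : ∑ σ ∈ agreeing e E, (((σ x * σ y : ℤˣ) : ℤ) : ℝ) =
      ∑ σ ∈ agreeing e E, -(((σ x * σ y : ℤˣ) : ℤ) : ℝ) := by
    have hm : ∀ σ ∈ agreeing e E, σ * τ ∈ agreeing e E := fun σ hσ =>
      mem_agreeing.2 fun p hp => by
        rw [Pi.mul_apply, Pi.mul_apply, mem_agreeing.1 hσ p hp, mem_agreeing.1 hτ p hp]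
    have hττ : τ * τ = 1 := funext fun z => Int.units_mul_self _
    refine Finset.sum_nbij' (fun σ => σ * τ) (fun σ => σ * τ) hm hm ?_ ?_ ?_
    · intro σ _; rw [mul_assoc, hττ, mul_one]
    · intro σ _; rw [mul_assoc, hττ, mul_one]
    · intro σ _
      have : (σ * τ) x * (σ * τ) y = -(σ x * σ y) := by
        rw [Pi.mul_apply, Pi.mul_apply, mul_mul_mul_comm, hxy, mul_neg, mul_one]
      rw [this]
      simp
  rw [Finset.sum_neg_distrib] at h1
  linarith

/-- `x` is an end of the bond `p`. -/
def IsEnd (e : P → V × V) (x : V) (p : P) : Prop := (e p).1 = x ∨ (e p).2 = x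

theorem exists_connecting {e : P → V × V} {adj : P → P → Prop}
    (hadj : ∀ z p q, IsEnd e z p → IsEnd e z q → adj p q) {E : Finset P} {x y : V} (hne : x ≠ y)
    (h : ∀ τ ∈ agreeing e E, τ x * τ y ≠ -1) :
    ∃ p ∈ E, IsEnd e x p ∧ ∃ q ∈ component adj E p, IsEnd e y q := by
  classical
  by_contra! hcon
  let U : V → Prop := fun z => z = x ∨
    ∃ p ∈ E, IsEnd e x p ∧ ∃ q ∈ component adj E p, IsEnd e z q
  have hU : ∀ r ∈ E, ∀ z w, IsEnd e z r → IsEnd e w r → U z → U w := by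
    rintro r hr z w hz hw (rfl | ⟨p, hp, hxp, q, hq, hzq⟩)
    · exact Or.inr ⟨r, hr, hz, r, mem_component_self hr, hw⟩
    · exact Or.inr ⟨p, hp, hxp, r, mem_component_of_adj hq hr (hadj z q r hzq hz), hw⟩
  let τ : V → ℤˣ := fun z => if U z then -1 else 1
  have hτ : τ ∈ agreeing e E := by
    rw [mem_agreeing]
    intro r hr
    have : U (e r).1 ↔ U (e r).2 :=
      ⟨hU r hr _ _ (Or.inl rfl) (Or.inr rfl), hU r hr _ _ (Or.inr rfl) (Or.inl rfl)⟩
    simp only [τ, this]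
  have hx : τ x = -1 := if_pos (Or.inl rfl)
  have hy : τ y = 1 := by
    refine if_neg ?_
    rintro (h' | ⟨p, hp, hxp, q, hq, hyq⟩)
    · exact hne h'.symm
    · exact hcon p hp hxp q hq hyq
  exact h τ hτ (by rw [hx, hy]; rfl)

theorem correlation_le {e : P → V × V} {adj : P → P → Prop} {D : ℕ}
    (hD : ∀ a : P, ∃ s : Finset P, s.card ≤ D ∧ ∀ b, adj a b → b ∈ s)
    (hadj : ∀ z p q, IsEnd e z p → IsEnd e z q → adj p q) {x y : V} (hne : x ≠ y)
    {s : Finset P} (hs : ∀ p, IsEnd e x p → p ∈ s) {d : ℕ}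
    (hd : ∀ p q γ, IsEnd e x p → IsEnd e y q → ConnectedFrom adj p γ → q ∈ γ → d ≤ γ.card)
    {K : ℝ} (hK : 0 ≤ K) (hv : (Real.exp (2 * K) - 1) * 2 ^ (D + 1) ≤ 1) :
    ∑ σ : V → ℤˣ, (((σ x * σ y : ℤˣ) : ℤ) : ℝ) *
        ∏ p, Real.exp (K * (((σ (e p).1 * σ (e p).2 : ℤˣ) : ℤ) : ℝ)) ≤
      (s.card * ((Real.exp (2 * K) - 1) * 2 ^ (D + 1)) ^ d) * graphIsing e K := by
  classical
  set v := Real.exp (2 * K) - 1 with hvdef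
  have hv0 : 0 ≤ v := sub_nonneg.2 (Real.one_le_exp (by linarith))
  have hG : graphIsing e K = Real.exp (-K) ^ Fintype.card P *
      ∑ E : Finset P, v ^ E.card * ((agreeing e E).card : ℝ) := by
    have := sum_mul_exp_eq e K fun _ => 1
    simpa [graphIsing] using this
  rw [sum_mul_exp_eq, hG, mul_left_comm]
  refine mul_le_mul_of_nonneg_left ?_ (by positivity)
  set W : Finset P → ℝ := fun E => v ^ E.card * ((agreeing e E).card : ℝ) with hW
  have hW0 : ∀ E, 0 ≤ W E := fun E => by positivity
  let F : P → Finset (Finset P) := fun p =>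
    Finset.univ.filter fun γ => ConnectedFrom adj p γ ∧ d ≤ γ.card
  let X : Finset P → Finset P → ℝ := fun γ E => if γ ⊆ E then v ^ γ.card * W (E \ γ) else 0
  have hX0 : ∀ γ E, 0 ≤ X γ E := by
    intro γ E
    simp only [X]
    split_ifs
    · exact mul_nonneg (pow_nonneg hv0 _) (hW0 _)
    · exact le_rfl
  have hpoint : ∀ E : Finset P, v ^ E.card * ∑ σ ∈ agreeing e E, (((σ x * σ y : ℤˣ) : ℤ) : ℝ) ≤
      ∑ p ∈ s, ∑ γ ∈ F p, X γ E := by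
    intro E
    by_cases h : ∀ τ ∈ agreeing e E, τ x * τ y ≠ -1
    · obtain ⟨p, hp, hxp, q, hq, hyq⟩ := exists_connecting hadj hne h
      set γ := component adj E p with hγ
      have hconn := connectedFrom_component (adj := adj) hp
      have hsub : γ ⊆ E := component_subset E p
      have h1 : v ^ E.card * ∑ σ ∈ agreeing e E, (((σ x * σ y : ℤˣ) : ℤ) : ℝ) ≤ X γ E := by
        simp only [X, if_pos hsub, hW]
        rw [← mul_assoc, ← pow_add, add_comm γ.card, Finset.card_sdiff_add_card_eq_card hsub]
        refine mul_le_mul_of_nonneg_left ?_ (by positivity)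
        refine le_trans (Finset.sum_le_card_nsmul _ _ 1 fun σ _ => ?_) ?_
        · rcases Int.units_eq_one_or (σ x * σ y) with e | e <;> rw [e] <;> simp
        · rw [nsmul_eq_mul, mul_one]
          exact_mod_cast Finset.card_le_card (agreeing_anti e Finset.sdiff_subset)
      refine h1.trans ?_
      have hF : γ ∈ F p := Finset.mem_filter.2 ⟨Finset.mem_univ _, hconn, hd p q γ hxp hyq hconn hq⟩
      exact (Finset.single_le_sum (f := fun γ => X γ E) (fun γ _ => hX0 γ E) hF).trans
        (Finset.single_le_sum (f := fun p => ∑ γ ∈ F p, X γ E)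
          (fun p _ => Finset.sum_nonneg fun γ _ => hX0 γ E) (hs p hxp))
    · push Not at h
      obtain ⟨τ, hτ, hxy⟩ := h
      rw [sum_agreeing_eq_zero e E hτ hxy, mul_zero]
      exact Finset.sum_nonneg fun p _ => Finset.sum_nonneg fun γ _ => hX0 γ E
  have hγ : ∀ γ, ∑ E, X γ E ≤ v ^ γ.card * ∑ E, W E := by
    intro γ
    simp only [X]
    rw [← Finset.sum_filter, ← Finset.mul_sum]
    refine mul_le_mul_of_nonneg_left ?_ (pow_nonneg hv0 _)
    rw [← Finset.sum_image (f := W) (g := fun E => E \ γ)]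
    · exact Finset.sum_le_sum_of_subset_of_nonneg (Finset.subset_univ _) fun E _ _ => hW0 E
    · intro E hE E' hE' h
      have h1 := (Finset.mem_filter.1 (Finset.mem_coe.1 hE)).2
      have h2 := (Finset.mem_filter.1 (Finset.mem_coe.1 hE')).2
      rw [← Finset.sdiff_union_of_subset h1, ← Finset.sdiff_union_of_subset h2]
      exact congrArg (· ∪ γ) h
  have hWs : 0 ≤ ∑ E, W E := Finset.sum_nonneg fun E _ => hW0 E
  calc ∑ E, v ^ E.card * ∑ σ ∈ agreeing e E, (((σ x * σ y : ℤˣ) : ℤ) : ℝ)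
      ≤ ∑ E, ∑ p ∈ s, ∑ γ ∈ F p, X γ E := Finset.sum_le_sum fun E _ => hpoint E
    _ = ∑ p ∈ s, ∑ γ ∈ F p, ∑ E, X γ E := by
        rw [Finset.sum_comm]
        exact Finset.sum_congr rfl fun p _ => Finset.sum_comm
    _ ≤ ∑ p ∈ s, ∑ γ ∈ F p, v ^ γ.card * ∑ E, W E :=
        Finset.sum_le_sum fun p _ => Finset.sum_le_sum fun γ _ => hγ γ
    _ = (∑ p ∈ s, ∑ γ ∈ F p, v ^ γ.card) * ∑ E, W E := by
        simp only [Finset.sum_mul]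
    _ ≤ (∑ _p ∈ s, (v * 2 ^ (D + 1)) ^ d) * ∑ E, W E :=
        mul_le_mul_of_nonneg_right (Finset.sum_le_sum fun p _ =>
          sum_connected_large_le hD p hv0 hv d) hWs
    _ = _ := by rw [Finset.sum_const, nsmul_eq_mul]

end Decay

section LineDecay

variable {L : ℕ} [NeZero L]

/-- The cell at `(4i, 0, 0)`. -/
def lineCell (L : ℕ) (i : ℕ) : Cell L :=
  ⟨toPoint L (gridPoint i 0), by simp only [res_toPoint]; exact isCellZ_gridPoint i 0⟩

theorem lineChar_spin {m : ℕ} (hm : m ≤ L) (σ : Cell L → ℤˣ) :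
    lineChar L m (σ, 1, 1) = σ (lineCell L 0) * σ (lineCell L m) := by
  have h : ∀ i, liftSpin σ 1 (gridPoint i 0) = σ (lineCell L i) := by
    intro i
    have hc : (∀ l, res (toPoint L (gridPoint i 0)) l = 0) ∨
        ∀ l, res (toPoint L (gridPoint i 0)) l = 2 := (lineCell L i).2
    rw [liftSpin, dif_pos hc]
    simp only [Pi.one_apply, one_zpow, Finset.prod_const_one, mul_one]
    rfl
  rw [lineChar_eq hm, lineSign, (isPotential_liftSpin σ 1).prod_lineSquare, h, h]

theorem posType_char {G : Type*} [CommGroup G] (χ : G →* ℤˣ) :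
    PosType fun g => ((χ g : ℤ) : ℝ) := by
  simpa using PosType.char 1 zero_le_one χ

theorem dominated_sign {G : Type*} [CommGroup G] (u : ℤˣ) (χ : G →* ℤˣ) :
    Dominated (fun g => (((u * χ g : ℤˣ) : ℤ) : ℝ)) fun g => ((χ g : ℤ) : ℝ) := by
  have h0 : PosType fun _ : G => (0 : ℝ) := .const le_rfl
  have h2 : PosType fun g : G => 2 * ((χ g : ℤ) : ℝ) := .char _ (by norm_num) _
  rcases Int.units_eq_one_or u with rfl | rfl
  · constructor
    · simpa using h0
    · simpa [two_mul] using h2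
  · constructor
    · simpa [two_mul] using h2
    · simpa using h0

theorem lineExpectation_le_correlation {m : ℕ} (hm : m ≤ L) {K : ℝ} (hK : 0 ≤ K) :
    lineExpectation L m K ≤ 16 * ((∑ σ : Cell L → ℤˣ,
      (((σ (lineCell L 0) * σ (lineCell L m) : ℤˣ) : ℤ) : ℝ) *
        ∏ p : Plaquette L, Real.exp (K * (((σ (bondEnds p).1 * σ (bondEnds p).2 : ℤˣ) : ℤ) : ℝ))) /
          graphIsing (bondEnds (L := L)) K) := by
  set N := ∑ σ : Cell L → ℤˣ, (((σ (lineCell L 0) * σ (lineCell L m) : ℤˣ) : ℤ) : ℝ) *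
        ∏ p : Plaquette L, Real.exp (K * (((σ (bondEnds p).1 * σ (bondEnds p).2 : ℤˣ) : ℤ) : ℝ))
    with hN
  have hterm : ∀ s η, ∑ σ : Cell L → ℤˣ, ((lineChar L m (σ, s, η) : ℤ) : ℝ) *
      Real.exp (∑ p, K * ((bondChar p (σ, s, η) : ℤ) : ℝ)) ≤ N := by
    intro s η
    have hsplit : ∀ σ : Cell L → ℤˣ, lineChar L m (σ, s, η) = lineChar L m (1, s, η) *
        pairChar (lineCell L 0) (lineCell L m) σ := by
      intro σ
      have h1 : (σ, s, η) = (1, s, η) * (σ, 1, 1) := by simp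
      rw [h1, map_mul, lineChar_spin hm]
      rfl
    have hb : ∀ (σ : Cell L → ℤˣ) (p : Plaquette L), bondChar p (σ, s, η) =
        squareSign η p * bondSign s p * spinChar p σ := by
      intro σ p
      have : ∀ u v w z : ℤˣ, u * (v * w * z) = u * v * (w * z) := by decide
      rw [bondChar_apply, twist_apply, this]
      rfl
    have hsum : ∀ σ : Cell L → ℤˣ, ((lineChar L m (σ, s, η) : ℤ) : ℝ) *
        Real.exp (∑ p, K * ((bondChar p (σ, s, η) : ℤ) : ℝ)) =
        ((lineChar L m (1, s, η) * pairChar (lineCell L 0) (lineCell L m) σ : ℤˣ) : ℤ) *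
          ∏ p, Real.exp (K * ((squareSign η p * bondSign s p * spinChar p σ : ℤˣ) : ℤ)) := by
      intro σ
      rw [hsplit σ]
      simp only [hb, Real.exp_sum]
    rw [Finset.sum_congr rfl fun σ _ => hsum σ]
    exact (le_abs_self _).trans (Dominated.abs_sum_le ((dominated_sign _ _).mul
      (.prod _ fun p _ => dominated_exp hK _ (spinChar p))))
  have hN0 : 0 ≤ N := by
    have hp : PosType fun σ : Cell L → ℤˣ =>
        ((pairChar (lineCell L 0) (lineCell L m) σ : ℤ) : ℝ) *
        ∏ p : Plaquette L, Real.exp (K * ((spinChar p σ : ℤ) : ℝ)) := by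
      refine PosType.mul ?_ (.prod _ fun p _ => .exp_char hK _)
      exact posType_char _
    exact hp.sum_nonneg
  have hI : graphIsing (bondEnds (L := L)) K ≤
      ∑ g : TwistGroup L, Real.exp (∑ p, K * ((bondChar p g : ℤ) : ℝ)) := by
    rw [← isingPartition_eq_graphIsing, sum_exp_bondChar, Finset.sum_add_distrib]
    exact (isingPartition_le_sum K).trans (le_add_of_nonneg_right
      (Finset.sum_nonneg fun s _ => (isingSigned_pos _ _ _).le))
  have hI0 : 0 < graphIsing (bondEnds (L := L)) K := by
    rw [← isingPartition_eq_graphIsing]; exact isingPartition_pos K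
  have hnum : ∑ g : TwistGroup L, ((lineChar L m g : ℤ) : ℝ) *
      Real.exp (∑ p, K * ((bondChar p g : ℤ) : ℝ)) ≤ 16 * N := by
    rw [sum_twistGroup]
    refine (Finset.sum_le_sum fun s _ => add_le_add (hterm s 1) (hterm s (-1))).trans_eq ?_
    rw [Finset.sum_const, Finset.card_univ, card_units_fun, nsmul_eq_mul]
    push_cast; ring
  rw [lineExpectation, ← mul_div_assoc]
  exact div_le_div₀ (by positivity) hnum hI0 hI

omit [NeZero L] in
theorem natAbs_valMinAbs_intCast_le (n : ℕ) [NeZero n] (d : ℤ) :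
    ((d : ZMod n).valMinAbs).natAbs ≤ d.natAbs := by
  exact ZMod.natAbs_min_of_le_div_two n _ _ (ZMod.coe_valMinAbs _) (ZMod.natAbs_valMinAbs_le _)

/-- The distance from the plane through the origin, in units of the cell. -/
def heightOf (p : Plaquette L) : ℕ := ((center p 0).valMinAbs).natAbs / 4

theorem heightOf_le_of_adjacent {p q : Plaquette L} (h : Adjacent p q) :
    heightOf q ≤ heightOf p + 1 := by
  obtain ⟨d, hd, e⟩ := h
  have h1 : center q 0 = center p 0 + ((d 0 : ℤ) : ZMod (4 * L)) := by rw [e]; rfl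
  have h2 := ZMod.natAbs_valMinAbs_add_le (center p 0) ((d 0 : ℤ) : ZMod (4 * L))
  have h3 := natAbs_valMinAbs_intCast_le (4 * L) (d 0)
  have h4 : (d 0).natAbs ≤ 4 := by
    have := hd 0
    rw [← Int.natCast_natAbs] at this
    exact_mod_cast this
  rw [heightOf, heightOf, h1]
  omega

theorem near_of_isEnd {c : Cell L} {p : Plaquette L} (h : IsEnd bondEnds c p) : Near c.1 p := by
  rcases h with rfl | rfl
  · exact near_cellAbove p
  · exact near_cellBelow p

theorem heightOf_near_zero {p : Plaquette L} (h : Near (lineCell L 0).1 p) : heightOf p = 0 := by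
  obtain ⟨d, hd, e⟩ := h
  have h1 : center p 0 = ((d 0 : ℤ) : ZMod (4 * L)) := by
    rw [e]; simp [lineCell, toPoint, gridPoint]
  have h3 := natAbs_valMinAbs_intCast_le (4 * L) (d 0)
  have h4 : (d 0).natAbs ≤ 2 := by
    have := hd 0
    rw [← Int.natCast_natAbs] at this
    exact_mod_cast this
  rw [heightOf, h1]
  omega

omit [NeZero L] in
theorem le_heightOf_near {m : ℕ} (hm : 1 ≤ m) (hL : 2 * m + 1 ≤ L) {p : Plaquette L}
    (h : Near (lineCell L m).1 p) : m - 1 ≤ heightOf p := by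
  obtain ⟨d, hd, e⟩ := h
  have h2 := abs_le.1 (hd 0)
  obtain ⟨n, hn⟩ : ∃ n : ℕ, (n : ℤ) = 4 * m + d 0 := ⟨(4 * m + d 0).toNat, by omega⟩
  have h1 : center p 0 = ((n : ℕ) : ZMod (4 * L)) := by
    have h3 : ((n : ℤ) : ZMod (4 * L)) = ((4 * m + d 0 : ℤ) : ZMod (4 * L)) := by rw [hn]
    push_cast at h3
    rw [e, h3]; simp [lineCell, toPoint, gridPoint]
  rw [heightOf, h1, ZMod.valMinAbs_natCast_of_le_half (by omega)]
  omega

omit [NeZero L] in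
theorem lineCell_ne {m : ℕ} (hm : 1 ≤ m) (hL : m < L) : lineCell L 0 ≠ lineCell L m := by
  intro h
  have h1 : toPoint L (gridPoint 0 0) 0 = toPoint L (gridPoint m 0) 0 := by
    have := congrArg (fun c : Cell L => c.1 0) h
    exact this
  have h2 : ((0 : ℕ) : ZMod (4 * L)) = ((4 * m : ℕ) : ZMod (4 * L)) := by
    simpa [toPoint, gridPoint] using h1
  replace h2 := congrArg ZMod.val h2
  rw [ZMod.val_natCast_of_lt (by omega), ZMod.val_natCast_of_lt (by omega)] at h2
  omega

/-- At high temperature of the dual Ising model the expectation of the defect line decays. -/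
theorem lineExpectation_le {m : ℕ} (hm : 1 ≤ m) (hL : 2 * m + 1 ≤ L) {K : ℝ} (hK : 0 ≤ K)
    (hv : (Real.exp (2 * K) - 1) * 2 ^ 730 ≤ 1 / 2) :
    lineExpectation L m K ≤ 11664 * (1 / 2) ^ m := by
  obtain ⟨s, hs, hs'⟩ := exists_finset_near (lineCell L 0).1
  have hv0 : 0 ≤ (Real.exp (2 * K) - 1) * 2 ^ 730 :=
    mul_nonneg (sub_nonneg.2 (Real.one_le_exp (by linarith))) (by positivity)
  have h1 := correlation_le (e := bondEnds (L := L)) (adj := Adjacent) exists_finset_adjacent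
    (fun z p q hp hq => (near_of_isEnd hp).adjacent (near_of_isEnd hq))
    (lineCell_ne hm (by omega)) (fun p hp => hs' p (near_of_isEnd hp)) (d := m)
    (fun p q γ hp hq hγ hqγ => by
      have h2 := hγ.height_le hqγ heightOf fun a b hab => heightOf_le_of_adjacent hab
      rw [heightOf_near_zero (near_of_isEnd hp)] at h2
      have h3 := le_heightOf_near hm hL (near_of_isEnd hq)
      omega) hK (hv.trans (by norm_num))
  have hI0 : 0 < graphIsing (bondEnds (L := L)) K := by
    rw [← isingPartition_eq_graphIsing]; exact isingPartition_pos K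
  rw [← div_le_iff₀ hI0] at h1
  refine (lineExpectation_le_correlation (by omega) hK).trans ?_
  have h2 : (s.card : ℝ) * ((Real.exp (2 * K) - 1) * 2 ^ 730) ^ m ≤ 729 * (1 / 2) ^ m := by
    have h3 : (s.card : ℝ) ≤ 729 := by exact_mod_cast hs
    exact mul_le_mul h3 (pow_le_pow_left₀ hv0 hv m) (pow_nonneg hv0 m) (by norm_num)
  have h4 := h1.trans h2
  generalize (1 / 2 : ℝ) ^ m = z at h4 ⊢
  clear h1 h2 hv0 hv
  linarith

end LineDecay

/-! ### The phase transition -/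

section Transition

theorem dominated_const_add {G : Type*} [CommGroup G] {a c : ℝ} (ha : 0 ≤ a) (hc : 0 ≤ c)
    (χ : G →* ℤˣ) : Dominated (fun _ => a) fun g => a + c * ((χ g : ℤ) : ℝ) := by
  constructor
  · simpa using PosType.char c hc χ
  · convert PosType.add _ _ (PosType.const (G := G) (add_nonneg ha ha)) (PosType.char c hc χ)
      using 2 with g
    ring

variable {L : ℕ} [NeZero L]

open Classical in
theorem lineExpectation_pos (m : ℕ) {K : ℝ} (hK : 0 < K) : 0 < lineExpectation L m K := by
  have hs := Real.sinh_pos_iff.2 hK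
  have hc := Real.cosh_pos K
  refine div_pos ?_ (Finset.sum_pos (fun _ _ => Real.exp_pos _) ⟨1, Finset.mem_univ _⟩)
  set b : Plaquette L → ℝ := fun p => if OnDefectLine m p then Real.sinh K else Real.cosh K with hb
  have hbpos : ∀ p, 0 < b p := fun p => by simp only [hb]; split_ifs <;> assumption
  have hdom : Dominated (fun _ : TwistGroup L => ∏ p, b p) fun g => ∏ p : Plaquette L,
      ((((if OnDefectLine m p then bondChar p g else 1 : ℤˣ) : ℤ) : ℝ) *
        Real.exp (K * ((bondChar p g : ℤ) : ℝ))) := by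
    refine Dominated.prod _ fun p _ => ?_
    by_cases h : OnDefectLine m p
    · have hf : (fun g : TwistGroup L => (((if OnDefectLine m p then bondChar p g else 1 : ℤˣ) : ℤ) : ℝ) *
          Real.exp (K * ((bondChar p g : ℤ) : ℝ))) =
          fun g => Real.sinh K + Real.cosh K * ((bondChar p g : ℤ) : ℝ) := by
        funext g
        rw [if_pos h, exp_mul_sign]
        rcases Int.units_eq_one_or (bondChar p g) with e | e <;> rw [e] <;> simp
      rw [hf, show b p = Real.sinh K from if_pos h]
      exact dominated_const_add hs.le hc.le _
    · have hf : (fun g : TwistGroup L => (((if OnDefectLine m p then bondChar p g else 1 : ℤˣ) : ℤ) : ℝ) *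
          Real.exp (K * ((bondChar p g : ℤ) : ℝ))) =
          fun g => Real.cosh K + Real.sinh K * ((bondChar p g : ℤ) : ℝ) := by
        funext g
        rw [if_neg h, exp_mul_sign]
        simp
      rw [hf, show b p = Real.cosh K from if_neg h]
      exact dominated_const_add hc.le hs.le _
  have h1 := (le_abs_self _).trans hdom.abs_sum_le
  refine lt_of_lt_of_le ?_ (h1.trans_eq (Finset.sum_congr rfl fun g _ => ?_))
  · exact Finset.sum_pos (fun _ _ => Finset.prod_pos fun p _ => hbpos p) ⟨1, Finset.mem_univ _⟩
  · rw [Finset.prod_mul_distrib, Real.exp_sum, lineChar_apply]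
    simp only [bondChar_apply]
    push_cast
    rfl

theorem lineExpectation_mono (m : ℕ) {K K' : ℝ} (hK : 0 ≤ K) (hKK' : K ≤ K') :
    lineExpectation L m K ≤ lineExpectation L m K' :=
  expectation_mono bondChar (lineChar L m) hK hKK'

theorem defectFreeEnergy_eq (m : ℕ) {β J : ℝ} (hx : 0 < β * J) :
    defectFreeEnergy L m β J =
      -(1 / β) * Real.log (lineExpectation L m (dualCoupling (β * J))) := by
  have hC := dualityConstant_pos (L := L) hx
  rw [defectFreeEnergy, partitionFunction_defect m hx, partitionFunction_const hx,
    mul_div_mul_left _ _ hC.ne', lineExpectation]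

theorem dualCoupling_anti {x y : ℝ} (hx : 0 < x) (hxy : x ≤ y) :
    dualCoupling y ≤ dualCoupling x := by
  have h1 : Real.tanh x ≤ Real.tanh y := by
    rw [Real.tanh_eq_sinh_div_cosh, Real.tanh_eq_sinh_div_cosh,
      div_le_div_iff₀ (Real.cosh_pos x) (Real.cosh_pos y)]
    have h := Real.sinh_nonneg_iff.2 (sub_nonneg.2 hxy)
    rw [Real.sinh_sub] at h
    linarith
  have h2 := Real.log_le_log (tanh_pos hx) h1
  rw [dualCoupling, dualCoupling]
  linarith

/-- The inverse temperatures (times the coupling) at which the defect line does not decay. -/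
def nonDecaying : Set ℝ :=
  {x | 0 < x ∧ ∃ c > 0, ∀ (L : ℕ) [NeZero L] (m : ℕ), m < L →
    c ≤ lineExpectation L m (dualCoupling x)}

theorem mem_nonDecaying_of_le {x y : ℝ} (hx : 0 < x) (hxy : x ≤ y) (hy : y ∈ nonDecaying) :
    x ∈ nonDecaying := by
  obtain ⟨hy0, c, hc, h⟩ := hy
  refine ⟨hx, c, hc, fun L _ m hm => (h L m hm).trans ?_⟩
  exact lineExpectation_mono m (dualCoupling_pos hy0).le (dualCoupling_anti hx hxy)

theorem nonDecaying_nonempty : nonDecaying.Nonempty := by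
  have h1 : Tendsto (fun K : ℝ => Real.exp (-(2 * K)) * 2 ^ 730) atTop (𝓝 (0 * 2 ^ 730)) := by
    refine Tendsto.mul_const _ ?_
    exact Real.tendsto_exp_neg_atTop_nhds_zero.comp (tendsto_id.const_mul_atTop two_pos)
  rw [zero_mul] at h1
  obtain ⟨K, hK, hK0⟩ := ((h1.eventually (gt_mem_nhds (show (0 : ℝ) < 1 / 400 by norm_num))).and
    (eventually_gt_atTop 0)).exists
  refine ⟨dualCoupling K, dualCoupling_pos hK0, 1 / 2, by norm_num, fun L _ m hm => ?_⟩
  rw [dualCoupling_dualCoupling hK0]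
  exact half_le_lineExpectation hK0 hK.le hm

theorem nonDecaying_bddAbove : BddAbove nonDecaying := by
  have h1 : Tendsto (fun K : ℝ => (Real.exp (2 * K) - 1) * 2 ^ 730) (𝓝[>] 0) (𝓝 0) := by
    have h2 : Continuous fun K : ℝ => (Real.exp (2 * K) - 1) * 2 ^ 730 := by fun_prop
    have h3 := h2.tendsto 0
    rw [mul_zero, Real.exp_zero, sub_self, zero_mul] at h3
    exact h3.mono_left nhdsWithin_le_nhds
  obtain ⟨K, hK, hK0⟩ := ((h1.eventually (gt_mem_nhds (show (0 : ℝ) < 1 / 2 by norm_num))).and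
    self_mem_nhdsWithin).exists
  have hK0' : 0 < K := hK0
  refine ⟨dualCoupling K, fun x hx => ?_⟩
  by_contra! hlt
  obtain ⟨-, c, hc, h⟩ := mem_nonDecaying_of_le (dualCoupling_pos hK0') hlt.le hx
  rw [dualCoupling_dualCoupling hK0'] at h
  have h2 : Tendsto (fun m : ℕ => 11664 * (1 / 2 : ℝ) ^ (m + 1)) atTop (𝓝 (11664 * 0)) :=
    ((tendsto_pow_atTop_nhds_zero_of_lt_one (by norm_num) (by norm_num)).comp
      (tendsto_add_atTop_nat 1)).const_mul _
  rw [mul_zero] at h2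
  obtain ⟨m, hm⟩ := (h2.eventually (gt_mem_nhds hc)).exists
  have h3 := h (2 * (m + 1) + 1) (m + 1) (by omega)
  exact absurd (h3.trans (lineExpectation_le (by omega) le_rfl hK0'.le hK.le)) (not_le.2 hm)

theorem exists_critical :
    ∃ x_c : ℝ, 0 < x_c ∧ ∀ β J : ℝ, 0 < β → 0 < J →
      (β * J < x_c →
        ∃ B : ℝ, ∀ (L : ℕ) [NeZero L] (m : ℕ), m < L → defectFreeEnergy L m β J ≤ B) ∧
      (x_c < β * J →
        ∀ B : ℝ, ∃ (L : ℕ) (_ : NeZero L) (m : ℕ), m < L ∧ B < defectFreeEnergy L m β J) := by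
  obtain ⟨x₀, hx₀⟩ := nonDecaying_nonempty
  refine ⟨sSup nonDecaying, hx₀.1.trans_le (le_csSup nonDecaying_bddAbove hx₀),
    fun β J hβ hJ => ⟨fun hlt => ?_, fun hlt B => ?_⟩⟩
  · have hx := mul_pos hβ hJ
    obtain ⟨y, hy, hxy⟩ := exists_lt_of_lt_csSup nonDecaying_nonempty hlt
    obtain ⟨-, c, hc, h⟩ := mem_nonDecaying_of_le hx hxy.le hy
    refine ⟨-(1 / β) * Real.log c, fun L _ m hm => ?_⟩
    rw [defectFreeEnergy_eq m hx]
    exact mul_le_mul_of_nonpos_left (Real.log_le_log hc (h L m hm))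
      (neg_nonpos.2 (one_div_pos.2 hβ).le)
  · have hx := mul_pos hβ hJ
    by_contra! hcon
    have hmem : β * J ∈ nonDecaying := by
      refine ⟨hx, Real.exp (-(β * B)), Real.exp_pos _, fun L _ m hm => ?_⟩
      have h1 := hcon L inferInstance m hm
      rw [defectFreeEnergy_eq m hx] at h1
      rw [← Real.le_log_iff_exp_le (lineExpectation_pos m (dualCoupling_pos hx))]
      have h2 := mul_le_mul_of_nonneg_left h1 hβ.le
      rw [← mul_assoc, mul_neg, mul_one_div_cancel hβ.ne'] at h2
      linarith
    exact absurd (le_csSup nonDecaying_bddAbove hmem) (not_le.2 hlt)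

end Transition

end BitruncatedCubic

theorem mainTheorem1 :
    -- finite volume: duality with the periodic Ising model up to a bounded factor
    (∀ (L : ℕ) [NeZero L] (β J : ℝ), 0 < β → 0 < J →
      dualityConstant L (β * J) * isingPartition L (dualCoupling (β * J))
          ≤ partitionFunction L β (fun _ => J) ∧
      partitionFunction L β (fun _ => J)
          ≤ 16 * (dualityConstant L (β * J) * isingPartition L (dualCoupling (β * J)))) ∧
    -- thermodynamic limit: the duality, with the boundary conditions summed over, becomes exact
    (∀ β J : ℝ, 0 < β → 0 < J →
      Tendsto (fun L : ℕ => partitionFunction (L + 1) β (fun _ => J) /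
          (dualityConstant (L + 1) (β * J) *
            ∑ s : Fin 3 → ℤˣ, isingTwisted (L + 1) s (dualCoupling (β * J))))
        atTop (𝓝 1)) ∧
    -- thermodynamic limit: duality of the pressures per 3-cell, and of their singularities
    (∃ φ ψ : ℝ → ℝ,
      (∀ K : ℝ, 0 < K →
        Tendsto (fun L : ℕ => Real.log (isingPartition (L + 1) K) / (2 * ((L : ℝ) + 1) ^ 3))
          atTop (𝓝 (ψ K))) ∧
      (∀ β J : ℝ, 0 < β → 0 < J →
        Tendsto (fun L : ℕ =>
            Real.log (partitionFunction (L + 1) β (fun _ => J)) / (2 * ((L : ℝ) + 1) ^ 3))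
          atTop (𝓝 (φ (β * J)))) ∧
      (∀ x : ℝ, 0 < x →
        φ x = 6 * Real.log 2 + 7 / 2 * Real.log (Real.sinh (2 * x) / 2) + ψ (dualCoupling x)) ∧
      (∀ x : ℝ, 0 < x → (AnalyticAt ℝ φ x ↔ AnalyticAt ℝ ψ (dualCoupling x)))) ∧
    -- phase transition at a finite positive critical temperature
    (∃ x_c : ℝ, 0 < x_c ∧ ∀ β J : ℝ, 0 < β → 0 < J →
      (β * J < x_c →
        ∃ B : ℝ, ∀ (L : ℕ) [NeZero L] (m : ℕ), m < L → defectFreeEnergy L m β J ≤ B) ∧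
      (x_c < β * J →
        ∀ B : ℝ, ∃ (L : ℕ) (_ : NeZero L) (m : ℕ), m < L ∧ B < defectFreeEnergy L m β J)) := by
  classical
  refine ⟨fun L _ β J hβ hJ => finite_volume_duality (mul_pos hβ hJ),
    fun β J hβ hJ => tendsto_duality (mul_pos hβ hJ), ?_, exists_critical⟩
  choose! ψ hψ using fun (K : ℝ) (hK : 0 < K) => exists_tendsto_log_isingPartition hK
  refine ⟨fun x => 6 * Real.log 2 + 7 / 2 * Real.log (Real.sinh (2 * x) / 2) + ψ (dualCoupling x),
    ψ, hψ, fun β J hβ hJ => ?_, fun _ _ => rfl, fun x hx => ?_⟩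
  · have hx := mul_pos hβ hJ
    exact tendsto_log_partitionFunction hx (hψ _ (dualCoupling_pos hx))
  · exact analyticAt_add_comp_dualCoupling_iff (fun _ h => analyticAt_log_sinh h) hx
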